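/- Let $q\in\mathbb C\setminus\{0\}$. Let $A=\widetilde{\mathcal O}_q(\mathrm{GL}(2))$ be the Hopf algebra over $\mathbb C$ with generators $a,b,c,d,D^{-1}$ and relations $$ab=q^{-1}ba,\quad ac=q\,ca,\quad cd=q^{-1}dc,\quad bd=q\,db,\quad bc=q^2cb,\quad ad=da,\quad DD^{-1}=D^{-1}D=1,$$ where $D=ad-q^{-1}bc$, with the matrix coproduct and counit, $D^{-1}$ group-like, and antipode $S(a)=dD^{-1}$, $S(b)=-q\,bD^{-1}$, $S(c)=-q^{-1}cD^{-1}$, $S(d)=aD^{-1}$, $S(D^{-1})=D$. Let $H=\widetilde{\mathcal O}_q(P)=A/(c)$, and write $t,n,s,\tilde D^{\pm1}$ for the images of $a,b,d,D^{\pm1}$; then $t$ is invertible with $t^{-1}=s\tilde D^{-1}$. Let $A_1=A[a^{-1}]$, $A_2=A[c^{-1}]$, $A_{12}=A[a^{-1}][c^{-1}]$, with the right $H$-coactions that extend $(\mathrm{id}\otimes\mathrm{pr})\Delta$. A right $H$-comodule algebra $R$ with coinvariants $B=R^{\mathrm{co}H}$ is *principal* if the canonical map $R\otimes_BR\to R\otimes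 H$, $x\otimes y\mapsto xy_{(0)}\otimes y_{(1)}$, is bijective and $R$ is faithfully flat as a left and as a right $B$-module; it is *cleft* if there is a convolution invertible $H$-comodule map $H\to R$ (a *cleaving map*). A sheaf $\mathcal F$ of $H$-comodule algebras ($H$ with bijective antipode) is a *locally cleft quantum principal bundle* over a ringed space $(M,\mathcal O_M)$ ($\mathcal O_M$ a sheaf of algebras) with respect to an open covering $\{U_i\}$ if there is a morphism $\mathcal O_M\to\mathcal F$ of sheaves of algebras that identifies $\mathcal O_M(U_i)$ with $\mathcal F(U_i)^{\mathrm{co}H}$ for all $i$, and every $\mathcal F(U_i)$ is principal and cleft. Let $U_1,U_2\subset\mathbf P^1=\mathbf P^1(\mathbb C)$ be the open sets where the first, respectively the second, homogeneous coordinate is non-zero. Give $\mathbf P^1$ the topology they generate, and the classical structure sheaf $\mathcal O_{\mathbf P^1}$: $\mathbb C$ on $\mathbf P^1$, $\mathbb C[z]$ on $U_1$, $\mathbb C[w]$ on $U_2$, $\mathbb C[z^{\pm1}]$ on $U_1\cap U_2$, with $w=z^{-1}$. Let $\mathcal F$ be given by $\mathcal F(\mathbf P^1)=A$, $\mathcal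 F(U_1)=A_1$, $\mathcal F(U_2)=A_2$, $\mathcal F(U_1\cap U_2)=A_{12}$, $\mathcal F(\emptyset)=0$, with the localization maps as restrictions. Then: 1. $\mathcal F$ is a sheaf, and it is a locally cleft quantum principal $\widetilde{\mathcal O}_q(P)$-bundle over $(\mathbf P^1,\mathcal O_{\mathbf P^1})$ with respect to the covering $\{U_1,U_2\}$. The same holds for every sheaf of $H$-comodule algebras on $\mathbf P^1$ whose sections over $U_1$ and $U_2$ are, as comodule algebras, $A_1$ and $A_2$, glued in such a way that the restrictions of $ca^{-1}\in A_1$ and $ac^{-1}\in A_2$ to $U_1\cap U_2$ are inverse to each other. 2. There is a cleaving map $\gamma_1:H\to A_1$ that is an algebra map, with $\tilde D^{\pm1}\mapsto D^{\pm1}$, $t^{\pm1}\mapsto a^{\pm1}$, $n\mapsto b$, $s\mapsto a^{-1}D$. Its convolution inverse is $\gamma_1\circ S$. 3. The elements $\tilde D^pt^mn^r$ ($p,m\in\mathbb Z$, $r\in\mathbb N$) form a vector space basis of $H$. The linear map $\gamma_2:H\to A_2$ with $$\gamma_2(\tilde D^pt^mn^r)=(-1)^pq^p\,D^pc^md^r$$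 is a cleaving map, with $\gamma_2(1)=1$ and $\gamma_2(s)=-q^{-1}c^{-1}D$. Its convolution inverse is the linear map given by $$\bar\gamma_2(\tilde D^pt^mn^r)=(-1)^pq^{-p+r(r-1)}\,d^rc^{-m}D^{-r-p}.$$ If $q^2\neq1$, then $\gamma_2$ is not an algebra map. -/

import Mathlib

set_option linter.unusedSimpArgs false
set_option linter.unreachableTactic false
set_option linter.unusedTactic false
set_option linter.unusedSectionVars false

open TensorProduct Coalgebra

/-- Generators of `Õ_q(GL(2))`; `Dinv` is the inverse of the quantum determinant. -/
inductive GLGen | a | b | c | d | Dinv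

open FreeAlgebra in
/-- The defining relations of `Õ_q(GL(2))`. -/
inductive GLRel (q : ℂ) : FreeAlgebra ℂ GLGen → FreeAlgebra ℂ GLGen → Prop
  | ab : GLRel q (ι ℂ .a * ι ℂ .b) (q⁻¹ • (ι ℂ .b * ι ℂ .a))
  | ac : GLRel q (ι ℂ .a * ι ℂ .c) (q • (ι ℂ .c * ι ℂ .a))
  | cd : GLRel q (ι ℂ .c * ι ℂ .d) (q⁻¹ • (ι ℂ .d * ι ℂ .c))
  | bd : GLRel q (ι ℂ .b * ι ℂ .d) (q • (ι ℂ .d * ι ℂ .b))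
  | bc : GLRel q (ι ℂ .b * ι ℂ .c) (q ^ 2 • (ι ℂ .c * ι ℂ .b))
  | ad : GLRel q (ι ℂ .a * ι ℂ .d) (ι ℂ .d * ι ℂ .a)
  | det_inv : GLRel q ((ι ℂ .a * ι ℂ .d - q⁻¹ • (ι ℂ .b * ι ℂ .c)) * ι ℂ .Dinv) 1
  | inv_det : GLRel q (ι ℂ .Dinv * (ι ℂ .a * ι ℂ .d - q⁻¹ • (ι ℂ .b * ι ℂ .c))) 1

/-- The Takhtajan-Sudbery algebra `A = Õ_q(GL(2))`. -/
def OGL (q : ℂ) : Type := RingQuot (GLRel q)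

namespace OGL
variable (q : ℂ)
noncomputable instance : Ring (OGL q) := inferInstanceAs (Ring (RingQuot (GLRel q)))
noncomputable instance : Algebra ℂ (OGL q) := inferInstanceAs (Algebra ℂ (RingQuot (GLRel q)))

/-- The generators `a, b, c, d, D⁻¹` of `A`. -/
noncomputable def gen (x : GLGen) : OGL q := RingQuot.mkAlgHom ℂ (GLRel q) (FreeAlgebra.ι ℂ x)

variable {q}
theorem mk_rel {x y : FreeAlgebra ℂ GLGen} (h : GLRel q x y) :
    FreeAlgebra.lift ℂ (gen q) x = FreeAlgebra.lift ℂ (gen q) y := by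
  have : FreeAlgebra.lift ℂ (gen q) = RingQuot.mkAlgHom ℂ (GLRel q) := by
    ext x; simp only [Function.comp_apply, FreeAlgebra.lift_ι_apply]; rfl
  rw [this]; exact RingQuot.mkAlgHom_rel ℂ h

/-- Algebra maps out of `A`. -/
noncomputable def lift {B : Type*} [Ring B] [Algebra ℂ B] (f : GLGen → B)
    (hf : ∀ x y, GLRel q x y → FreeAlgebra.lift ℂ f x = FreeAlgebra.lift ℂ f y) :
    OGL q →ₐ[ℂ] B :=
  RingQuot.liftAlgHom ℂ ⟨FreeAlgebra.lift ℂ f, fun x y h => hf x y h⟩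

theorem lift_gen {B : Type*} [Ring B] [Algebra ℂ B] (f : GLGen → B)
    (hf : ∀ x y, GLRel q x y → FreeAlgebra.lift ℂ f x = FreeAlgebra.lift ℂ f y) (x : GLGen) :
    lift f hf (gen q x) = f x := by
  simp only [lift, gen]
  erw [RingQuot.liftAlgHom_mkAlgHom_apply]
  simp

theorem hom_ext {B : Type*} [Semiring B] [Algebra ℂ B] {f g : OGL q →ₐ[ℂ] B}
    (h : ∀ x, f (gen q x) = g (gen q x)) : f = g := by
  apply RingQuot.ringQuot_ext' ℂ
  ext x
  exact h x

theorem adjoin_gen : Algebra.adjoin ℂ (Set.range (gen q)) = ⊤ := by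
  have h : (RingQuot.mkAlgHom ℂ (GLRel q)).range = ⊤ :=
    AlgHom.range_eq_top _ |>.2 (RingQuot.mkAlgHom_surjective ℂ _)
  have := FreeAlgebra.adjoin_range_ι (R := ℂ) (X := GLGen)
  rw [← Algebra.map_top, ← this, AlgHom.map_adjoin, ← Set.range_comp] at h
  exact h

theorem rba (hq : q ≠ 0) : gen q .b * gen q .a = q • (gen q .a * gen q .b) := by
  have := mk_rel (GLRel.ab (q := q))
  simp only [map_mul, map_smul, FreeAlgebra.lift_ι_apply] at this
  rw [this, smul_smul, mul_inv_cancel₀ hq, one_smul]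
theorem rca (hq : q ≠ 0) : gen q .c * gen q .a = q⁻¹ • (gen q .a * gen q .c) := by
  have := mk_rel (GLRel.ac (q := q))
  simp only [map_mul, map_smul, FreeAlgebra.lift_ι_apply] at this
  rw [this, smul_smul, inv_mul_cancel₀ hq, one_smul]
theorem rdc (hq : q ≠ 0) : gen q .d * gen q .c = q • (gen q .c * gen q .d) := by
  have := mk_rel (GLRel.cd (q := q))
  simp only [map_mul, map_smul, FreeAlgebra.lift_ι_apply] at this
  rw [this, smul_smul, mul_inv_cancel₀ hq, one_smul]
theorem rdb (hq : q ≠ 0) : gen q .d * gen q .b = q⁻¹ • (gen q .b * gen q .d) := by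
  have := mk_rel (GLRel.bd (q := q))
  simp only [map_mul, map_smul, FreeAlgebra.lift_ι_apply] at this
  rw [this, smul_smul, inv_mul_cancel₀ hq, one_smul]
theorem rcb (hq : q ≠ 0) : gen q .c * gen q .b = (q ^ 2)⁻¹ • (gen q .b * gen q .c) := by
  have := mk_rel (GLRel.bc (q := q))
  simp only [map_mul, map_smul, FreeAlgebra.lift_ι_apply] at this
  rw [this, smul_smul, inv_mul_cancel₀ (pow_ne_zero 2 hq), one_smul]
theorem rda : gen q .d * gen q .a = gen q .a * gen q .d := by
  have := mk_rel (GLRel.ad (q := q))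
  simp only [map_mul, FreeAlgebra.lift_ι_apply] at this
  exact this.symm

/-- The quantum determinant `D = ad - q⁻¹ bc`. -/
noncomputable def det (q : ℂ) : OGL q := gen q .a * gen q .d - q⁻¹ • (gen q .b * gen q .c)

theorem det_inv : det q * gen q .Dinv = 1 := by
  have := mk_rel (GLRel.det_inv (q := q))
  simp only [map_mul, map_smul, map_sub, map_one, FreeAlgebra.lift_ι_apply] at this; exact this
theorem inv_det : gen q .Dinv * det q = 1 := by
  have := mk_rel (GLRel.inv_det (q := q))
  simp only [map_mul, map_smul, map_sub, map_one, FreeAlgebra.lift_ι_apply] at this; exact this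

/-- The matrix coproduct on generators. -/
noncomputable def comulFun (q : ℂ) : GLGen → OGL q ⊗[ℂ] OGL q
  | .a => gen q .a ⊗ₜ gen q .a + gen q .b ⊗ₜ gen q .c
  | .b => gen q .a ⊗ₜ gen q .b + gen q .b ⊗ₜ gen q .d
  | .c => gen q .c ⊗ₜ gen q .a + gen q .d ⊗ₜ gen q .c
  | .d => gen q .c ⊗ₜ gen q .b + gen q .d ⊗ₜ gen q .d
  | .Dinv => gen q .Dinv ⊗ₜ gen q .Dinv

theorem comulFun_det (hq : q ≠ 0) :
    comulFun q .a * comulFun q .d - q⁻¹ • (comulFun q .b * comulFun q .c) = det q ⊗ₜ det q := by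
  simp only [comulFun, det, mul_add, add_mul, Algebra.TensorProduct.tmul_mul_tmul, sub_tmul,
    tmul_sub, ← smul_tmul', tmul_smul, Algebra.smul_mul_assoc, Algebra.mul_smul_comm,
    smul_smul, smul_add, rba hq, rca hq, rdc hq, rdb hq, rcb hq,
    rda]
  match_scalars <;> field_simp <;> ring

/-- The coproduct of `A`. -/
noncomputable def comulHom (hq : q ≠ 0) : OGL q →ₐ[ℂ] OGL q ⊗[ℂ] OGL q :=
  lift (comulFun q) <| by
    intro x y h
    have hdet := comulFun_det hq
    cases h
    case det_inv =>
      simp only [map_mul, map_smul, map_sub, map_one, FreeAlgebra.lift_ι_apply, hdet]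
      simp only [comulFun, Algebra.TensorProduct.tmul_mul_tmul, det_inv,
        Algebra.TensorProduct.one_def]
    case inv_det =>
      simp only [map_mul, map_smul, map_sub, map_one, FreeAlgebra.lift_ι_apply, hdet]
      simp only [comulFun, Algebra.TensorProduct.tmul_mul_tmul, inv_det,
        Algebra.TensorProduct.one_def]
    all_goals
      simp only [map_mul, map_smul, FreeAlgebra.lift_ι_apply]
      simp only [comulFun, mul_add, add_mul, Algebra.TensorProduct.tmul_mul_tmul,
        ← smul_tmul', tmul_smul, Algebra.smul_mul_assoc, Algebra.mul_smul_comm,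
    smul_smul, smul_add, rba hq, rca hq, rdc hq, rdb hq, rcb hq, rda]
      match_scalars <;> field_simp <;> ring

/-- The counit on generators. -/
noncomputable def counitFun : GLGen → ℂ
  | .a => 1
  | .b => 0
  | .c => 0
  | .d => 1
  | .Dinv => 1

/-- The counit of `A`. -/
noncomputable def counitHom (q : ℂ) : OGL q →ₐ[ℂ] ℂ :=
  lift counitFun <| by
    intro x y h
    cases h <;> simp [counitFun]

section
variable {B : Type*} [Ring B] [Algebra ℂ B]
theorem swap_assoc {x y : B} {s : ℂ} (h : x * y = s • (y * x)) (z : B) :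
    x * (y * z) = s • (y * (x * z)) := by
  rw [← mul_assoc, h, Algebra.smul_mul_assoc, mul_assoc]
theorem swap_assoc' {x y : B} (h : x * y = y * x) (z : B) :
    x * (y * z) = y * (x * z) := by
  rw [← mul_assoc, h, mul_assoc]
theorem swap_inv {x D D' : B} {s : ℂ} (h : x * D = s • (D * x)) (h1 : D * D' = 1)
    (h2 : D' * D = 1) : D' * x = s • (x * D') := by
  calc D' * x = D' * (x * D) * D' := by rw [mul_assoc, mul_assoc, h1, mul_one]
    _ = s • (x * D') := by
      rw [h, Algebra.mul_smul_comm, ← mul_assoc, h2, one_mul, Algebra.smul_mul_assoc]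
end

section
theorem rDa (hq : q ≠ 0) : gen q .Dinv * gen q .a = gen q .a * gen q .Dinv := by
  have := swap_inv (s := 1) (x := gen q .a) (D := det q) ?_ det_inv inv_det
  · rwa [one_smul] at this
  simp only [det, mul_sub, sub_mul, mul_assoc, Algebra.smul_mul_assoc, Algebra.mul_smul_comm,
    smul_smul, smul_sub, rba hq, rca hq, rda, swap_assoc (rba hq), swap_assoc (rca hq),
    swap_assoc' (rda (q := q))]
  match_scalars <;> field_simp
theorem rDd (hq : q ≠ 0) : gen q .Dinv * gen q .d = gen q .d * gen q .Dinv := by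
  have := swap_inv (s := 1) (x := gen q .d) (D := det q) ?_ det_inv inv_det
  · rwa [one_smul] at this
  simp only [det, mul_sub, sub_mul, mul_assoc, Algebra.smul_mul_assoc, Algebra.mul_smul_comm,
    smul_smul, smul_sub, rdb hq, rdc hq, rda, swap_assoc (rdb hq), swap_assoc (rdc hq),
    swap_assoc' (rda (q := q))]
  match_scalars <;> field_simp
theorem rDb (hq : q ≠ 0) : gen q .Dinv * gen q .b = q ^ 2 • (gen q .b * gen q .Dinv) := by
  refine swap_inv (x := gen q .b) (D := det q) ?_ det_inv inv_det
  simp only [det, mul_sub, sub_mul, mul_assoc, Algebra.smul_mul_assoc, Algebra.mul_smul_comm,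
    smul_smul, smul_sub, rba hq, rdb hq, rcb hq, swap_assoc (rba hq), swap_assoc (rcb hq),
    swap_assoc (rdb hq)]
  match_scalars <;> field_simp
theorem rDc (hq : q ≠ 0) : gen q .Dinv * gen q .c = (q ^ 2)⁻¹ • (gen q .c * gen q .Dinv) := by
  refine swap_inv (x := gen q .c) (D := det q) ?_ det_inv inv_det
  simp only [det, mul_sub, sub_mul, mul_assoc, Algebra.smul_mul_assoc, Algebra.mul_smul_comm,
    smul_smul, smul_sub, rca hq, rdc hq, rcb hq, swap_assoc (rca hq), swap_assoc (rcb hq),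
    swap_assoc (rdc hq)]
  match_scalars <;> field_simp

theorem antipode_det (hq : q ≠ 0) :
    gen q .a * gen q .Dinv * (gen q .d * gen q .Dinv)
      - q⁻¹ • (-q⁻¹ • (gen q .c * gen q .Dinv) * (-q • (gen q .b * gen q .Dinv)))
      = gen q .Dinv := by
  have h : det q * gen q .Dinv * gen q .Dinv = gen q .Dinv := by rw [det_inv, one_mul]
  refine Eq.trans ?_ h
  simp only [det, mul_sub, sub_mul, mul_assoc, Algebra.smul_mul_assoc, Algebra.mul_smul_comm,
    smul_smul, smul_sub, rcb hq, swap_assoc (rcb hq),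
    swap_assoc' (rDd hq), swap_assoc (rDb hq)]
  match_scalars <;> field_simp
end

open MulOpposite in
/-- The antipode on generators. -/
noncomputable def antipodeFun (q : ℂ) : GLGen → (OGL q)ᵐᵒᵖ
  | .a => op (gen q .d * gen q .Dinv)
  | .b => op (-q • (gen q .b * gen q .Dinv))
  | .c => op (-q⁻¹ • (gen q .c * gen q .Dinv))
  | .d => op (gen q .a * gen q .Dinv)
  | .Dinv => op (det q)

open MulOpposite in
/-- The antipode of `A`, as an algebra map to the opposite algebra. -/
noncomputable def antipodeHom (hq : q ≠ 0) : OGL q →ₐ[ℂ] (OGL q)ᵐᵒᵖ :=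
  lift (antipodeFun q) <| by
    have hdet : antipodeFun q .a * antipodeFun q .d
        - q⁻¹ • (antipodeFun q .b * antipodeFun q .c) = op (gen q .Dinv) := by
      simp only [antipodeFun, ← op_mul, ← op_smul, ← op_sub]
      rw [antipode_det hq]
    intro x y h
    cases h
    case det_inv =>
      simp only [map_mul, map_smul, map_sub, map_one, FreeAlgebra.lift_ι_apply, hdet]
      simp only [antipodeFun, ← op_mul, det_inv, op_one]
    case inv_det =>
      simp only [map_mul, map_smul, map_sub, map_one, FreeAlgebra.lift_ι_apply, hdet]
      simp only [antipodeFun, ← op_mul, inv_det, op_one]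
    all_goals
      simp only [map_mul, map_smul, FreeAlgebra.lift_ι_apply]
      simp only [antipodeFun, ← op_mul, ← op_smul]
      congr 1
      simp only [mul_assoc, Algebra.smul_mul_assoc, Algebra.mul_smul_comm,
        smul_smul, swap_assoc (rba hq), swap_assoc (rca hq), swap_assoc (rdc hq),
        swap_assoc (rdb hq), swap_assoc (rcb hq), swap_assoc' (rda (q := q)),
        swap_assoc' (rDa hq), swap_assoc' (rDd hq), swap_assoc (rDb hq), swap_assoc (rDc hq)]
      try (match_scalars <;> field_simp)

theorem comulHom_gen (hq : q ≠ 0) (x : GLGen) : comulHom hq (gen q x) = comulFun q x :=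
  lift_gen _ _ x
theorem counitHom_gen (x : GLGen) : counitHom q (gen q x) = counitFun x :=
  lift_gen _ _ x
theorem antipodeHom_gen (hq : q ≠ 0) (x : GLGen) : antipodeHom hq (gen q x) = antipodeFun q x :=
  lift_gen _ _ x

noncomputable instance [NeZero q] : Bialgebra ℂ (OGL q) :=
  Bialgebra.ofAlgHom (comulHom (NeZero.ne q)) (counitHom q)
    (by
      refine hom_ext fun x => ?_
      cases x <;>
        simp [comulHom_gen, comulFun, add_tmul, tmul_add] <;> abel)
    (by
      refine hom_ext fun x => ?_
      cases x <;> simp [comulHom_gen, comulFun, counitHom_gen, counitFun])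
    (by
      refine hom_ext fun x => ?_
      cases x <;> simp [comulHom_gen, comulFun, counitHom_gen, counitFun])

theorem comul_gen [NeZero q] (x : GLGen) : comul (R := ℂ) (gen q x) = comulFun q x :=
  comulHom_gen (NeZero.ne q) x
theorem counit_gen [NeZero q] (x : GLGen) : counit (R := ℂ) (gen q x) = counitFun x :=
  counitHom_gen x
end OGL

section
variable {A : Type*} [Ring A] [Bialgebra ℂ A] (S : A →ₐ[ℂ] Aᵐᵒᵖ)

/-- The linear map underlying an algebra map to the opposite algebra. -/
noncomputable def antiLin : A →ₗ[ℂ] A :=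
  (MulOpposite.opLinearEquiv ℂ).symm.toLinearMap ∘ₗ S.toLinearMap

theorem antiLin_mul (x y : A) : antiLin S (x * y) = antiLin S y * antiLin S x := by
  simp [antiLin]

theorem antiLin_left_mul (u v : A ⊗[ℂ] A) (e : ℂ)
    (hu : LinearMap.mul' ℂ A ((antiLin S).rTensor A u) = algebraMap ℂ A e) :
    LinearMap.mul' ℂ A ((antiLin S).rTensor A (u * v)) =
      e • LinearMap.mul' ℂ A ((antiLin S).rTensor A v) := by
  have key : ∀ (u : A ⊗[ℂ] A) (y z : A), LinearMap.mul' ℂ A ((antiLin S).rTensor A (u * y ⊗ₜ z)) =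
      antiLin S y * LinearMap.mul' ℂ A ((antiLin S).rTensor A u) * z := by
    intro u y z
    induction u with
    | zero => simp
    | add a b ha hb => simp only [add_mul, map_add, ha, hb, mul_add]
    | tmul a b => simp [antiLin_mul, mul_assoc]
  induction v with
  | zero => simp
  | add a b ha hb => simp only [mul_add, map_add, ha, hb, smul_add]
  | tmul y z => rw [key, hu]; simp [Algebra.algebraMap_eq_smul_one]

theorem antiLin_right_mul (u v : A ⊗[ℂ] A) (e : ℂ)
    (hv : LinearMap.mul' ℂ A ((antiLin S).lTensor A v) = algebraMap ℂ A e) :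
    LinearMap.mul' ℂ A ((antiLin S).lTensor A (u * v)) =
      e • LinearMap.mul' ℂ A ((antiLin S).lTensor A u) := by
  have key : ∀ (v : A ⊗[ℂ] A) (y z : A), LinearMap.mul' ℂ A ((antiLin S).lTensor A (y ⊗ₜ z * v)) =
      y * LinearMap.mul' ℂ A ((antiLin S).lTensor A v) * antiLin S z := by
    intro v y z
    induction v with
    | zero => simp
    | add a b ha hb => simp only [add_mul, map_add, ha, hb, mul_add]
    | tmul a b => simp [antiLin_mul, mul_assoc]
  induction u with
  | zero => simp
  | add a b ha hb => simp only [add_mul, map_add, ha, hb, smul_add]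
  | tmul y z => rw [key, hv]; simp [Algebra.algebraMap_eq_smul_one]

/-- An anti-multiplicative map that satisfies the antipode identities on generators is an
antipode. -/
noncomputable abbrev hopfOfGenerators (s : Set A) (hs : Algebra.adjoin ℂ s = ⊤)
    (hl : ∀ x ∈ s, LinearMap.mul' ℂ A ((antiLin S).rTensor A (comul (R := ℂ) x))
      = algebraMap ℂ A (counit x))
    (hr : ∀ x ∈ s, LinearMap.mul' ℂ A ((antiLin S).lTensor A (comul (R := ℂ) x))
      = algebraMap ℂ A (counit x)) : HopfAlgebra ℂ A where
  antipode := antiLin S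
  mul_antipode_rTensor_comul := by
    ext x
    have hx : x ∈ Algebra.adjoin ℂ s := hs ▸ Algebra.mem_top
    simp only [LinearMap.comp_apply, Algebra.linearMap_apply]
    induction hx using Algebra.adjoin_induction with
    | mem x hx => exact hl x hx
    | algebraMap r => simp [Algebra.TensorProduct.one_def, antiLin, Algebra.algebraMap_eq_smul_one]
    | add x y _ _ hx hy => simp only [map_add, hx, hy]
    | mul x y _ _ hx hy =>
      rw [Bialgebra.comul_mul, antiLin_left_mul S _ _ _ hx, hy, Bialgebra.counit_mul, map_mul,
        Algebra.smul_def]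
  mul_antipode_lTensor_comul := by
    ext x
    have hx : x ∈ Algebra.adjoin ℂ s := hs ▸ Algebra.mem_top
    simp only [LinearMap.comp_apply, Algebra.linearMap_apply]
    induction hx using Algebra.adjoin_induction with
    | mem x hx => exact hr x hx
    | algebraMap r => simp [Algebra.TensorProduct.one_def, antiLin, Algebra.algebraMap_eq_smul_one]
    | add x y _ _ hx hy => simp only [map_add, hx, hy]
    | mul x y _ _ hx hy =>
      rw [Bialgebra.comul_mul, antiLin_right_mul S _ _ _ hy, hx, Bialgebra.counit_mul,
        mul_comm (counit x), map_mul, Algebra.smul_def]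
end

namespace OGL
variable {q : ℂ} [NeZero q]

theorem antiLin_gen (x : GLGen) : antiLin (antipodeHom (NeZero.ne q)) (gen q x) =
    (antipodeFun q x).unop := by
  simp only [antiLin, LinearMap.comp_apply, AlgHom.toLinearMap_apply, antipodeHom_gen]
  rfl

noncomputable instance : HopfAlgebra ℂ (OGL q) :=
  hopfOfGenerators (antipodeHom (NeZero.ne q)) (Set.range (gen q)) adjoin_gen
    (by
      have hq : q ≠ 0 := NeZero.ne q
      have hdet : det q * gen q .Dinv = 1 := det_inv
      simp only [det] at hdet
      rintro _ ⟨x, rfl⟩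
      rw [comul_gen, counit_gen]
      cases x
      case Dinv => simp [comulFun, counitFun, antiLin_gen, antipodeFun, det_inv]
      all_goals
        simp only [comulFun, counitFun, map_add, LinearMap.rTensor_tmul, antiLin_gen, antipodeFun,
          LinearMap.mul'_apply, MulOpposite.unop_op, map_one, map_zero, ← hdet]
        simp only [mul_assoc, Algebra.smul_mul_assoc, Algebra.mul_smul_comm, sub_mul, smul_smul,
        neg_smul, smul_neg, neg_mul, mul_neg,
        rba hq, rca hq, rdc hq, rdb hq, rcb hq, rda, swap_assoc (rba hq), swap_assoc (rca hq),
        swap_assoc (rdc hq), swap_assoc (rdb hq), swap_assoc (rcb hq), swap_assoc' (rda (q := q)),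
        rDa hq, rDd hq, rDb hq, rDc hq,
        swap_assoc' (rDa hq), swap_assoc' (rDd hq), swap_assoc (rDb hq), swap_assoc (rDc hq)]
        match_scalars <;> field_simp <;> try ring)
    (by
      have hq : q ≠ 0 := NeZero.ne q
      have hdet : det q * gen q .Dinv = 1 := det_inv
      simp only [det] at hdet
      rintro _ ⟨x, rfl⟩
      rw [comul_gen, counit_gen]
      cases x
      case Dinv => simp [comulFun, counitFun, antiLin_gen, antipodeFun, inv_det]
      all_goals
        simp only [comulFun, counitFun, map_add, LinearMap.lTensor_tmul, antiLin_gen, antipodeFun,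
          LinearMap.mul'_apply, MulOpposite.unop_op, map_one, map_zero, ← hdet]
        simp only [mul_assoc, Algebra.smul_mul_assoc, Algebra.mul_smul_comm, sub_mul, smul_smul,
        neg_smul, smul_neg, neg_mul, mul_neg,
        rba hq, rca hq, rdc hq, rdb hq, rcb hq, rda, swap_assoc (rba hq), swap_assoc (rca hq),
        swap_assoc (rdc hq), swap_assoc (rdb hq), swap_assoc (rcb hq), swap_assoc' (rda (q := q)),
        rDa hq, rDd hq, rDb hq, rDc hq,
        swap_assoc' (rDa hq), swap_assoc' (rDd hq), swap_assoc (rDb hq), swap_assoc (rDc hq)]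
        match_scalars <;> field_simp <;> try ring)

end OGL

namespace OGL

/-- The two-sided ideal generated by `c`. -/
noncomputable def borelIdeal (q : ℂ) : Ideal (OGL q) := (TwoSidedIdeal.span {gen q .c}).asIdeal

instance (q : ℂ) : (borelIdeal q).IsTwoSided := by unfold borelIdeal; infer_instance

theorem borelIdeal_induction {q : ℂ} {B : Type*} [Ring B] [Algebra ℂ B] (f : OGL q →ₐ[ℂ] B)
    (h : f (gen q .c) = 0) {x : OGL q} (hx : x ∈ borelIdeal q) : f x = 0 := by
  have hle : TwoSidedIdeal.span {gen q .c} ≤ TwoSidedIdeal.ker f := by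
    rw [TwoSidedIdeal.span_le]
    rintro _ rfl
    exact (TwoSidedIdeal.mem_ker f).2 h
  exact (TwoSidedIdeal.mem_ker f).1 (hle (TwoSidedIdeal.mem_asIdeal.1 hx))

theorem gen_c_mem (q : ℂ) : gen q .c ∈ borelIdeal q :=
  TwoSidedIdeal.mem_asIdeal.2 (TwoSidedIdeal.subset_span rfl)

theorem mk_gen_c (q : ℂ) : Ideal.Quotient.mk (borelIdeal q) (gen q .c) = 0 :=
  Ideal.Quotient.eq_zero_iff_mem.2 (gen_c_mem q)

instance (q : ℂ) [NeZero q] : (borelIdeal q).IsHopfIdeal ℂ where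
  counit_eq_zero x hx :=
    borelIdeal_induction (Bialgebra.counitAlgHom ℂ (OGL q)) (by simp [counit_gen, counitFun]) hx
  map_mkQ_comul_eq_zero x hx := by
    let π := Ideal.Quotient.mkₐ ℂ (borelIdeal q)
    refine borelIdeal_induction ((Algebra.TensorProduct.map π π).comp
      (Bialgebra.comulAlgHom ℂ (OGL q))) ?_ hx
    have hc : π (gen q .c) = 0 := mk_gen_c q
    simp [comul_gen, comulFun, hc]
  antipode_mem x hx := by
    let π := Ideal.Quotient.mkₐ ℂ (borelIdeal q)
    have hc : π (gen q .c) = 0 := mk_gen_c q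
    have := borelIdeal_induction ((AlgHom.op π).comp (antipodeHom (NeZero.ne q))) (by
      simp [antipodeHom_gen, antipodeFun, hc]) hx
    rw [← Ideal.Quotient.eq_zero_iff_mem]
    exact MulOpposite.op_injective this

end OGL

/-- The Hopf algebra `H = Õ_q(P) = A/(c)`. -/
abbrev OP (q : ℂ) : Type := OGL q ⧸ OGL.borelIdeal q

namespace OP
variable (q : ℂ)
/-- The projection `A → H`. -/
noncomputable def pr [NeZero q] : OGL q →ₐc[ℂ] OP q :=
  Bialgebra.Quotient.mkBialgHom (OGL.borelIdeal q)
end OP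

/-- Relations of the universal localization `R[u⁻¹]`: the generator `some x` stands for `x ∈ R` and
the generator `none` for `u⁻¹`. -/
inductive LocRel {R : Type} [Ring R] [Algebra ℂ R] (u : R) :
    FreeAlgebra ℂ (Option R) → FreeAlgebra ℂ (Option R) → Prop
  | add (x y : R) : LocRel u (FreeAlgebra.ι ℂ (some (x + y)))
      (FreeAlgebra.ι ℂ (some x) + FreeAlgebra.ι ℂ (some y))
  | mul (x y : R) : LocRel u (FreeAlgebra.ι ℂ (some (x * y)))
      (FreeAlgebra.ι ℂ (some x) * FreeAlgebra.ι ℂ (some y))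
  | scalar (s : ℂ) : LocRel u (FreeAlgebra.ι ℂ (some (algebraMap ℂ R s)))
      (algebraMap ℂ (FreeAlgebra ℂ (Option R)) s)
  | mul_inv : LocRel u (FreeAlgebra.ι ℂ (some u) * FreeAlgebra.ι ℂ none) 1
  | inv_mul : LocRel u (FreeAlgebra.ι ℂ none * FreeAlgebra.ι ℂ (some u)) 1

/-- The algebra `R[u⁻¹]`: the extension of `R` by a two-sided inverse of `u`. -/
def Loc (R : Type) [Ring R] [Algebra ℂ R] (u : R) : Type := RingQuot (LocRel u)

namespace Loc
section
variable {R : Type} [Ring R] [Algebra ℂ R] (u : R)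
noncomputable instance : Ring (Loc R u) := inferInstanceAs (Ring (RingQuot (LocRel u)))
noncomputable instance : Algebra ℂ (Loc R u) := inferInstanceAs (Algebra ℂ (RingQuot (LocRel u)))

/-- The quotient map of the presentation. -/
noncomputable def mk : FreeAlgebra ℂ (Option R) →ₐ[ℂ] Loc R u := RingQuot.mkAlgHom ℂ (LocRel u)

variable {u} in
theorem mk_rel {x y : FreeAlgebra ℂ (Option R)} (h : LocRel u x y) : mk u x = mk u y :=
  RingQuot.mkAlgHom_rel ℂ h

/-- The canonical map `R → R[u⁻¹]`. -/
noncomputable def incl : R →ₐ[ℂ] Loc R u :=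
  AlgHom.ofLinearMap
    { toFun x := mk u (FreeAlgebra.ι ℂ (some x))
      map_add' x y := by rw [mk_rel (LocRel.add x y), map_add]
      map_smul' s x := by
        rw [Algebra.smul_def, mk_rel (LocRel.mul _ x), map_mul, mk_rel (LocRel.scalar s),
          AlgHom.commutes, ← Algebra.smul_def]; rfl }
    (by
      have := mk_rel (u := u) (LocRel.scalar 1)
      rw [map_one, map_one, map_one] at this
      exact this)
    (fun x y => by
      change mk u _ = mk u _ * mk u _
      rw [mk_rel (LocRel.mul x y), map_mul])

/-- The image of `u`, as a unit of `R[u⁻¹]`. -/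
noncomputable def unit : (Loc R u)ˣ where
  val := incl u u
  inv := mk u (FreeAlgebra.ι ℂ none)
  val_inv := by
    have := mk_rel (LocRel.mul_inv (u := u))
    rwa [map_mul, map_one] at this
  inv_val := by
    have := mk_rel (LocRel.inv_mul (u := u))
    rwa [map_mul, map_one] at this

variable {u} {S : Type*} [Ring S] [Algebra ℂ S]

/-- The universal property of `R[u⁻¹]`. -/
noncomputable def lift (f : R →ₐ[ℂ] S) (v : Sˣ) (hv : (v : S) = f u) : Loc R u →ₐ[ℂ] S :=
  RingQuot.liftAlgHom ℂ ⟨FreeAlgebra.lift ℂ fun o => o.elim ((v⁻¹ : Sˣ) : S) f, by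
    intro x y h
    cases h <;> simp [← hv]⟩

theorem lift_incl (f : R →ₐ[ℂ] S) (v : Sˣ) (hv : (v : S) = f u) (x : R) :
    lift f v hv (incl u x) = f x := by
  change RingQuot.liftAlgHom ℂ _ (RingQuot.mkAlgHom ℂ (LocRel u) _) = _
  erw [RingQuot.liftAlgHom_mkAlgHom_apply]
  simp

theorem hom_ext {f g : Loc R u →ₐ[ℂ] S} (h : f.comp (incl u) = g.comp (incl u)) : f = g := by
  have h1 (x : R) : f (incl u x) = g (incl u x) := DFunLike.congr_fun h x
  have h2 : Units.map (f : Loc R u →* S) (unit u) = Units.map (g : Loc R u →* S) (unit u) :=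
    Units.ext (h1 u)
  apply RingQuot.ringQuot_ext' ℂ
  ext o
  cases o with
  | some x => exact h1 x
  | none => exact congrArg (fun w : Sˣ => ((w⁻¹ : Sˣ) : S)) h2
end
end Loc

/-- A right `H`-comodule algebra: a coassociative and counital coaction that is an algebra map. -/
class ComoduleAlgebra (H : Type) [Ring H] [Bialgebra ℂ H] (R : Type) [Ring R] [Algebra ℂ R] where
  coact : R →ₐ[ℂ] R ⊗[ℂ] H
  coassoc : (Algebra.TensorProduct.assoc ℂ ℂ ℂ R H H).toAlgHom.comp
      ((Algebra.TensorProduct.map coact (AlgHom.id ℂ H)).comp coact) =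
    (Algebra.TensorProduct.map (AlgHom.id ℂ R) (Bialgebra.comulAlgHom ℂ H)).comp coact
  counital : (Algebra.TensorProduct.rid ℂ ℂ R).toAlgHom.comp
      ((Algebra.TensorProduct.map (AlgHom.id ℂ R) (Bialgebra.counitAlgHom ℂ H)).comp coact) =
    AlgHom.id ℂ R

theorem subsingleton_punit_tensor (M : Type*) [AddCommGroup M] [Module ℂ M] :
    Subsingleton (PUnit.{1} ⊗[ℂ] M) := by
  refine ⟨fun x y => ?_⟩
  have h (z : PUnit.{1} ⊗[ℂ] M) : z = 0 := by
    induction z with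
    | zero => rfl
    | add a b ha hb => rw [ha, hb, add_zero]
    | tmul a b => rw [Subsingleton.elim a 0, zero_tmul]
  rw [h x, h y]

namespace ComoduleAlgebra
variable (H : Type) [Ring H] [Bialgebra ℂ H]

/-- The one-element algebra is a comodule algebra. -/
noncomputable instance punit : ComoduleAlgebra H PUnit.{1} :=
  have := subsingleton_punit_tensor H
  have := subsingleton_punit_tensor (H ⊗[ℂ] H)
  { coact := AlgHom.ofLinearMap 0 (Subsingleton.elim _ _) (fun _ _ => Subsingleton.elim _ _)
    coassoc := AlgHom.ext fun _ => Subsingleton.elim _ _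
    counital := AlgHom.ext fun _ => Subsingleton.elim _ _ }

variable {H} in
/-- A bialgebra map `π : A → H` makes `A` an `H`-comodule algebra through `(id ⊗ π) ∘ Δ`. -/
noncomputable abbrev ofBialgHom {A : Type} [Ring A] [Bialgebra ℂ A] (π : A →ₐc[ℂ] H) :
    ComoduleAlgebra H A where
  coact := (Algebra.TensorProduct.map (AlgHom.id ℂ A) (π : A →ₐ[ℂ] H)).comp
    (Bialgebra.comulAlgHom ℂ A)
  coassoc := by
    ext x
    have h1 : ∀ y : A ⊗[ℂ] A, Algebra.TensorProduct.assoc ℂ ℂ ℂ A H H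
        (Algebra.TensorProduct.map ((Algebra.TensorProduct.map (AlgHom.id ℂ A) (π : A →ₐ[ℂ] H)).comp
          (Bialgebra.comulAlgHom ℂ A)) (AlgHom.id ℂ H)
          (Algebra.TensorProduct.map (AlgHom.id ℂ A) (π : A →ₐ[ℂ] H) y)) =
        Algebra.TensorProduct.map (AlgHom.id ℂ A)
          (Algebra.TensorProduct.map (π : A →ₐ[ℂ] H) (π : A →ₐ[ℂ] H))
          (TensorProduct.assoc ℂ A A A (comul.rTensor A y)) := by
      intro y
      induction y with
      | zero => simp
      | add a b ha hb => simp only [map_add, ha, hb]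
      | tmul a b =>
        simp only [Algebra.TensorProduct.map_tmul, AlgHom.comp_apply, AlgHom.id_apply,
          Bialgebra.comulAlgHom_apply, LinearMap.rTensor_tmul]
        induction comul (R := ℂ) a with
        | zero => simp
        | add a b ha hb => simp only [map_add, add_tmul, ha, hb]
        | tmul a b => simp
    have h2 : ∀ y : A ⊗[ℂ] A, Algebra.TensorProduct.map (AlgHom.id ℂ A)
          (Bialgebra.comulAlgHom ℂ H)
          (Algebra.TensorProduct.map (AlgHom.id ℂ A) (π : A →ₐ[ℂ] H) y) =
        Algebra.TensorProduct.map (AlgHom.id ℂ A)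
          (Algebra.TensorProduct.map (π : A →ₐ[ℂ] H) (π : A →ₐ[ℂ] H)) (comul.lTensor A y) := by
      intro y
      induction y with
      | zero => simp
      | add a b ha hb => simp only [map_add, ha, hb]
      | tmul a b =>
        simp only [Algebra.TensorProduct.map_tmul, AlgHom.id_apply,
          Bialgebra.comulAlgHom_apply, LinearMap.lTensor_tmul]
        congr 1
        exact (CoalgHomClass.map_comp_comul_apply π b).symm
    simp only [AlgHom.comp_apply, Bialgebra.comulAlgHom_apply]
    refine (h1 _).trans (Eq.trans ?_ (h2 _).symm)
    rw [Coalgebra.coassoc_apply]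
  counital := by
    ext x
    have h : ∀ y : A ⊗[ℂ] A, Algebra.TensorProduct.rid ℂ ℂ A
        (Algebra.TensorProduct.map (AlgHom.id ℂ A) (Bialgebra.counitAlgHom ℂ H)
          (Algebra.TensorProduct.map (AlgHom.id ℂ A) (π : A →ₐ[ℂ] H) y)) =
        TensorProduct.rid ℂ A (counit.lTensor A y) := by
      intro y
      induction y with
      | zero => simp
      | add a b ha hb => simp only [map_add, ha, hb]
      | tmul a b => simp
    simp only [AlgHom.comp_apply, Bialgebra.comulAlgHom_apply]
    refine (h _).trans ?_
    simp

/-- If `δ(u) = u ⊗ g` with `g` invertible, then `δ` extends (uniquely) to `R[u⁻¹]`, with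
`δ(u⁻¹) = u⁻¹ ⊗ g⁻¹`. -/
noncomputable abbrev loc {R : Type} [Ring R] [Algebra ℂ R] [ComoduleAlgebra H R] (u : R) (g : Hˣ)
    (hu : coact (H := H) u = u ⊗ₜ (g : H)) : ComoduleAlgebra H (Loc R u) :=
  let δ : Loc R u →ₐ[ℂ] Loc R u ⊗[ℂ] H :=
    Loc.lift ((Algebra.TensorProduct.map (Loc.incl u) (AlgHom.id ℂ H)).comp coact)
      { val := (Loc.unit u : Loc R u) ⊗ₜ (g : H)
        inv := ((Loc.unit u)⁻¹ : (Loc R u)ˣ) ⊗ₜ ((g⁻¹ : Hˣ) : H)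
        val_inv := by simp [Algebra.TensorProduct.one_def]
        inv_val := by simp [Algebra.TensorProduct.one_def] }
      (by simp [hu, Loc.unit])
  have hδ (x : R) : δ (Loc.incl u x) =
      Algebra.TensorProduct.map (Loc.incl u) (AlgHom.id ℂ H) (coact x) := Loc.lift_incl _ _ _ x
  { coact := δ
    coassoc := by
      apply Loc.hom_ext
      ext x
      have h1 : ∀ y : R ⊗[ℂ] H, Algebra.TensorProduct.assoc ℂ ℂ ℂ (Loc R u) H H
          (Algebra.TensorProduct.map δ (AlgHom.id ℂ H)
            (Algebra.TensorProduct.map (Loc.incl u) (AlgHom.id ℂ H) y)) =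
          Algebra.TensorProduct.map (Loc.incl u) (AlgHom.id ℂ (H ⊗[ℂ] H))
            (Algebra.TensorProduct.assoc ℂ ℂ ℂ R H H
              (Algebra.TensorProduct.map coact (AlgHom.id ℂ H) y)) := by
        intro y
        induction y with
        | zero => simp
        | add a b ha hb => simp only [map_add, ha, hb]
        | tmul a b =>
          simp only [Algebra.TensorProduct.map_tmul, AlgHom.id_apply, hδ]
          induction coact (H := H) a with
          | zero => simp
          | add a b ha hb => simp only [map_add, add_tmul, ha, hb]
          | tmul a b => simp
      have h2 : ∀ y : R ⊗[ℂ] H, Algebra.TensorProduct.map (AlgHom.id ℂ (Loc R u))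
            (Bialgebra.comulAlgHom ℂ H)
            (Algebra.TensorProduct.map (Loc.incl u) (AlgHom.id ℂ H) y) =
          Algebra.TensorProduct.map (Loc.incl u) (AlgHom.id ℂ (H ⊗[ℂ] H))
            (Algebra.TensorProduct.map (AlgHom.id ℂ R) (Bialgebra.comulAlgHom ℂ H) y) := by
        intro y
        induction y with
        | zero => simp
        | add a b ha hb => simp only [map_add, ha, hb]
        | tmul a b => simp
      simp only [AlgHom.comp_apply, hδ]
      refine (h1 _).trans (Eq.trans ?_ (h2 _).symm)
      exact congrArg _ (DFunLike.congr_fun (ComoduleAlgebra.coassoc (H := H) (R := R)) x)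
    counital := by
      apply Loc.hom_ext
      ext x
      have h : ∀ y : R ⊗[ℂ] H, Algebra.TensorProduct.rid ℂ ℂ (Loc R u)
          (Algebra.TensorProduct.map (AlgHom.id ℂ (Loc R u)) (Bialgebra.counitAlgHom ℂ H)
            (Algebra.TensorProduct.map (Loc.incl u) (AlgHom.id ℂ H) y)) =
          Loc.incl u (Algebra.TensorProduct.rid ℂ ℂ R
            (Algebra.TensorProduct.map (AlgHom.id ℂ R) (Bialgebra.counitAlgHom ℂ H) y)) := by
        intro y
        induction y with
        | zero => simp
        | add a b ha hb => simp only [map_add, ha, hb]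
        | tmul a b => simp
      simp only [AlgHom.comp_apply, hδ]
      refine (h _).trans ?_
      exact congrArg _ (DFunLike.congr_fun (ComoduleAlgebra.counital (H := H) (R := R)) x) }

end ComoduleAlgebra

open CategoryTheory TopologicalSpace Opposite

section General
variable (H : Type) [Ring H] [HopfAlgebra ℂ H] (R : Type) [Ring R] [Algebra ℂ R]
  [ComoduleAlgebra H R]

open ComoduleAlgebra

/-- The subalgebra `R^{co H} = {b | δ(b) = b ⊗ 1}`. -/
noncomputable def coinvariants : Subalgebra ℂ R :=
  AlgHom.equalizer (coact : R →ₐ[ℂ] R ⊗[ℂ] H) Algebra.TensorProduct.includeLeft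

/-- The relations `x b ⊗ y = x ⊗ b y`, `b ∈ B`, whose quotient is `R ⊗_B R`. -/
def balancedRelations (B : Subalgebra ℂ R) : Submodule ℂ (R ⊗[ℂ] R) :=
  Submodule.span ℂ {w | ∃ (x y : R) (b : B), w = (x * b) ⊗ₜ y - x ⊗ₜ (b * y)}

/-- `x ⊗ y ↦ x y₍₀₎ ⊗ y₍₁₎` on `R ⊗ R`. -/
noncomputable def canonicalMapAux : R ⊗[ℂ] R →ₗ[ℂ] R ⊗[ℂ] H :=
  LinearMap.mul' ℂ (R ⊗[ℂ] H) ∘ₗ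
    TensorProduct.map (Algebra.TensorProduct.includeLeft : R →ₐ[ℂ] R ⊗[ℂ] H).toLinearMap
      (coact : R →ₐ[ℂ] R ⊗[ℂ] H).toLinearMap

theorem balancedRelations_le_ker :
    balancedRelations R (coinvariants H R) ≤ LinearMap.ker (canonicalMapAux H R) := by
  refine Submodule.span_le.2 ?_
  rintro _ ⟨x, y, b, rfl⟩
  have hb : coact (H := H) (b : R) = (b : R) ⊗ₜ 1 := b.2
  simp [canonicalMapAux, hb, ← mul_assoc (x ⊗ₜ[ℂ] (1 : H))]

/-- The canonical map `R ⊗_B R → R ⊗ H` for `B = R^{co H}`. -/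
noncomputable def canonicalMap :
    ((R ⊗[ℂ] R) ⧸ balancedRelations R (coinvariants H R)) →ₗ[ℂ] R ⊗[ℂ] H :=
  Submodule.liftQ _ (canonicalMapAux H R) (balancedRelations_le_ker H R)

/-- The extension `R^{co H} ⊆ R` is `H`-Galois. -/
def IsHopfGalois : Prop := Function.Bijective (canonicalMap H R)

end General

section Flat
/-- The relations `x r ⊗ y = x ⊗ r y`, for a right module `N` and a left module `M` over a possibly
noncommutative ring `R`. -/
def balancedSubgroup (R N M : Type) [Ring R] [AddCommGroup N] [Module Rᵐᵒᵖ N] [AddCommGroup M]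
    [Module R M] : AddSubgroup (N ⊗[ℤ] M) :=
  AddSubgroup.closure {w | ∃ (x : N) (r : R) (y : M),
    w = (MulOpposite.op r • x) ⊗ₜ y - x ⊗ₜ (r • y)}

/-- The tensor product `N ⊗_R M` of a right module and a left module. -/
abbrev BalancedTensor (R N M : Type) [Ring R] [AddCommGroup N] [Module Rᵐᵒᵖ N] [AddCommGroup M]
    [Module R M] : Type :=
  (N ⊗[ℤ] M) ⧸ balancedSubgroup R N M

/-- The map `f ⊗_R M`. -/
noncomputable def BalancedTensor.map {R N N' : Type} (M : Type) [Ring R] [AddCommGroup N]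
    [Module Rᵐᵒᵖ N] [AddCommGroup N'] [Module Rᵐᵒᵖ N'] [AddCommGroup M] [Module R M]
    (f : N →ₗ[Rᵐᵒᵖ] N') : BalancedTensor R N M →+ BalancedTensor R N' M :=
  QuotientAddGroup.map _ _ (f.toAddMonoidHom.toIntLinearMap.rTensor M).toAddMonoidHom <| by
    refine (AddSubgroup.closure_le _).2 ?_
    rintro _ ⟨x, r, y, rfl⟩
    refine AddSubgroup.subset_closure ⟨f x, r, y, ?_⟩
    rw [map_sub, ← f.map_smul]
    rfl

/-- The left `R`-module `M` is faithfully flat: `- ⊗_R M` preserves injections of right modules, and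
`N ⊗_R M = 0` only for `N = 0`. As `R` lies in `Type`, it suffices to test modules in `Type`. -/
structure IsFaithfullyFlat (R M : Type) [Ring R] [AddCommGroup M] [Module R M] : Prop where
  flat : ∀ (N N' : Type) [AddCommGroup N] [Module Rᵐᵒᵖ N] [AddCommGroup N'] [Module Rᵐᵒᵖ N']
    (f : N →ₗ[Rᵐᵒᵖ] N'), Function.Injective f → Function.Injective (BalancedTensor.map M f)
  faithful : ∀ (N : Type) [AddCommGroup N] [Module Rᵐᵒᵖ N],
    Subsingleton (BalancedTensor R N M) → Subsingleton N
end Flat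

section General2
variable (H : Type) [Ring H] [HopfAlgebra ℂ H] (R : Type) [Ring R] [Algebra ℂ R]
  [ComoduleAlgebra H R]
open ComoduleAlgebra

/-- A principal `H`-comodule algebra: `H`-Galois, and faithfully flat over its coinvariants, both as a
left and as a right module. -/
structure IsPrincipal : Prop where
  galois : IsHopfGalois H R
  flat_left : IsFaithfullyFlat (coinvariants H R) R
  flat_right : IsFaithfullyFlat (coinvariants H R).op R

variable {H R}
/-- `γ : H → R` is a map of right `H`-comodules. -/
def IsComoduleMap (γ : H →ₗ[ℂ] R) : Prop :=
  (coact : R →ₐ[ℂ] R ⊗[ℂ] H).toLinearMap ∘ₗ γ = TensorProduct.map γ LinearMap.id ∘ₗ comul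

/-- A cleaving map: a comodule map that is invertible for the convolution product. -/
structure IsCleavingMap (γ : H →ₗ[ℂ] R) : Prop where
  comodule : IsComoduleMap γ
  invertible : IsUnit (WithConv.toConv γ)

variable (H R)
/-- `R` is a cleft extension of its coinvariants. -/
def IsCleft : Prop := ∃ γ : H →ₗ[ℂ] R, IsCleavingMap γ

variable {R} in
/-- The algebra map `f` intertwines the coactions. -/
def IsComoduleAlgHom {R' : Type} [Ring R'] [Algebra ℂ R'] [ComoduleAlgebra H R']
    (f : R →ₐ[ℂ] R') : Prop :=
  (coact : R' →ₐ[ℂ] R' ⊗[ℂ] H).comp f =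
    (Algebra.TensorProduct.map f (AlgHom.id ℂ H)).comp coact

/-- A presheaf of `H`-comodule algebras: a presheaf of algebras with coactions that commute with the
restrictions. -/
structure ComoduleAlgPresheaf (X : TopCat.{0}) where
  presheaf : TopCat.Presheaf (AlgCat.{0} ℂ) X
  comodule (U : Opens X) : ComoduleAlgebra H (presheaf.obj (op U))
  map_coact {U V : Opens X} (h : U ⟶ V) : IsComoduleAlgHom H (presheaf.map h.op).hom

attribute [instance] ComoduleAlgPresheaf.comodule

variable {H}
/-- `F` is a quantum principal bundle over the quantum ringed space `(X, O)` with respect to the open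
covering `U`: `O` is a sheaf of algebras, `F` is a sheaf of `H`-comodule algebras, `F(U_i)^{co H}` is
`O(U_i)`, by identifications that come from one morphism `O → F` of sheaves of algebras, and `F(U_i)`
is principal. Hopf algebras of bundles have bijective antipode. -/
structure IsQuantumPrincipalBundle {X : TopCat.{0}} (O : TopCat.Presheaf (AlgCat.{0} ℂ) X)
    (F : ComoduleAlgPresheaf H X) {I : Type} (U : I → Opens X) : Prop where
  antipode_bijective : Function.Bijective (HopfAlgebra.antipode ℂ (A := H))
  isSheaf_base : O.IsSheaf
  isSheaf : F.presheaf.IsSheaf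
  cover : ⨆ i, U i = ⊤
  coinv : ∃ ι : O ⟶ F.presheaf, ∀ i, Function.Injective (ι.app (op (U i))).hom ∧
    (ι.app (op (U i))).hom.range = coinvariants H (F.presheaf.obj (op (U i)))
  principal : ∀ i, IsPrincipal H (F.presheaf.obj (op (U i)))

/-- A locally cleft quantum principal bundle, with respect to the covering `U`. -/
structure IsLocallyCleftBundle {X : TopCat.{0}} (O : TopCat.Presheaf (AlgCat.{0} ℂ) X)
    (F : ComoduleAlgPresheaf H X) {I : Type} (U : I → Opens X) : Prop extends
    IsQuantumPrincipalBundle O F U where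
  cleft : ∀ i, IsCleft H (F.presheaf.obj (op (U i)))

end General2

section Line
open scoped LinearAlgebra.Projectivization

/-- The set of points `[x₀ : x₁]` with `x_i ≠ 0`; so `U₁` is `i = 0` and `U₂` is `i = 1`. -/
def chartSet (i : Fin 2) : Set (ℙ ℂ (Fin 2 → ℂ)) := {p | p.rep i ≠ 0}

/-- The projective line, with the topology generated by `U₁` and `U₂`. -/
def P1 : TopCat.{0} :=
  @TopCat.of (ℙ ℂ (Fin 2 → ℂ)) (TopologicalSpace.generateFrom (Set.range chartSet))

/-- The open sets `U₁ = chart 0` and `U₂ = chart 1`. -/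
def chart (i : Fin 2) : Opens P1 :=
  ⟨chartSet i, TopologicalSpace.isOpen_generateFrom_of_mem ⟨i, rfl⟩⟩

/-- Labels for the five open sets `P¹`, `U₁`, `U₂`, `U₁ ∩ U₂`, `∅`. -/
inductive OpenKind | whole | one | two | both | empty

namespace OpenKind
/-- Inclusion of the open sets. -/
def le : OpenKind → OpenKind → Prop
  | empty, _ => True
  | _, whole => True
  | both, both => True
  | both, one => True
  | both, two => True
  | one, one => True
  | two, two => True
  | _, _ => False

open Classical in
/-- The label of an open set of `P1`. -/
noncomputable def of (U : Opens P1) : OpenKind :=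
  if chart 0 ⊔ chart 1 ≤ U then whole
  else if chart 0 ≤ U then one
  else if chart 1 ≤ U then two
  else if chart 0 ⊓ chart 1 ≤ U then both
  else empty

theorem of_mono {U V : Opens P1} (h : U ≤ V) : (of U).le (of V) := by
  unfold of
  by_cases a1 : chart 0 ≤ U <;> by_cases a2 : chart 1 ≤ U <;>
  by_cases a3 : chart 0 ⊓ chart 1 ≤ U <;> by_cases b1 : chart 0 ≤ V <;>
  by_cases b2 : chart 1 ≤ V <;> by_cases b3 : chart 0 ⊓ chart 1 ≤ V <;>
  simp only [sup_le_iff, a1, a2, a3, b1, b2, b3, and_true, and_false, if_true, if_false, le] <;>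
  first
    | exact absurd (a1.trans h) b1
    | exact absurd (a2.trans h) b2
    | exact absurd (a3.trans h) b3
end OpenKind

/-- A commutative square of algebras `G → R₁ → R₁₂`, `G → R₂ → R₁₂`. -/
structure AlgSquare where
  (G R₁ R₂ R₁₂ : AlgCat.{0} ℂ)
  (g₁ : G ⟶ R₁) (g₂ : G ⟶ R₂) (r₁ : R₁ ⟶ R₁₂) (r₂ : R₂ ⟶ R₁₂)
  comm : g₁ ≫ r₁ = g₂ ≫ r₂

namespace AlgSquare
variable (S : AlgSquare)
/-- The values `G, R₁, R₂, R₁₂, 0` over `P¹, U₁, U₂, U₁ ∩ U₂, ∅`. -/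
def obj : OpenKind → AlgCat.{0} ℂ
  | .whole => S.G
  | .one => S.R₁
  | .two => S.R₂
  | .both => S.R₁₂
  | .empty => AlgCat.of ℂ PUnit

/-- The map to the one-element algebra. -/
noncomputable def toEmpty (R : AlgCat.{0} ℂ) : R ⟶ AlgCat.of ℂ PUnit.{1} :=
  AlgCat.ofHom (AlgHom.ofLinearMap 0 (Subsingleton.elim _ _) (fun _ _ => Subsingleton.elim _ _))

/-- The restriction maps. -/
noncomputable def res : (k l : OpenKind) → l.le k → (S.obj k ⟶ S.obj l)
  | _, .empty, _ => toEmpty _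
  | .whole, .whole, _ => 𝟙 _
  | .whole, .one, _ => S.g₁
  | .whole, .two, _ => S.g₂
  | .whole, .both, _ => S.g₁ ≫ S.r₁
  | .one, .one, _ => 𝟙 _
  | .one, .both, _ => S.r₁
  | .two, .two, _ => 𝟙 _
  | .two, .both, _ => S.r₂
  | .both, .both, _ => 𝟙 _

theorem to_empty_ext {R : AlgCat.{0} ℂ} (f g : R ⟶ AlgCat.of ℂ PUnit.{1}) : f = g :=
  by
  apply AlgCat.hom_ext
  exact AlgHom.ext fun _ => Subsingleton.elim (α := PUnit.{1}) _ _

theorem res_self (k : OpenKind) (h : k.le k) : S.res k k h = 𝟙 _ := by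
  cases k
  case empty => exact to_empty_ext _ _
  all_goals rfl

theorem res_comp (k l m : OpenKind) (h : l.le k) (h' : m.le l) (h'' : m.le k) :
    S.res k l h ≫ S.res l m h' = S.res k m h'' := by
  cases m
  case empty => exact to_empty_ext _ _
  all_goals cases l <;> first | exact h'.elim | skip
  all_goals cases k <;> first | exact h.elim | skip
  all_goals first
    | exact Category.id_comp _ | exact Category.comp_id _ | rfl | exact S.comm.symm

/-- The presheaf of algebras on the projective line given by the square. -/
noncomputable def presheaf : TopCat.Presheaf (AlgCat.{0} ℂ) P1 where
  obj U := S.obj (OpenKind.of U.unop)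
  map f := S.res _ _ (OpenKind.of_mono f.unop.le)
  map_id _ := S.res_self _ _
  map_comp _ _ := (S.res_comp _ _ _ _ _ _).symm
end AlgSquare

/-- A commutative square of `H`-comodule algebras. -/
structure ComoduleAlgSquare (H : Type) [Ring H] [HopfAlgebra ℂ H] extends AlgSquare where
  [cG : ComoduleAlgebra H G]
  [c₁ : ComoduleAlgebra H R₁]
  [c₂ : ComoduleAlgebra H R₂]
  [c₁₂ : ComoduleAlgebra H R₁₂]
  hg₁ : IsComoduleAlgHom H g₁.hom
  hg₂ : IsComoduleAlgHom H g₂.hom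
  hr₁ : IsComoduleAlgHom H r₁.hom
  hr₂ : IsComoduleAlgHom H r₂.hom

attribute [instance] ComoduleAlgSquare.cG ComoduleAlgSquare.c₁ ComoduleAlgSquare.c₂
  ComoduleAlgSquare.c₁₂

namespace ComoduleAlgSquare
variable {H : Type} [Ring H] [HopfAlgebra ℂ H] (S : ComoduleAlgSquare H)

noncomputable instance comodule (k : OpenKind) : ComoduleAlgebra H (S.toAlgSquare.obj k) :=
  match k with
  | .whole => S.cG
  | .one => S.c₁
  | .two => S.c₂
  | .both => S.c₁₂
  | .empty => ComoduleAlgebra.punit H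

theorem isComoduleAlgHom_id (R : Type) [Ring R] [Algebra ℂ R] [ComoduleAlgebra H R] :
    IsComoduleAlgHom H (AlgHom.id ℂ R) := by
  rw [IsComoduleAlgHom, Algebra.TensorProduct.map_id, AlgHom.id_comp, AlgHom.comp_id]

theorem isComoduleAlgHom_comp {R R' R'' : Type} [Ring R] [Algebra ℂ R] [ComoduleAlgebra H R]
    [Ring R'] [Algebra ℂ R'] [ComoduleAlgebra H R'] [Ring R''] [Algebra ℂ R'']
    [ComoduleAlgebra H R''] {f : R →ₐ[ℂ] R'} {g : R' →ₐ[ℂ] R''} (hf : IsComoduleAlgHom H f)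
    (hg : IsComoduleAlgHom H g) : IsComoduleAlgHom H (g.comp f) := by
  unfold IsComoduleAlgHom at *
  rw [← AlgHom.comp_assoc, hg, AlgHom.comp_assoc, hf, ← AlgHom.comp_assoc,
    ← Algebra.TensorProduct.map_comp, AlgHom.comp_id]

theorem res_coact (k l : OpenKind) (h : l.le k) :
    IsComoduleAlgHom H (S.toAlgSquare.res k l h).hom := by
  cases l
  case empty =>
    have := subsingleton_punit_tensor H
    exact AlgHom.ext fun _ => Subsingleton.elim (α := PUnit.{1} ⊗[ℂ] H) _ _
  all_goals cases k <;> first | exact h.elim | skip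
  all_goals first
    | exact S.hg₁ | exact S.hg₂ | exact S.hr₁ | exact S.hr₂
    | exact isComoduleAlgHom_comp S.hg₁ S.hr₁ | exact isComoduleAlgHom_id S.G
    | exact isComoduleAlgHom_id S.R₁ | exact isComoduleAlgHom_id S.R₂
    | exact isComoduleAlgHom_id S.R₁₂

/-- The presheaf of `H`-comodule algebras on the projective line given by the square. -/
noncomputable def presheaf : ComoduleAlgPresheaf H P1 where
  presheaf := S.toAlgSquare.presheaf
  comodule U := S.comodule (OpenKind.of U)
  map_coact _ := S.res_coact _ _ _
end ComoduleAlgSquare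

open Polynomial in
/-- The (classical) structure sheaf of the projective line: `ℂ` over `P¹`, `ℂ[z]` over `U₁`, `ℂ[w]` over
`U₂` and `ℂ[z, z⁻¹]` over `U₁ ∩ U₂`, with `w = z⁻¹`. -/
noncomputable def lineSquare : AlgSquare where
  G := AlgCat.of ℂ ℂ
  R₁ := AlgCat.of ℂ ℂ[X]
  R₂ := AlgCat.of ℂ ℂ[X]
  R₁₂ := AlgCat.of ℂ (LaurentPolynomial ℂ)
  g₁ := AlgCat.ofHom (Algebra.ofId ℂ ℂ[X])
  g₂ := AlgCat.ofHom (Algebra.ofId ℂ ℂ[X])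
  r₁ := AlgCat.ofHom (aeval (LaurentPolynomial.T 1))
  r₂ := AlgCat.ofHom (aeval (LaurentPolynomial.T (-1)))
  comm := by
    ext

end Line

section Concrete
variable (q : ℂ)

/-- The quantum determinant as a unit. -/
noncomputable def OGL.D : (OGL q)ˣ := ⟨OGL.det q, OGL.gen q .Dinv, OGL.det_inv, OGL.inv_det⟩

namespace OP
/-- `n`, the image of `b` in `H`. -/
noncomputable def n : OP q := Ideal.Quotient.mk _ (OGL.gen q .b)
/-- `s`, the image of `d` in `H`. -/
noncomputable def s : OP q := Ideal.Quotient.mk _ (OGL.gen q .d)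
/-- `D̃`, the image of the quantum determinant in `H`. -/
noncomputable def D : (OP q)ˣ :=
  Units.map (Ideal.Quotient.mk (OGL.borelIdeal q) : OGL q →* OP q) (OGL.D q)

variable [NeZero q]

/-- `t`, the image of `a` in `H`, with inverse `s D̃⁻¹`. -/
noncomputable def t : (OP q)ˣ where
  val := Ideal.Quotient.mk _ (OGL.gen q .a)
  inv := Ideal.Quotient.mk _ (OGL.gen q .d * OGL.gen q .Dinv)
  val_inv := by
    rw [← map_mul, ← mul_assoc]
    have h : OGL.gen q .a * OGL.gen q .d = OGL.det q + q⁻¹ • (OGL.gen q .b * OGL.gen q .c) := by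
      rw [OGL.det, sub_add_cancel]
    rw [h, add_mul, OGL.det_inv, map_add, Algebra.smul_mul_assoc, Algebra.smul_def]
    simp only [map_mul, map_one, OGL.mk_gen_c, mul_zero, zero_mul, add_zero]
  inv_val := by
    have hq : q ≠ 0 := NeZero.ne q
    rw [← map_mul, mul_assoc, OGL.rDa hq, ← mul_assoc, OGL.rda]
    have h : OGL.gen q .a * OGL.gen q .d = OGL.det q + q⁻¹ • (OGL.gen q .b * OGL.gen q .c) := by
      rw [OGL.det, sub_add_cancel]
    rw [h, add_mul, OGL.det_inv, map_add, Algebra.smul_mul_assoc, Algebra.smul_def]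
    simp only [map_mul, map_one, OGL.mk_gen_c, mul_zero, zero_mul, add_zero]
end OP

/-- `A[a⁻¹]` -/
abbrev A1 : Type := Loc (OGL q) (OGL.gen q .a)
/-- `A[c⁻¹]` -/
abbrev A2 : Type := Loc (OGL q) (OGL.gen q .c)
/-- `A[a⁻¹][c⁻¹]` -/
abbrev A12 : Type := Loc (A1 q) (Loc.incl (OGL.gen q .a) (OGL.gen q .c))

/-- The restriction `A[a⁻¹] → A[a⁻¹][c⁻¹]`. -/
noncomputable def res1 : A1 q →ₐ[ℂ] A12 q := Loc.incl _
/-- The restriction `A[c⁻¹] → A[a⁻¹][c⁻¹]`. -/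
noncomputable def res2 : A2 q →ₐ[ℂ] A12 q :=
  Loc.lift ((Loc.incl _).comp (Loc.incl (OGL.gen q .a))) (Loc.unit _) rfl

theorem res2_incl :
    (res2 q).comp (Loc.incl (OGL.gen q .c)) = (res1 q).comp (Loc.incl (OGL.gen q .a)) :=
  AlgHom.ext fun x => Loc.lift_incl _ _ _ x

variable [NeZero q]

open ComoduleAlgebra

/-- The coaction `(id ⊗ pr) ∘ Δ` of `H` on `A`. -/
noncomputable instance : ComoduleAlgebra (OP q) (OGL q) := ofBialgHom (OP.pr q)

theorem coact_gen (x : GLGen) : coact (H := OP q) (OGL.gen q x) =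
    Algebra.TensorProduct.map (AlgHom.id ℂ (OGL q)) (Ideal.Quotient.mkₐ ℂ (OGL.borelIdeal q))
      (OGL.comulFun q x) := by
  rw [← OGL.comul_gen]; rfl

theorem coact_a : coact (H := OP q) (OGL.gen q .a) = OGL.gen q .a ⊗ₜ (OP.t q : OP q) := by
  simp [coact_gen, OGL.comulFun, OGL.mk_gen_c, OP.t]

theorem coact_c : coact (H := OP q) (OGL.gen q .c) = OGL.gen q .c ⊗ₜ (OP.t q : OP q) := by
  simp [coact_gen, OGL.comulFun, OGL.mk_gen_c, OP.t]

noncomputable instance : ComoduleAlgebra (OP q) (A1 q) :=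
  loc (OP q) (OGL.gen q .a) (OP.t q) (coact_a q)

noncomputable instance : ComoduleAlgebra (OP q) (A2 q) :=
  loc (OP q) (OGL.gen q .c) (OP.t q) (coact_c q)

theorem coact_incl_a (x : OGL q) : coact (H := OP q) (Loc.incl (OGL.gen q .a) x) =
    Algebra.TensorProduct.map (Loc.incl (OGL.gen q .a)) (AlgHom.id ℂ (OP q)) (coact x) :=
  Loc.lift_incl _ _ _ x

theorem coact_incl_c (x : OGL q) : coact (H := OP q) (Loc.incl (OGL.gen q .c) x) =
    Algebra.TensorProduct.map (Loc.incl (OGL.gen q .c)) (AlgHom.id ℂ (OP q)) (coact x) :=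
  Loc.lift_incl _ _ _ x

noncomputable instance : ComoduleAlgebra (OP q) (A12 q) :=
  loc (OP q) (Loc.incl (OGL.gen q .a) (OGL.gen q .c)) (OP.t q) (by
    rw [coact_incl_a, coact_c]; simp)

theorem coact_res1 (x : A1 q) : coact (H := OP q) (res1 q x) =
    Algebra.TensorProduct.map (res1 q) (AlgHom.id ℂ (OP q)) (coact x) :=
  Loc.lift_incl _ _ _ x

theorem isComoduleAlgHom_res2 : IsComoduleAlgHom (OP q) (res2 q) := by
  apply Loc.hom_ext
  rw [AlgHom.comp_assoc, res2_incl]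
  ext x
  have h (y : OGL q ⊗[ℂ] OP q) :
      Algebra.TensorProduct.map (res1 q) (AlgHom.id ℂ (OP q))
        (Algebra.TensorProduct.map (Loc.incl (OGL.gen q .a)) (AlgHom.id ℂ (OP q)) y) =
      Algebra.TensorProduct.map (res2 q) (AlgHom.id ℂ (OP q))
        (Algebra.TensorProduct.map (Loc.incl (OGL.gen q .c)) (AlgHom.id ℂ (OP q)) y) := by
    induction y with
    | zero => simp
    | add a b ha hb => simp only [map_add, ha, hb]
    | tmul a b =>
      simp only [Algebra.TensorProduct.map_tmul]
      rw [← AlgHom.comp_apply (res2 q), res2_incl]; rfl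
  simp only [AlgHom.comp_apply]
  rw [coact_res1, coact_incl_a, coact_incl_c, h]

/-- The square `A → A[a⁻¹] → A[a⁻¹][c⁻¹]`, `A → A[c⁻¹] → A[a⁻¹][c⁻¹]`. -/
noncomputable def bundleSquare : ComoduleAlgSquare (OP q) where
  G := AlgCat.of ℂ (OGL q)
  R₁ := AlgCat.of ℂ (A1 q)
  R₂ := AlgCat.of ℂ (A2 q)
  R₁₂ := AlgCat.of ℂ (A12 q)
  g₁ := AlgCat.ofHom (Loc.incl (OGL.gen q .a))
  g₂ := AlgCat.ofHom (Loc.incl (OGL.gen q .c))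
  r₁ := AlgCat.ofHom (res1 q)
  r₂ := AlgCat.ofHom (res2 q)
  comm := by
    apply AlgCat.hom_ext
    exact (res2_incl q).symm
  cG := inferInstanceAs (ComoduleAlgebra (OP q) (OGL q))
  c₁ := inferInstanceAs (ComoduleAlgebra (OP q) (A1 q))
  c₂ := inferInstanceAs (ComoduleAlgebra (OP q) (A2 q))
  c₁₂ := inferInstanceAs (ComoduleAlgebra (OP q) (A12 q))
  hg₁ := AlgHom.ext (coact_incl_a q)
  hg₂ := AlgHom.ext (coact_incl_c q)
  hr₁ := AlgHom.ext (coact_res1 q)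
  hr₂ := isComoduleAlgHom_res2 q

/-- The sheaf `F` of `Õ_q(P)`-comodule algebras on the projective line. -/
noncomputable def bundle : ComoduleAlgPresheaf (OP q) P1 := (bundleSquare q).presheaf

end Concrete

/-! Distinguished elements of the charts. -/

namespace A1
variable (q : ℂ)
/-- `a`, invertible in `A[a⁻¹]`. -/
noncomputable def a : (A1 q)ˣ := Loc.unit (OGL.gen q .a)
/-- `b` in `A[a⁻¹]`. -/
noncomputable def b : A1 q := Loc.incl _ (OGL.gen q .b)
/-- `c` in `A[a⁻¹]`. -/
noncomputable def c : A1 q := Loc.incl _ (OGL.gen q .c)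
/-- The quantum determinant in `A[a⁻¹]`. -/
noncomputable def D : (A1 q)ˣ := Units.map (Loc.incl (OGL.gen q .a) : OGL q →* A1 q) (OGL.D q)
end A1

namespace A2
variable (q : ℂ)
/-- `a` in `A[c⁻¹]`. -/
noncomputable def a : A2 q := Loc.incl _ (OGL.gen q .a)
/-- `c`, invertible in `A[c⁻¹]`. -/
noncomputable def c : (A2 q)ˣ := Loc.unit (OGL.gen q .c)
/-- `d` in `A[c⁻¹]`. -/
noncomputable def d : A2 q := Loc.incl _ (OGL.gen q .d)
/-- The quantum determinant in `A[c⁻¹]`. -/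
noncomputable def D : (A2 q)ˣ := Units.map (Loc.incl (OGL.gen q .c) : OGL q →* A2 q) (OGL.D q)
end A2

section Charts
variable {H : Type} [Ring H] [HopfAlgebra ℂ H]

/-- Restriction from `V` to `U ⊆ V` in a presheaf of `H`-comodule algebras. -/
def ComoduleAlgPresheaf.res {X : TopCat.{0}} (F : ComoduleAlgPresheaf H X) {U V : Opens X}
    (h : U ≤ V) : F.presheaf.obj (op V) →ₐ[ℂ] F.presheaf.obj (op U) :=
  (F.presheaf.map (homOfLE h).op).hom

variable (q : ℂ) [NeZero q]

/-- `F` has sections `A`, `A[a⁻¹]`, `A[c⁻¹]`, `A[a⁻¹][c⁻¹]`, `0` over `P¹`, `U₁`, `U₂`, `U₁ ∩ U₂`,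
`∅`, as comodule algebras, and its restriction maps are the localization maps. -/
def HasLocalizationSections (F : ComoduleAlgPresheaf (OP q) P1) : Prop :=
  ∃ (e : OGL q ≃ₐ[ℂ] F.presheaf.obj (op ⊤))
    (e₁ : A1 q ≃ₐ[ℂ] F.presheaf.obj (op (chart 0)))
    (e₂ : A2 q ≃ₐ[ℂ] F.presheaf.obj (op (chart 1)))
    (e₁₂ : A12 q ≃ₐ[ℂ] F.presheaf.obj (op (chart 0 ⊓ chart 1))),
    IsComoduleAlgHom (OP q) e.toAlgHom ∧ IsComoduleAlgHom (OP q) e₁.toAlgHom ∧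
    IsComoduleAlgHom (OP q) e₂.toAlgHom ∧ IsComoduleAlgHom (OP q) e₁₂.toAlgHom ∧
    (∀ x, F.res le_top (e x) = e₁ (Loc.incl _ x)) ∧
    (∀ x, F.res le_top (e x) = e₂ (Loc.incl _ x)) ∧
    (∀ x, F.res inf_le_left (e₁ x) = e₁₂ (res1 q x)) ∧
    (∀ x, F.res inf_le_right (e₂ x) = e₁₂ (res2 q x)) ∧
    Subsingleton (F.presheaf.obj (op ⊥))

/-- `F` has sections `A[a⁻¹]` and `A[c⁻¹]` over `U₁` and `U₂`, as comodule algebras, glued over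
`U₁ ∩ U₂` in any way that makes the coordinates `c a⁻¹` and `a c⁻¹` of the base inverse to each
other. -/
def HasChartSections (F : ComoduleAlgPresheaf (OP q) P1) : Prop :=
  ∃ (e₁ : A1 q ≃ₐ[ℂ] F.presheaf.obj (op (chart 0)))
    (e₂ : A2 q ≃ₐ[ℂ] F.presheaf.obj (op (chart 1))),
    IsComoduleAlgHom (OP q) e₁.toAlgHom ∧ IsComoduleAlgHom (OP q) e₂.toAlgHom ∧
    F.res inf_le_left (e₁ (A1.c q * ↑(A1.a q)⁻¹)) *
      F.res inf_le_right (e₂ (A2.a q * ↑(A2.c q)⁻¹)) =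
        (1 : F.presheaf.obj (op (chart 0 ⊓ chart 1))) ∧
    F.res inf_le_right (e₂ (A2.a q * ↑(A2.c q)⁻¹)) *
      F.res inf_le_left (e₁ (A1.c q * ↑(A1.a q)⁻¹)) =
        (1 : F.presheaf.obj (op (chart 0 ⊓ chart 1)))

end Charts

/-! ### Elements that commute up to a scalar -/

section QComm
variable {R : Type*} [Ring R] [Algebra ℂ R]

/-- `x` and `y` commute up to a non-zero scalar. -/
def QComm (x y : R) : Prop := ∃ s : ℂ, s ≠ 0 ∧ x * y = s • (y * x)

theorem QComm.symm {x y : R} (h : QComm x y) : QComm y x := by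
  obtain ⟨s, hs, h⟩ := h
  exact ⟨s⁻¹, inv_ne_zero hs, by rw [h, smul_smul, inv_mul_cancel₀ hs, one_smul]⟩

theorem QComm.refl (x : R) : QComm x x := ⟨1, one_ne_zero, by rw [one_smul]⟩

theorem QComm.of_commute {x y : R} (h : x * y = y * x) : QComm x y :=
  ⟨1, one_ne_zero, by rw [one_smul, h]⟩

theorem QComm.one_right (x : R) : QComm x 1 := .of_commute (by rw [mul_one, one_mul])

theorem QComm.mul_right {x y z : R} (h : QComm x y) (h' : QComm x z) : QComm x (y * z) := by
  obtain ⟨s, hs, h⟩ := h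
  obtain ⟨s', hs', h'⟩ := h'
  exact ⟨s * s', mul_ne_zero hs hs', by
    rw [← mul_assoc, h, smul_mul_assoc, mul_assoc, h', mul_smul_comm, smul_smul, mul_assoc]⟩

theorem QComm.mul_left {x y z : R} (h : QComm x z) (h' : QComm y z) : QComm (x * y) z :=
  (h.symm.mul_right h'.symm).symm

theorem QComm.pow_right {x y : R} (h : QComm x y) (n : ℕ) : QComm x (y ^ n) := by
  induction n with
  | zero => rw [pow_zero]; exact .one_right x
  | succ n ih => rw [pow_succ]; exact ih.mul_right h

theorem QComm.inv_right {x : R} {u : Rˣ} (h : QComm x u) : QComm x ↑u⁻¹ := by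
  obtain ⟨s, hs, h⟩ := h
  refine QComm.symm ⟨s, hs, ?_⟩
  rw [Units.inv_mul_eq_iff_eq_mul, mul_smul_comm, ← mul_assoc, ← smul_mul_assoc, ← h,
    Units.mul_inv_cancel_right]

theorem QComm.zpow_right {x : R} {u : Rˣ} (h : QComm x u) (n : ℤ) : QComm x ↑(u ^ n) := by
  cases n with
  | ofNat n => simpa using h.pow_right n
  | negSucc n => rw [zpow_negSucc, ← inv_pow]; simpa using h.inv_right.pow_right (n + 1)

theorem QComm.map {S : Type*} [Ring S] [Algebra ℂ S] (f : R →ₐ[ℂ] S) {x y : R} (h : QComm x y) :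
    QComm (f x) (f y) := by
  obtain ⟨s, hs, h⟩ := h
  exact ⟨s, hs, by rw [← map_mul, h, map_smul, map_mul]⟩

/-- A subspace that contains `1` and is stable under left multiplication by generators is
everything. -/
theorem Submodule.eq_top_of_adjoin {s : Set R} (hs : Algebra.adjoin ℂ s = ⊤) (M : Submodule ℂ R)
    (h1 : (1 : R) ∈ M) (h : ∀ g ∈ s, ∀ x ∈ M, g * x ∈ M) : M = ⊤ := by
  have key : ∀ y ∈ Algebra.adjoin ℂ s, ∀ x ∈ M, y * x ∈ M := by
    intro y hy
    induction hy using Algebra.adjoin_induction with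
    | mem y hy => exact h y hy
    | algebraMap r => intro x hx; rw [← Algebra.smul_def]; exact M.smul_mem r hx
    | add y z _ _ hy hz => intro x hx; rw [add_mul]; exact M.add_mem (hy x hx) (hz x hx)
    | mul y z _ _ hy hz => intro x hx; rw [mul_assoc]; exact hy _ (hz x hx)
  rw [eq_top_iff]
  intro y _
  simpa using key y (hs ▸ Algebra.mem_top) 1 h1

/-- If `z, D, u, v` commute up to scalars and generate `R` together with `D⁻¹, u⁻¹`, then the
monomials `z ^ k D ^ p u ^ m v ^ r` span `R`. -/
theorem span_monomials_eq_top {z v : R} {D u : Rˣ}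
    (hgen : Algebra.adjoin ℂ {z, v, (D : R), ↑D⁻¹, (u : R), ↑u⁻¹} = ⊤)
    (hDz : QComm (D : R) z) (huz : QComm (u : R) z) (huD : QComm (u : R) D)
    (hvz : QComm v z) (hvD : QComm v D) (hvu : QComm v u) :
    Submodule.span ℂ (Set.range fun i : (ℤ × ℤ × ℕ) × ℕ =>
      z ^ i.2 * (↑(D ^ i.1.1 * u ^ i.1.2.1) * v ^ i.1.2.2)) = ⊤ := by
  set M := Submodule.span ℂ (Set.range fun i : (ℤ × ℤ × ℕ) × ℕ =>
      z ^ i.2 * (↑(D ^ i.1.1 * u ^ i.1.2.1) * v ^ i.1.2.2)) with hM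
  have mem (k : ℕ) (p m : ℤ) (r : ℕ) : z ^ k * (↑(D ^ p * u ^ m) * v ^ r) ∈ M :=
    Submodule.subset_span ⟨((p, m, r), k), rfl⟩
  have red (g : R) (h : ∀ (k : ℕ) (p m : ℤ) (r : ℕ), g * (z ^ k * (↑(D ^ p * u ^ m) * v ^ r)) ∈ M) :
      ∀ x ∈ M, g * x ∈ M := by
    intro x hx
    induction hx using Submodule.span_induction with
    | mem x hx => obtain ⟨⟨⟨p, m, r⟩, k⟩, rfl⟩ := hx; exact h k p m r
    | zero => rw [mul_zero]; exact M.zero_mem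
    | add x y _ _ hx hy => rw [mul_add]; exact M.add_mem hx hy
    | smul c x _ hx => rw [mul_smul_comm]; exact M.smul_mem c hx
  have hD (e : ℤ) : ∀ x ∈ M, ↑(D ^ e) * x ∈ M := by
    refine red _ fun k p m r => ?_
    obtain ⟨s, -, hs⟩ := ((hDz.symm.zpow_right e).symm.pow_right k)
    rw [← mul_assoc, hs, smul_mul_assoc, mul_assoc, ← mul_assoc _ _ (v ^ r), ← Units.val_mul,
      ← mul_assoc (D ^ e), ← zpow_add]
    exact M.smul_mem _ (mem _ _ _ _)
  have hu (e : ℤ) : ∀ x ∈ M, ↑(u ^ e) * x ∈ M := by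
    refine red _ fun k p m r => ?_
    obtain ⟨s, -, hs⟩ := ((huz.symm.zpow_right e).symm.pow_right k)
    obtain ⟨s', -, hs'⟩ := ((huD.symm.zpow_right e).symm.zpow_right p)
    rw [← mul_assoc, hs, smul_mul_assoc, mul_assoc, Units.val_mul, ← mul_assoc _ _ (v ^ r),
      ← mul_assoc _ _ (↑(u ^ m) : R), hs', smul_mul_assoc, smul_mul_assoc, mul_smul_comm,
      mul_assoc _ _ (↑(u ^ m) : R), ← Units.val_mul, ← zpow_add, ← Units.val_mul]
    exact M.smul_mem _ (M.smul_mem _ (mem _ _ _ _))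
  refine Submodule.eq_top_of_adjoin hgen M (by simpa using mem 0 0 0 0) ?_
  rintro g (rfl | rfl | rfl | rfl | rfl | rfl)
  · refine red _ fun k p m r => ?_
    rw [← mul_assoc, ← pow_succ']
    exact mem _ _ _ _
  · refine red _ fun k p m r => ?_
    obtain ⟨s, -, hs⟩ := hvz.pow_right k
    obtain ⟨s', -, hs'⟩ := (hvD.zpow_right p).mul_right (hvu.zpow_right m)
    rw [← mul_assoc, hs, smul_mul_assoc, mul_assoc, ← mul_assoc _ _ (_ ^ r), Units.val_mul, hs',
      smul_mul_assoc, mul_smul_comm, mul_assoc _ _ (_ ^ r), ← pow_succ', ← Units.val_mul]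
    exact M.smul_mem _ (M.smul_mem _ (mem _ _ _ _))
  · simpa using hD 1
  · simpa using hD (-1)
  · simpa using hu 1
  · simpa using hu (-1)

end QComm

/-! ### Localizations -/

namespace Loc
variable {R : Type} [Ring R] [Algebra ℂ R] (u : R)

theorem adjoin_eq_top {s : Set R} (hs : Algebra.adjoin ℂ s = ⊤) :
    Algebra.adjoin ℂ (insert (↑(unit u)⁻¹) (incl u '' s)) = ⊤ := by
  have h : (mk u).range = ⊤ :=
    AlgHom.range_eq_top _ |>.2 (RingQuot.mkAlgHom_surjective ℂ _)
  rw [eq_top_iff, ← h, ← Algebra.map_top, ← FreeAlgebra.adjoin_range_ι, AlgHom.map_adjoin,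
    ← Set.range_comp]
  refine Algebra.adjoin_le ?_
  rintro _ ⟨o, rfl⟩
  cases o with
  | none => exact Algebra.subset_adjoin (Set.mem_insert _ _)
  | some x =>
    have hx : incl u x ∈ (Algebra.adjoin ℂ s).map (incl u) := ⟨x, hs ▸ Algebra.mem_top, rfl⟩
    rw [AlgHom.map_adjoin] at hx
    exact Algebra.adjoin_mono (Set.subset_insert _ _) hx

theorem val_unit : (unit u : Loc R u) = incl u u := rfl

/-- If `u` commutes up to scalars with generators of `R`, then every element of `R[u⁻¹]` has a
denominator that is a power of `u`. -/
theorem exists_pow_mul_eq {s : Set R} (hs : Algebra.adjoin ℂ s = ⊤) (hu : ∀ g ∈ s, QComm u g)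
    (x : Loc R u) : ∃ (n : ℕ) (y : R), incl u u ^ n * x = incl u y := by
  let M : Submodule ℂ (Loc R u) :=
    { carrier := {x | ∃ (n : ℕ) (y : R), incl u u ^ n * x = incl u y}
      zero_mem' := ⟨0, 0, by simp⟩
      add_mem' := by
        rintro x x' ⟨n, y, h⟩ ⟨n', y', h'⟩
        refine ⟨n + n', u ^ n' * y + u ^ n * y', ?_⟩
        rw [mul_add, add_comm n, pow_add, mul_assoc, h, ← pow_add, add_comm n', pow_add, mul_assoc, h']
        simp only [map_add, map_mul, map_pow]
      smul_mem' := by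
        rintro c x ⟨n, y, h⟩
        exact ⟨n, c • y, by rw [mul_smul_comm, h, map_smul]⟩ }
  have hM : M = ⊤ := by
    refine Submodule.eq_top_of_adjoin (adjoin_eq_top u hs) M ⟨0, 1, by simp⟩ ?_
    rintro g (rfl | ⟨g, hg, rfl⟩) x ⟨n, y, h⟩
    · refine ⟨n + 1, y, ?_⟩
      rw [← h, pow_succ, mul_assoc, ← val_unit, Units.mul_inv_cancel_left]
    · obtain ⟨t, -, ht⟩ := ((hu g hg).map (incl u)).symm.pow_right n |>.symm
      exact ⟨n, t • (g * y), by rw [← mul_assoc, ht, smul_mul_assoc, mul_assoc, h, map_smul, map_mul]⟩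
  have hx : x ∈ M := hM ▸ Submodule.mem_top
  exact hx

end Loc

/-! ### A representation of the function algebra by shift operators -/

/-- The exponents `(i, l, j, k)` of the monomials `a ^ i D ^ l b ^ j c ^ k`. -/
abbrev TorusExp : Type := ℤ × ℤ × ℤ × ℤ

namespace Torus

/-- The operator `e_w ↦ f(w) e_{w + u}`. -/
noncomputable def shift (u : TorusExp) (f : TorusExp → ℂ) : Module.End ℂ (TorusExp →₀ ℂ) :=
  Finsupp.lsum ℂ fun w => f w • Finsupp.lsingle (w + u)

theorem shift_single (u : TorusExp) (f : TorusExp → ℂ) (w : TorusExp) (s : ℂ) :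
    shift u f (Finsupp.single w s) = Finsupp.single (w + u) (f w * s) := by
  simp [shift]

theorem shift_apply (u : TorusExp) (f : TorusExp → ℂ) (x : TorusExp →₀ ℂ) (w : TorusExp) :
    shift u f x w = f (w - u) * x (w - u) := by
  induction x using Finsupp.induction_linear with
  | zero => simp
  | add x y hx hy => rw [map_add, Finsupp.add_apply, hx, hy, Finsupp.add_apply, mul_add]
  | single v s =>
    rw [shift_single]
    by_cases h : v = w - u
    · subst h; simp
    · rw [Finsupp.single_eq_of_ne, Finsupp.single_eq_of_ne (Ne.symm h), mul_zero]
      rintro rfl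
      simp at h

/-- The operator `e_w ↦ f(w) e_{w + u}` as a unit, for non-vanishing `f`. -/
noncomputable def shiftUnit (u : TorusExp) (f : TorusExp → ℂ) (hf : ∀ w, f w ≠ 0) :
    (Module.End ℂ (TorusExp →₀ ℂ))ˣ where
  val := shift u f
  inv := shift (-u) fun w => (f (w - u))⁻¹
  val_inv := by
    ext w : 1
    ext : 1
    simp [shift_single, hf, ← sub_eq_add_neg]
  inv_val := by
    ext w : 1
    ext : 1
    simp [shift_single, hf]

theorem shiftUnit_inv_val (u : TorusExp) (f : TorusExp → ℂ) (hf : ∀ w, f w ≠ 0) :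
    (↑(shiftUnit u f hf)⁻¹ : Module.End ℂ (TorusExp →₀ ℂ)) =
      shift (-u) fun w => (f (w - u))⁻¹ := rfl

/-- The coefficient of `e_x` in `v` is non-zero, and all other terms of `v` have smaller degree in
`b`. -/
def HasLead (v : TorusExp →₀ ℂ) (x : TorusExp) : Prop :=
  v x ≠ 0 ∧ ∀ y, v y ≠ 0 → y = x ∨ y.2.2.1 < x.2.2.1

theorem hasLead_single (x : TorusExp) : HasLead (Finsupp.single x 1) x :=
  ⟨by simp, fun y hy => by
    by_contra! h
    exact hy (Finsupp.single_eq_of_ne h.1)⟩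

theorem hasLead_shift {u : TorusExp} {f : TorusExp → ℂ} (hf : ∀ w, f w ≠ 0) {v : TorusExp →₀ ℂ}
    {x : TorusExp} (h : HasLead v x) : HasLead (shift u f v) (x + u) := by
  refine ⟨by rw [shift_apply, add_sub_cancel_right]; exact mul_ne_zero (hf _) h.1, fun y hy => ?_⟩
  rw [shift_apply] at hy
  rcases h.2 _ (right_ne_zero_of_mul hy) with h | h
  · exact .inl (by rw [← h, sub_add_cancel])
  · refine .inr ?_
    simp only [Prod.snd_sub, Prod.fst_sub, Prod.snd_add, Prod.fst_add] at h ⊢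
    omega

theorem hasLead_zpow {u : TorusExp} {f : TorusExp → ℂ} (hf : ∀ w, f w ≠ 0) (n : ℤ)
    {v : TorusExp →₀ ℂ} {x : TorusExp} (h : HasLead v x) :
    HasLead ((shiftUnit u f hf ^ n : (Module.End ℂ (TorusExp →₀ ℂ))ˣ).val v) (x + n • u) := by
  induction n using Int.induction_on with
  | zero => simpa using h
  | succ n ih =>
    rw [add_comm, zpow_add, zpow_one, add_smul, one_smul, add_comm u, ← add_assoc, Units.val_mul,
      Module.End.mul_apply]
    exact hasLead_shift hf ih
  | pred n ih =>
    rw [sub_eq_neg_add, zpow_add, zpow_neg_one, add_smul, neg_smul, one_smul, add_comm (-u),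
      ← add_assoc, Units.val_mul, Module.End.mul_apply, shiftUnit_inv_val]
    exact hasLead_shift (fun w => inv_ne_zero (hf _)) ih

theorem hasLead_add {v v' : TorusExp →₀ ℂ} {x x' : TorusExp} (h : HasLead v x)
    (h' : HasLead v' x') (hx : x'.2.2.1 < x.2.2.1) : HasLead (v + v') x := by
  have h0 : v' x = 0 := by
    by_contra h0
    rcases h'.2 x h0 with rfl | h1 <;> omega
  refine ⟨by rw [Finsupp.add_apply, h0, add_zero]; exact h.1, fun y hy => ?_⟩
  by_cases hy0 : v y = 0
  · rw [Finsupp.add_apply, hy0, zero_add] at hy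
    rcases h'.2 y hy with rfl | h1
    · exact .inr hx
    · exact .inr (h1.trans hx)
  · exact h.2 y hy0

/-- Vectors with pairwise different leading exponents are linearly independent. -/
theorem linearIndependent_of_hasLead {ι : Type*} (v : ι → TorusExp →₀ ℂ) (x : ι → TorusExp)
    (hx : Function.Injective x) (h : ∀ i, HasLead (v i) (x i)) : LinearIndependent ℂ v := by
  classical
  rw [linearIndependent_iff']
  intro s g hg i hi
  by_contra hgi
  obtain ⟨m, hm, hmax⟩ := (s.filter (g · ≠ 0)).exists_max_image (fun i => (x i).2.2.1)
    ⟨i, by simp [hi, hgi]⟩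
  rw [Finset.mem_filter] at hm
  have h0 := DFunLike.congr_fun hg (x m)
  rw [Finsupp.finsetSum_apply, Finset.sum_eq_single m] at h0
  · exact mul_ne_zero hm.2 (h m).1 h0
  · intro j hj hjm
    rw [Finsupp.smul_apply, smul_eq_mul]
    by_contra hne
    rcases (h j).2 _ (right_ne_zero_of_mul hne) with h1 | h1
    · exact hjm (hx h1.symm)
    · have := hmax j (Finset.mem_filter.2 ⟨hj, left_ne_zero_of_mul hne⟩)
      omega
  · exact fun hn => absurd hm.1 hn

variable (q : ℂ) [NeZero q]

/-- The operator of `a`. -/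
noncomputable def opA : (Module.End ℂ (TorusExp →₀ ℂ))ˣ :=
  shiftUnit (1, 0, 0, 0) (fun _ => 1) fun _ => one_ne_zero
/-- The operator of the quantum determinant. -/
noncomputable def opD : (Module.End ℂ (TorusExp →₀ ℂ))ˣ :=
  shiftUnit (0, 1, 0, 0) (fun _ => 1) fun _ => one_ne_zero
/-- The operator of `b`. -/
noncomputable def opB : (Module.End ℂ (TorusExp →₀ ℂ))ˣ :=
  shiftUnit (0, 0, 1, 0) (fun w => q ^ (w.1 + 2 * w.2.1)) fun _ => zpow_ne_zero _ (NeZero.ne q)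
/-- The operator of `c`. -/
noncomputable def opC : (Module.End ℂ (TorusExp →₀ ℂ))ˣ :=
  shiftUnit (0, 0, 0, 1) (fun w => q ^ (-w.1 - 2 * w.2.1 - 2 * w.2.2.1))
    fun _ => zpow_ne_zero _ (NeZero.ne q)

/-- The operators of the generators. -/
noncomputable def opFun : GLGen → Module.End ℂ (TorusExp →₀ ℂ)
  | .a => opA
  | .b => opB q
  | .c => opC q
  | .d => ↑opA⁻¹ * (opD + q⁻¹ • (opB q * opC q))
  | .Dinv => ↑opD⁻¹

theorem opA_single (w : TorusExp) (s : ℂ) :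
    (opA : Module.End ℂ (TorusExp →₀ ℂ)) (Finsupp.single w s) =
      Finsupp.single (w.1 + 1, w.2.1, w.2.2.1, w.2.2.2) s := by
  have := shift_single (1, 0, 0, 0) (fun _ => 1) w s
  rw [one_mul] at this
  refine this.trans (congrArg (Finsupp.single · s) ?_)
  ext <;> simp

theorem opA_inv_single (w : TorusExp) (s : ℂ) :
    (↑opA⁻¹ : Module.End ℂ (TorusExp →₀ ℂ)) (Finsupp.single w s) =
      Finsupp.single (w.1 - 1, w.2.1, w.2.2.1, w.2.2.2) s := by
  rw [opA, shiftUnit_inv_val, shift_single, inv_one, one_mul]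
  congr 1
  ext <;> simp [sub_eq_add_neg]

theorem opD_single (w : TorusExp) (s : ℂ) :
    (opD : Module.End ℂ (TorusExp →₀ ℂ)) (Finsupp.single w s) =
      Finsupp.single (w.1, w.2.1 + 1, w.2.2.1, w.2.2.2) s := by
  have := shift_single (0, 1, 0, 0) (fun _ => 1) w s
  rw [one_mul] at this
  refine this.trans (congrArg (Finsupp.single · s) ?_)
  ext <;> simp

theorem opB_single (w : TorusExp) (s : ℂ) :
    (opB q : Module.End ℂ (TorusExp →₀ ℂ)) (Finsupp.single w s) =
      Finsupp.single (w.1, w.2.1, w.2.2.1 + 1, w.2.2.2) (q ^ (w.1 + 2 * w.2.1) * s) := by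
  refine (shift_single _ _ w s).trans (congrArg (Finsupp.single · _) ?_)
  ext <;> simp

theorem opC_single (w : TorusExp) (s : ℂ) :
    (opC q : Module.End ℂ (TorusExp →₀ ℂ)) (Finsupp.single w s) =
      Finsupp.single (w.1, w.2.1, w.2.2.1, w.2.2.2 + 1)
        (q ^ (-w.1 - 2 * w.2.1 - 2 * w.2.2.1) * s) := by
  refine (shift_single _ _ w s).trans (congrArg (Finsupp.single · _) ?_)
  ext <;> simp

theorem opFun_rel {x y : FreeAlgebra ℂ GLGen} (h : GLRel q x y) :
    FreeAlgebra.lift ℂ (opFun q) x = FreeAlgebra.lift ℂ (opFun q) y := by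
  have hq : q ≠ 0 := NeZero.ne q
  have hdet : opFun q .a * opFun q .d - q⁻¹ • (opFun q .b * opFun q .c) = opD := by
    simp only [opFun, Units.mul_inv_cancel_left]
    exact add_sub_cancel_right (opD : Module.End ℂ (TorusExp →₀ ℂ)) _
  cases h
  case det_inv =>
    simp only [map_mul, map_smul, map_sub, map_one, FreeAlgebra.lift_ι_apply, hdet]
    exact opD.mul_inv
  case inv_det =>
    simp only [map_mul, map_smul, map_sub, map_one, FreeAlgebra.lift_ι_apply, hdet]
    exact opD.inv_mul
  all_goals
    simp only [map_mul, map_smul, FreeAlgebra.lift_ι_apply]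
    refine Finsupp.lhom_ext fun w s => ?_
    simp only [opFun, Module.End.mul_apply, LinearMap.smul_apply, LinearMap.add_apply, map_add,
      opA_single, opA_inv_single, opB_single, opC_single, opD_single, smul_add,
      Finsupp.smul_single, smul_eq_mul, ← mul_assoc, ← zpow_neg_one q, ← zpow_natCast q,
      ← zpow_add₀ hq, ← zpow_one_add₀ hq, sub_add_cancel, add_sub_cancel_right]
    try congr 2
  all_goals (push_cast; ring_nf)

theorem hasLead_d {v : TorusExp →₀ ℂ} {x : TorusExp} (h : HasLead v x) :
    HasLead (opFun q .d v) (x + (-1, 0, 1, 1)) := by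
  have hC := hasLead_shift (u := (0, 0, 0, 1))
    (f := fun w => q ^ (-w.1 - 2 * w.2.1 - 2 * w.2.2.1)) (fun _ => zpow_ne_zero _ (NeZero.ne q)) h
  have hB := hasLead_shift (u := (0, 0, 1, 0)) (f := fun w => q ^ (w.1 + 2 * w.2.1))
    (fun _ => zpow_ne_zero _ (NeZero.ne q)) hC
  have hB' := hasLead_shift (u := 0) (f := fun _ => q⁻¹) (fun _ => inv_ne_zero (NeZero.ne q)) hB
  have hD := hasLead_shift (u := (0, 1, 0, 0)) (f := fun _ => 1) (fun _ => one_ne_zero) h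
  have hs : ∀ w : TorusExp →₀ ℂ, shift 0 (fun _ => q⁻¹) w = q⁻¹ • w := fun w => by
    ext y; rw [shift_apply, sub_zero, Finsupp.smul_apply, smul_eq_mul]
  rw [hs] at hB'
  have := hasLead_shift (u := -(1, 0, 0, 0)) (f := fun _ => 1⁻¹) (by simp)
    (hasLead_add hB' hD (by simp))
  have hx : x + (0, 0, 0, 1) + (0, 0, 1, 0) + 0 + -(1, 0, 0, 0) = x + (-1, 0, 1, 1) := by
    ext <;> simp
  rw [hx, add_comm] at this
  exact this

/-- The representation of `A` by the operators. -/
noncomputable def rep : OGL q →ₐ[ℂ] Module.End ℂ (TorusExp →₀ ℂ) :=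
  OGL.lift (opFun q) fun _ _ h => opFun_rel q h

theorem rep_gen (x : GLGen) : rep q (OGL.gen q x) = opFun q x := OGL.lift_gen _ _ x

/-- The representation of `A[a⁻¹]`. -/
noncomputable def rep1 : A1 q →ₐ[ℂ] Module.End ℂ (TorusExp →₀ ℂ) :=
  Loc.lift (S := Module.End ℂ (TorusExp →₀ ℂ)) (rep q) opA (rep_gen q .a).symm

theorem rep1_incl (x : OGL q) : rep1 q (Loc.incl _ x) = rep q x :=
  Loc.lift_incl (S := Module.End ℂ (TorusExp →₀ ℂ)) _ _ _ x

/-- The representation of `A[a⁻¹][c⁻¹]`. -/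
noncomputable def rep12 : A12 q →ₐ[ℂ] Module.End ℂ (TorusExp →₀ ℂ) :=
  Loc.lift (S := Module.End ℂ (TorusExp →₀ ℂ)) (rep1 q) (opC q) ((rep1_incl q _).trans (rep_gen q .c)).symm

theorem rep12_res1 (x : A1 q) : rep12 q (res1 q x) = rep1 q x :=
  Loc.lift_incl (S := Module.End ℂ (TorusExp →₀ ℂ)) _ _ _ x

theorem rep12_res2_incl (x : OGL q) : rep12 q (res2 q (Loc.incl _ x)) = rep q x := by
  rw [← AlgHom.comp_apply (res2 q), res2_incl, AlgHom.comp_apply, rep12_res1, rep1_incl]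

theorem rep_D : rep q (OGL.det q) = opD := by
  simp only [OGL.det, map_sub, map_mul, map_smul, rep_gen, opFun, Units.mul_inv_cancel_left]
  exact add_sub_cancel_right (opD : Module.End ℂ (TorusExp →₀ ℂ)) _

theorem units_map_zpow {R S : Type*} [Semiring R] [Semiring S] [Algebra ℂ R] [Algebra ℂ S]
    (f : R →ₐ[ℂ] S)
    {u : Rˣ} {v : Sˣ} (h : f u = v) (n : ℤ) : f ↑(u ^ n) = ↑(v ^ n) := by
  have : Units.map (f : R →* S) u = v := Units.ext h
  rw [← this, ← map_zpow]
  rfl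

end Torus

/-! ### Monomials in the function algebra and in its localizations -/

namespace Torus

/-- `T` translates leading exponents by `u`. -/
def Moves (T : Module.End ℂ (TorusExp →₀ ℂ)) (u : TorusExp) : Prop :=
  ∀ v x, HasLead v x → HasLead (T v) (x + u)

theorem Moves.mul {T T' : Module.End ℂ (TorusExp →₀ ℂ)} {u u' : TorusExp} (h : Moves T u)
    (h' : Moves T' u') : Moves (T * T') (u + u') := fun v x hv => by
  rw [add_comm u, ← add_assoc]
  exact h _ _ (h' _ _ hv)

theorem Moves.pow {T : Module.End ℂ (TorusExp →₀ ℂ)} {u : TorusExp} (h : Moves T u) (n : ℕ) :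
    Moves (T ^ n) ((n : ℤ) • u) := by
  induction n with
  | zero => intro v x hv; simpa using hv
  | succ n ih =>
    rw [pow_succ]
    push_cast
    rw [add_smul, one_smul]
    exact ih.mul h

theorem moves_shift (u : TorusExp) {f : TorusExp → ℂ} (hf : ∀ w, f w ≠ 0) (n : ℤ) :
    Moves (shiftUnit u f hf ^ n : (Module.End ℂ (TorusExp →₀ ℂ))ˣ).val (n • u) :=
  fun _ _ hv => hasLead_zpow hf n hv

theorem moves_d (q : ℂ) [NeZero q] : Moves (opFun q .d) (-1, 0, 1, 1) := fun _ _ hv => hasLead_d q hv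

/-- Evaluation at the first basis vector is injective on the span of elements that translate leading
exponents differently. -/
theorem linearIndependent_of_moves {R : Type*} [Ring R] [Algebra ℂ R]
    (ρ : R →ₐ[ℂ] Module.End ℂ (TorusExp →₀ ℂ)) {ι : Type*} (m : ι → R) (u : ι → TorusExp)
    (hu : Function.Injective u) (h : ∀ i, Moves (ρ (m i)) (u i)) :
    LinearIndependent ℂ fun i => ρ (m i) :=
  LinearIndependent.of_comp (LinearMap.applyₗ (Finsupp.single (0 : TorusExp) (1 : ℂ)))
    (linearIndependent_of_hasLead _ u hu fun i => by
      have := h i _ _ (hasLead_single 0)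
      rwa [zero_add] at this)

end Torus

namespace OGL
variable (q : ℂ) [NeZero q]

theorem qcomm_ba : QComm (gen q .b) (gen q .a) := ⟨_, NeZero.ne q, rba (NeZero.ne q)⟩
theorem qcomm_ca : QComm (gen q .c) (gen q .a) :=
  ⟨_, inv_ne_zero (NeZero.ne q), rca (NeZero.ne q)⟩
theorem qcomm_dc : QComm (gen q .d) (gen q .c) := ⟨_, NeZero.ne q, rdc (NeZero.ne q)⟩
theorem qcomm_db : QComm (gen q .d) (gen q .b) :=
  ⟨_, inv_ne_zero (NeZero.ne q), rdb (NeZero.ne q)⟩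
theorem qcomm_cb : QComm (gen q .c) (gen q .b) :=
  ⟨_, inv_ne_zero (pow_ne_zero 2 (NeZero.ne q)), rcb (NeZero.ne q)⟩
theorem qcomm_da : QComm (gen q .d) (gen q .a) := .of_commute rda

theorem qcomm_D (x : GLGen) : QComm (gen q x) (D q) := by
  have hq : q ≠ 0 := NeZero.ne q
  suffices h : QComm (gen q x) ↑(D q)⁻¹ by simpa using h.inv_right
  change QComm (gen q x) (gen q .Dinv)
  cases x
  · exact (QComm.of_commute (rDa hq)).symm
  · exact QComm.symm ⟨_, pow_ne_zero 2 hq, rDb hq⟩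
  · exact QComm.symm ⟨_, inv_ne_zero (pow_ne_zero 2 hq), rDc hq⟩
  · exact (QComm.of_commute (rDd hq)).symm
  · exact .refl _

theorem qcomm_a (x : GLGen) : QComm (gen q .a) (gen q x) := by
  cases x
  · exact .refl _
  · exact (qcomm_ba q).symm
  · exact (qcomm_ca q).symm
  · exact (qcomm_da q).symm
  · exact (qcomm_D q .a).inv_right

theorem qcomm_c (x : GLGen) : QComm (gen q .c) (gen q x) := by
  cases x
  · exact qcomm_ca q
  · exact qcomm_cb q
  · exact .refl _
  · exact (qcomm_dc q).symm
  · exact (qcomm_D q .c).inv_right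

theorem a_mul_d : gen q .a * gen q .d = D q + q⁻¹ • (gen q .b * gen q .c) := by
  change _ = det q + _
  rw [det, sub_add_cancel]

/-- The monomials `a ^ i b ^ j c ^ k D ^ p`, and, for negative `i`, `d ^ (-i) b ^ j c ^ k D ^ p`. -/
noncomputable def monomial (x : ℤ × ℤ × ℕ × ℕ) : OGL q :=
  gen q .a ^ x.1.toNat * gen q .d ^ (-x.1).toNat *
    (gen q .b ^ x.2.2.1 * (gen q .c ^ x.2.2.2 * ↑(D q ^ x.2.1)))

theorem span_monomial : Submodule.span ℂ (Set.range (monomial q)) = ⊤ := by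
  set M := Submodule.span ℂ (Set.range (monomial q)) with hM
  have mem (i p : ℤ) (j k : ℕ) : gen q .a ^ i.toNat * gen q .d ^ (-i).toNat *
      (gen q .b ^ j * (gen q .c ^ k * ↑(D q ^ p))) ∈ M :=
    Submodule.subset_span ⟨(i, p, j, k), rfl⟩
  have red (g : OGL q) (h : ∀ (i p : ℤ) (j k : ℕ), g * (gen q .a ^ i.toNat *
      gen q .d ^ (-i).toNat * (gen q .b ^ j * (gen q .c ^ k * ↑(D q ^ p)))) ∈ M) :
      ∀ x ∈ M, g * x ∈ M := by
    intro x hx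
    induction hx using Submodule.span_induction with
    | mem x hx => obtain ⟨⟨i, p, j, k⟩, rfl⟩ := hx; exact h i p j k
    | zero => rw [mul_zero]; exact M.zero_mem
    | add x y _ _ hx hy => rw [mul_add]; exact M.add_mem hx hy
    | smul c x _ hx => rw [mul_smul_comm]; exact M.smul_mem c hx
  have hb : ∀ x ∈ M, gen q .b * x ∈ M := by
    refine red _ fun i p j k => ?_
    obtain ⟨s, -, hs⟩ := ((qcomm_ba q).pow_right i.toNat).mul_right
      ((qcomm_db q).symm.pow_right (-i).toNat)
    rw [← mul_assoc, hs, smul_mul_assoc, mul_assoc, ← mul_assoc (gen q .b), ← pow_succ']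
    exact M.smul_mem _ (mem _ _ _ _)
  have hc : ∀ x ∈ M, gen q .c * x ∈ M := by
    refine red _ fun i p j k => ?_
    obtain ⟨s, -, hs⟩ := ((qcomm_ca q).pow_right i.toNat).mul_right
      ((qcomm_dc q).symm.pow_right (-i).toNat)
    obtain ⟨s', -, hs'⟩ := (qcomm_cb q).pow_right j
    rw [← mul_assoc, hs, smul_mul_assoc, mul_assoc, ← mul_assoc (gen q .c), hs', smul_mul_assoc,
      mul_smul_comm, mul_assoc _ (gen q .c), ← mul_assoc (gen q .c), ← pow_succ']
    exact M.smul_mem _ (M.smul_mem _ (mem _ _ _ _))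
  have hD (e : ℤ) : ∀ x ∈ M, ↑(D q ^ e) * x ∈ M := by
    refine red _ fun i p j k => ?_
    obtain ⟨s, -, hs⟩ := ((((qcomm_D q .a).zpow_right e).symm.pow_right i.toNat).mul_right
      (((qcomm_D q .d).zpow_right e).symm.pow_right (-i).toNat)).mul_right
      ((((qcomm_D q .b).zpow_right e).symm.pow_right j).mul_right
        (((qcomm_D q .c).zpow_right e).symm.pow_right k))
    rw [← mul_assoc (gen q .b ^ j), ← mul_assoc (_ * _) (_ * _), ← mul_assoc, hs, smul_mul_assoc,
      mul_assoc (_ * _ * _), ← Units.val_mul, ← zpow_add, mul_assoc (_ * _), mul_assoc (gen q .b ^ j)]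
    exact M.smul_mem _ (mem _ _ _ _)
  have hz : ∀ x ∈ M, (D q + q⁻¹ • (gen q .b * gen q .c)) * x ∈ M := fun x hx => by
    rw [add_mul, smul_mul_assoc, mul_assoc]
    refine M.add_mem ?_ (M.smul_mem _ (hb _ (hc _ hx)))
    simpa using hD 1 x hx
  refine Submodule.eq_top_of_adjoin adjoin_gen M (by simpa using mem 0 0 0 0) ?_
  rintro _ ⟨g, rfl⟩
  cases g
  · refine red _ fun i p j k => ?_
    rcases le_or_gt 0 i with hi | hi
    · have := mem (i + 1) p j k
      rw [show (i + 1).toNat = i.toNat + 1 by omega, show (-(i + 1)).toNat = (-i).toNat by omega]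
        at this
      simpa only [mul_assoc, pow_succ'] using this
    · have := hz _ (mem (i + 1) p j k)
      rw [show (i + 1).toNat = 0 by omega, pow_zero, one_mul] at this
      rw [show i.toNat = 0 by omega, show (-i).toNat = (-(i + 1)).toNat + 1 by omega, pow_zero,
        one_mul, pow_succ']
      simpa only [← a_mul_d, mul_assoc] using this
  · exact hb
  · exact hc
  · refine red _ fun i p j k => ?_
    rcases le_or_gt i 0 with hi | hi
    · have := mem (i - 1) p j k
      rw [show (i - 1).toNat = 0 by omega, show (-(i - 1)).toNat = (-i).toNat + 1 by omega,
        pow_zero, one_mul, pow_succ'] at this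
      rwa [show i.toNat = 0 by omega, pow_zero, one_mul, ← mul_assoc]
    · have := hz _ (mem (i - 1) p j k)
      rw [show (-(i - 1)).toNat = 0 by omega, pow_zero, mul_one] at this
      rw [show i.toNat = (i - 1).toNat + 1 by omega, show (-i).toNat = 0 by omega, pow_zero,
        mul_one, pow_succ']
      simpa only [← a_mul_d, ← rda, mul_assoc] using this
  · have := hD (-1)
    rwa [zpow_neg_one] at this

open Torus in
theorem linearIndependent_rep_monomial : LinearIndependent ℂ fun i => rep q (monomial q i) := by
  refine linearIndependent_of_moves (rep q) (monomial q)
    (fun x => (x.1.toNat : ℤ) • (1, 0, 0, 0) + ((-x.1).toNat : ℤ) • (-1, 0, 1, 1) +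
      ((x.2.2.1 : ℤ) • (0, 0, 1, 0) + ((x.2.2.2 : ℤ) • (0, 0, 0, 1) + x.2.1 • (0, 1, 0, 0)))) ?_ ?_
  · rintro ⟨i, p, j, k⟩ ⟨i', p', j', k'⟩ h
    simp only [Prod.smul_mk, smul_eq_mul, Prod.mk_add_mk, Prod.mk.injEq] at h ⊢
    omega
  · rintro ⟨i, p, j, k⟩
    simp only [monomial, map_mul, map_pow, rep_gen, units_map_zpow (rep q) (u := D q) (rep_D q)]
    have hA := moves_shift (1, 0, 0, 0) (f := fun _ => 1) (fun _ => one_ne_zero)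
    have hD := moves_shift (0, 1, 0, 0) (f := fun _ => 1) (fun _ => one_ne_zero)
    have hB := moves_shift (0, 0, 1, 0) (f := fun w => q ^ (w.1 + 2 * w.2.1))
      (fun _ => zpow_ne_zero _ (NeZero.ne q))
    have hC := moves_shift (0, 0, 0, 1) (f := fun w => q ^ (-w.1 - 2 * w.2.1 - 2 * w.2.2.1))
      (fun _ => zpow_ne_zero _ (NeZero.ne q))
    have hA1 := hA 1
    have hB1 := hB 1
    have hC1 := hC 1
    rw [one_smul, zpow_one] at hA1 hB1 hC1
    exact ((hA1.pow _).mul ((moves_d q).pow _)).mul ((hB1.pow _).mul ((hC1.pow _).mul (hD _)))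

theorem rep_injective : Function.Injective (Torus.rep q) := by
  have h := linearIndependent_rep_monomial q
  have h' : LinearIndependent ℂ ((Torus.rep q).toLinearMap ∘ monomial q) := h
  have hdis := Submodule.range_ker_disjoint h'
  rw [span_monomial, disjoint_iff, top_inf_eq] at hdis
  refine (injective_iff_map_eq_zero _).2 fun x hx => ?_
  have : x ∈ LinearMap.ker (Torus.rep q).toLinearMap := hx
  rwa [hdis] at this

end OGL

/-! ### Monomials in the two charts -/

section ChartMonomials

variable (q : ℂ)

namespace A1

/-- The coordinate `c a⁻¹` of the first chart. -/
noncomputable def z : A1 q := c q * ↑(a q)⁻¹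

/-- The monomials `z ^ k D ^ p a ^ m b ^ r`. -/
noncomputable def monomial (i : (ℤ × ℤ × ℕ) × ℕ) : A1 q :=
  z q ^ i.2 * (↑(D q ^ i.1.1 * a q ^ i.1.2.1) * b q ^ i.1.2.2)

variable [NeZero q]

theorem qcomm_Da : QComm (D q : A1 q) (a q) := ((OGL.qcomm_D q .a).map (Loc.incl _)).symm
theorem qcomm_Db : QComm (D q : A1 q) (b q) := ((OGL.qcomm_D q .b).map (Loc.incl _)).symm
theorem qcomm_Dc : QComm (D q : A1 q) (c q) := ((OGL.qcomm_D q .c).map (Loc.incl _)).symm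
theorem qcomm_ba : QComm (b q) (a q) := (OGL.qcomm_ba q).map (Loc.incl _)
theorem qcomm_ca : QComm (c q) (a q) := (OGL.qcomm_ca q).map (Loc.incl _)
theorem qcomm_cb : QComm (c q) (b q) := (OGL.qcomm_cb q).map (Loc.incl _)

theorem qcomm_Dz : QComm (D q : A1 q) (z q) := (qcomm_Dc q).mul_right (qcomm_Da q).inv_right
theorem qcomm_az : QComm (a q : A1 q) (z q) :=
  (qcomm_ca q).symm.mul_right (QComm.refl _).inv_right
theorem qcomm_bz : QComm (b q) (z q) := (qcomm_cb q).symm.mul_right (qcomm_ba q).inv_right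

theorem incl_d : Loc.incl _ (OGL.gen q .d) = (↑(a q)⁻¹ * (D q + q⁻¹ • (b q * c q)) : A1 q) := by
  rw [Units.eq_inv_mul_iff_mul_eq]
  have := congrArg (Loc.incl (OGL.gen q .a)) (OGL.a_mul_d q)
  simp only [map_mul, map_add, map_smul] at this
  exact this

theorem adjoin_eq_top :
    Algebra.adjoin ℂ {z q, b q, (D q : A1 q), ↑(D q)⁻¹, (a q : A1 q), ↑(a q)⁻¹} = ⊤ := by
  rw [eq_top_iff, ← Loc.adjoin_eq_top (OGL.gen q .a) OGL.adjoin_gen]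
  set S := Algebra.adjoin ℂ {z q, b q, (D q : A1 q), ↑(D q)⁻¹, (a q : A1 q), ↑(a q)⁻¹} with hS
  have hz : z q ∈ S := Algebra.subset_adjoin (by simp)
  have hb : b q ∈ S := Algebra.subset_adjoin (by simp)
  have hD : ↑(D q) ∈ S := Algebra.subset_adjoin (by simp)
  have hD' : ↑(D q)⁻¹ ∈ S := Algebra.subset_adjoin (by simp)
  have ha : ↑(a q) ∈ S := Algebra.subset_adjoin (by simp)
  have ha' : ↑(a q)⁻¹ ∈ S := Algebra.subset_adjoin (by simp)
  have hc : c q ∈ S := by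
    have := S.mul_mem hz ha
    rwa [z, Units.inv_mul_cancel_right] at this
  refine Algebra.adjoin_le (Set.insert_subset ha' ?_)
  rintro _ ⟨_, ⟨x, rfl⟩, rfl⟩
  cases x
  · exact ha
  · exact hb
  · exact hc
  · change Loc.incl _ _ ∈ S
    rw [incl_d]
    exact S.mul_mem ha' (S.add_mem hD (S.smul_mem (S.mul_mem hb hc) _))
  · exact hD'

theorem span_monomial : Submodule.span ℂ (Set.range (monomial q)) = ⊤ :=
  span_monomials_eq_top (adjoin_eq_top q) (qcomm_Dz q) (qcomm_az q) (qcomm_Da q).symm (qcomm_bz q)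
    (qcomm_Db q).symm (qcomm_ba q)

open Torus in
theorem linearIndependent_monomial : LinearIndependent ℂ (monomial q) := by
  refine LinearIndependent.of_comp (rep1 q).toLinearMap ?_
  refine linearIndependent_of_moves (rep1 q) (monomial q)
    (fun x => (x.2 : ℤ) • ((0, 0, 0, 1) + (-1 : ℤ) • (1, 0, 0, 0)) +
      (x.1.1 • (0, 1, 0, 0) + x.1.2.1 • (1, 0, 0, 0) + (x.1.2.2 : ℤ) • (0, 0, 1, 0))) ?_ ?_
  · rintro ⟨⟨p, m, r⟩, k⟩ ⟨⟨p', m', r'⟩, k'⟩ h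
    simp only [Prod.smul_mk, smul_eq_mul, Prod.mk_add_mk, Prod.mk.injEq] at h ⊢
    omega
  · rintro ⟨⟨p, m, r⟩, k⟩
    have hA := moves_shift (1, 0, 0, 0) (f := fun _ => 1) (fun _ => one_ne_zero)
    have hD := moves_shift (0, 1, 0, 0) (f := fun _ => 1) (fun _ => one_ne_zero)
    have hB := moves_shift (0, 0, 1, 0) (f := fun w => q ^ (w.1 + 2 * w.2.1))
      (fun _ => zpow_ne_zero _ (NeZero.ne q)) 1
    have hC := moves_shift (0, 0, 0, 1) (f := fun w => q ^ (-w.1 - 2 * w.2.1 - 2 * w.2.2.1))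
      (fun _ => zpow_ne_zero _ (NeZero.ne q)) 1
    rw [one_smul, zpow_one] at hB hC
    have ea : rep1 q (a q) = opA := (rep1_incl q _).trans (rep_gen q .a)
    have eD : rep1 q (D q) = opD := (rep1_incl q _).trans (rep_D q)
    have eb : rep1 q (b q) = opB q := (rep1_incl q _).trans (rep_gen q .b)
    have ec : rep1 q (c q) = opC q := (rep1_incl q _).trans (rep_gen q .c)
    have ea' := units_map_zpow (rep1 q) ea (-1)
    rw [zpow_neg_one] at ea'
    simp only [monomial, z, map_mul, map_pow, Units.val_mul, units_map_zpow (rep1 q) ea, ea',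
      units_map_zpow (rep1 q) eD, eb, ec]
    exact ((hC.mul (hA _)).pow _).mul (((hD _).mul (hA _)).mul (hB.pow _))

end A1

namespace A2

/-- The coordinate `a c⁻¹` of the second chart. -/
noncomputable def z : A2 q := a q * ↑(c q)⁻¹

/-- The monomials `z ^ k D ^ p c ^ m d ^ r`. -/
noncomputable def monomial (i : (ℤ × ℤ × ℕ) × ℕ) : A2 q :=
  z q ^ i.2 * (↑(D q ^ i.1.1 * c q ^ i.1.2.1) * d q ^ i.1.2.2)

variable [NeZero q]

theorem qcomm_Da : QComm (D q : A2 q) (a q) := ((OGL.qcomm_D q .a).map (Loc.incl _)).symm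
theorem qcomm_Dc : QComm (D q : A2 q) (c q) := ((OGL.qcomm_D q .c).map (Loc.incl _)).symm
theorem qcomm_Dd : QComm (D q : A2 q) (d q) := ((OGL.qcomm_D q .d).map (Loc.incl _)).symm
theorem qcomm_ca : QComm (c q : A2 q) (a q) := (OGL.qcomm_ca q).map (Loc.incl _)
theorem qcomm_da : QComm (d q) (a q) := (OGL.qcomm_da q).map (Loc.incl _)
theorem qcomm_dc : QComm (d q) (c q) := (OGL.qcomm_dc q).map (Loc.incl _)

theorem qcomm_Dz : QComm (D q : A2 q) (z q) := (qcomm_Da q).mul_right (qcomm_Dc q).inv_right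
theorem qcomm_cz : QComm (c q : A2 q) (z q) := (qcomm_ca q).mul_right (QComm.refl _).inv_right
theorem qcomm_dz : QComm (d q) (z q) := (qcomm_da q).mul_right (qcomm_dc q).inv_right

theorem incl_b : Loc.incl _ (OGL.gen q .b) = (q • ((a q * d q - D q) * ↑(c q)⁻¹) : A2 q) := by
  rw [← smul_mul_assoc, Units.eq_mul_inv_iff_mul_eq]
  have h : OGL.gen q .b * OGL.gen q .c = q • (OGL.gen q .a * OGL.gen q .d - OGL.D q) := by
    rw [OGL.a_mul_d, add_sub_cancel_left, smul_smul, mul_inv_cancel₀ (NeZero.ne q), one_smul]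
  have := congrArg (Loc.incl (OGL.gen q .c)) h
  simp only [map_mul, map_sub, map_smul] at this
  exact this

theorem adjoin_eq_top :
    Algebra.adjoin ℂ {z q, d q, (D q : A2 q), ↑(D q)⁻¹, (c q : A2 q), ↑(c q)⁻¹} = ⊤ := by
  rw [eq_top_iff, ← Loc.adjoin_eq_top (OGL.gen q .c) OGL.adjoin_gen]
  set S := Algebra.adjoin ℂ {z q, d q, (D q : A2 q), ↑(D q)⁻¹, (c q : A2 q), ↑(c q)⁻¹} with hS
  have hz : z q ∈ S := Algebra.subset_adjoin (by simp)
  have hd : d q ∈ S := Algebra.subset_adjoin (by simp)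
  have hD : ↑(D q) ∈ S := Algebra.subset_adjoin (by simp)
  have hD' : ↑(D q)⁻¹ ∈ S := Algebra.subset_adjoin (by simp)
  have hc : ↑(c q) ∈ S := Algebra.subset_adjoin (by simp)
  have hc' : ↑(c q)⁻¹ ∈ S := Algebra.subset_adjoin (by simp)
  have ha : a q ∈ S := by
    have := S.mul_mem hz hc
    rwa [z, Units.inv_mul_cancel_right] at this
  refine Algebra.adjoin_le (Set.insert_subset hc' ?_)
  rintro _ ⟨_, ⟨x, rfl⟩, rfl⟩
  cases x
  · exact ha
  · change Loc.incl _ _ ∈ S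
    rw [incl_b]
    exact S.smul_mem (S.mul_mem (S.sub_mem (S.mul_mem ha hd) hD) hc') _
  · exact hc
  · exact hd
  · exact hD'

theorem span_monomial : Submodule.span ℂ (Set.range (monomial q)) = ⊤ :=
  span_monomials_eq_top (adjoin_eq_top q) (qcomm_Dz q) (qcomm_cz q) (qcomm_Dc q).symm (qcomm_dz q)
    (qcomm_Dd q).symm (qcomm_dc q)

open Torus in
theorem linearIndependent_monomial : LinearIndependent ℂ (monomial q) := by
  set ρ := (rep12 q).comp (res2 q) with hρ
  have hincl (x : OGL q) : ρ (Loc.incl _ x) = rep q x := rep12_res2_incl q x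
  refine LinearIndependent.of_comp ρ.toLinearMap ?_
  refine linearIndependent_of_moves ρ (monomial q)
    (fun x => (x.2 : ℤ) • ((1, 0, 0, 0) + (-1 : ℤ) • (0, 0, 0, 1)) +
      (x.1.1 • (0, 1, 0, 0) + x.1.2.1 • (0, 0, 0, 1) + (x.1.2.2 : ℤ) • (-1, 0, 1, 1))) ?_ ?_
  · rintro ⟨⟨p, m, r⟩, k⟩ ⟨⟨p', m', r'⟩, k'⟩ h
    simp only [Prod.smul_mk, smul_eq_mul, Prod.mk_add_mk, Prod.mk.injEq] at h ⊢
    omega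
  · rintro ⟨⟨p, m, r⟩, k⟩
    have hA := moves_shift (1, 0, 0, 0) (f := fun _ => 1) (fun _ => one_ne_zero) 1
    have hD := moves_shift (0, 1, 0, 0) (f := fun _ => 1) (fun _ => one_ne_zero)
    have hC := moves_shift (0, 0, 0, 1) (f := fun w => q ^ (-w.1 - 2 * w.2.1 - 2 * w.2.2.1))
      (fun _ => zpow_ne_zero _ (NeZero.ne q))
    rw [one_smul, zpow_one] at hA
    have ea : ρ (a q) = opA := (hincl _).trans (rep_gen q .a)
    have eD : ρ (D q) = opD := (hincl _).trans (rep_D q)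
    have ed : ρ (d q) = opFun q .d := (hincl _).trans (rep_gen q .d)
    have ec : ρ (c q) = opC q := (hincl _).trans (rep_gen q .c)
    have ec' := units_map_zpow ρ ec (-1)
    rw [zpow_neg_one] at ec'
    simp only [monomial, z, map_mul, map_pow, Units.val_mul, units_map_zpow ρ ec, ec',
      units_map_zpow ρ eD, ea, ed]
    exact ((hA.mul (hC _)).pow _).mul (((hD _).mul (hC _)).mul ((moves_d q).pow _))

end A2

/-! ### Gluing the two localizations -/

section Gluing
variable [NeZero q]

/-- The map `A → A[a⁻¹][c⁻¹]`. -/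
noncomputable def incl12 : OGL q →ₐ[ℂ] A12 q := (res1 q).comp (Loc.incl (OGL.gen q .a))

theorem incl12_injective : Function.Injective (incl12 q) := by
  refine Function.Injective.of_comp (f := Torus.rep12 q) ?_
  convert OGL.rep_injective q using 1
  funext x
  exact (Torus.rep12_res1 q _).trans (Torus.rep1_incl q x)

theorem incl1_injective : Function.Injective (Loc.incl (OGL.gen q .a)) :=
  Function.Injective.of_comp (f := res1 q) (incl12_injective q)

theorem res2_incl_apply (x : OGL q) : res2 q (Loc.incl _ x) = incl12 q x :=
  DFunLike.congr_fun (res2_incl q) x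

theorem exists_incl1 (x : A1 q) :
    ∃ (n : ℕ) (y : OGL q), Loc.incl _ (OGL.gen q .a) ^ n * x = Loc.incl _ y :=
  Loc.exists_pow_mul_eq _ OGL.adjoin_gen (by rintro _ ⟨x, rfl⟩; exact OGL.qcomm_a q x) x

theorem exists_incl2 (x : A2 q) :
    ∃ (n : ℕ) (y : OGL q), Loc.incl _ (OGL.gen q .c) ^ n * x = Loc.incl _ y :=
  Loc.exists_pow_mul_eq _ OGL.adjoin_gen (by rintro _ ⟨x, rfl⟩; exact OGL.qcomm_c q x) x

theorem isUnit_incl1 : IsUnit (Loc.incl (OGL.gen q .a) (OGL.gen q .a)) := (A1.a q).isUnit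
theorem isUnit_incl2 : IsUnit (Loc.incl (OGL.gen q .c) (OGL.gen q .c)) := (A2.c q).isUnit

theorem res2_injective : Function.Injective (res2 q) := by
  refine (injective_iff_map_eq_zero _).2 fun x hx => ?_
  obtain ⟨n, y, h⟩ := exists_incl2 q x
  have h0 : incl12 q y = 0 := by rw [← res2_incl_apply, ← h, map_mul, hx, mul_zero]
  rw [(injective_iff_map_eq_zero _).1 (incl12_injective q) y h0, map_zero] at h
  exact ((isUnit_incl2 q).pow n).mul_right_eq_zero.1 h

theorem a_mul_left_cancel {x y : OGL q} (h : OGL.gen q .a * x = OGL.gen q .a * y) : x = y := by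
  refine incl1_injective q ((isUnit_incl1 q).mul_left_cancel ?_)
  rw [← map_mul, h, map_mul]

theorem exists_a_mul_of_c_mul {x y : OGL q} (h : OGL.gen q .c * x = OGL.gen q .a * y) :
    ∃ w, x = OGL.gen q .a * w := by
  have ha := OGL.rDa (q := q) (NeZero.ne q)
  have hD : OGL.det q * x = OGL.gen q .a * (OGL.gen q .d * x - OGL.gen q .b * y) := by
    rw [OGL.det, sub_mul, mul_assoc, smul_mul_assoc, mul_assoc, h, ← mul_assoc (OGL.gen q .b),
      OGL.rba (NeZero.ne q), smul_mul_assoc, smul_smul, inv_mul_cancel₀ (NeZero.ne q), one_smul,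
      mul_sub, mul_assoc]
  refine ⟨OGL.gen q .Dinv * (OGL.gen q .d * x - OGL.gen q .b * y), ?_⟩
  rw [← mul_assoc, ← ha, mul_assoc, ← hD, ← mul_assoc, OGL.inv_det, one_mul]

theorem exists_a_mul_of_c_pow_mul {n : ℕ} {x y : OGL q}
    (h : OGL.gen q .c ^ n * x = OGL.gen q .a * y) : ∃ w, x = OGL.gen q .a * w := by
  induction n generalizing x with
  | zero => exact ⟨y, by simpa using h⟩
  | succ n ih =>
    rw [pow_succ, mul_assoc] at h
    obtain ⟨w, hw⟩ := ih h
    exact exists_a_mul_of_c_mul q hw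

theorem exists_a_pow_mul_of_c_pow_mul {m n : ℕ} {x y : OGL q}
    (h : OGL.gen q .c ^ n * x = OGL.gen q .a ^ m * y) : ∃ w, x = OGL.gen q .a ^ m * w := by
  induction m generalizing x y with
  | zero => exact ⟨x, by simp⟩
  | succ m ih =>
    rw [pow_succ', mul_assoc] at h
    obtain ⟨w, rfl⟩ := exists_a_mul_of_c_pow_mul q h
    obtain ⟨s, hs, hs'⟩ := (OGL.qcomm_a q .c).pow_right n
    have h' : OGL.gen q .c ^ n * w = OGL.gen q .a ^ m * (s • y) := by
      refine a_mul_left_cancel q ?_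
      rw [← mul_assoc, hs', smul_mul_assoc, mul_assoc, h, mul_smul_comm, mul_smul_comm]
    obtain ⟨w', rfl⟩ := ih h'
    exact ⟨w', by rw [pow_succ', mul_assoc]⟩

/-- `A` is the fibre product of `A[a⁻¹]` and `A[c⁻¹]` over `A[a⁻¹][c⁻¹]`. -/
theorem exists_glue {x : A1 q} {y : A2 q} (h : res1 q x = res2 q y) :
    ∃ w : OGL q, Loc.incl _ w = x ∧ Loc.incl _ w = y := by
  obtain ⟨m, x', hx⟩ := exists_incl1 q x
  obtain ⟨n, y', hy⟩ := exists_incl2 q y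
  obtain ⟨s, hs, hs'⟩ := ((OGL.qcomm_a q .c).pow_right n).symm.pow_right m
  have key : OGL.gen q .c ^ n * x' = OGL.gen q .a ^ m * (s • y') := by
    refine incl12_injective q ?_
    have hx' : incl12 q x' = incl12 q (OGL.gen q .a) ^ m * res1 q x := by
      rw [incl12, AlgHom.comp_apply, AlgHom.comp_apply, ← hx, map_mul, map_pow]
    have hy' : incl12 q y' = incl12 q (OGL.gen q .c) ^ n * res2 q y := by
      rw [← res2_incl_apply, ← hy, map_mul, map_pow, res2_incl_apply]
    rw [map_mul, map_mul, map_pow, map_pow, map_smul, hx', hy', h, ← mul_assoc, mul_smul_comm,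
      ← mul_assoc, ← smul_mul_assoc, ← map_pow, ← map_pow, ← map_mul, ← map_mul, ← map_smul, hs']
  obtain ⟨w, rfl⟩ := exists_a_pow_mul_of_c_pow_mul q key
  have hw : Loc.incl _ w = x := by
    refine ((isUnit_incl1 q).pow m).mul_left_cancel ?_
    rw [hx, map_mul, map_pow]
  refine ⟨w, hw, res2_injective q ?_⟩
  rw [res2_incl_apply, ← h, ← hw]
  rfl

end Gluing

end ChartMonomials

/-! ### Free modules are faithfully flat -/

section FaithfullyFlat
variable {R M ι : Type} [Ring R] [AddCommGroup M] [Module R M] (b : Module.Basis ι R M)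
  (N : Type) [AddCommGroup N] [Module Rᵐᵒᵖ N]

theorem BalancedTensor.mk_smul {R N M : Type} [Ring R] [AddCommGroup M] [Module R M]
    [AddCommGroup N] [Module Rᵐᵒᵖ N] (n : N) (r : R) (m : M) :
    (QuotientAddGroup.mk ((MulOpposite.op r • n) ⊗ₜ[ℤ] m) : BalancedTensor R N M) =
      QuotientAddGroup.mk (n ⊗ₜ[ℤ] (r • m)) := by
  rw [← sub_eq_zero, ← QuotientAddGroup.mk_sub, QuotientAddGroup.eq_zero_iff]
  exact AddSubgroup.subset_closure ⟨n, r, m, rfl⟩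

/-- The coordinates of an element of `N ⊗ M` with respect to a basis of `M`. -/
noncomputable def coordAux : N ⊗[ℤ] M →+ (ι →₀ N) :=
  TensorProduct.liftAddHom
    (AddMonoidHom.mk' (fun n => AddMonoidHom.mk' (fun m =>
        (b.repr m).mapRange (fun r => MulOpposite.op r • n) (by simp))
      fun m m' => by ext i; simp [add_smul])
    fun n n' => by ext m i; simp)
    fun r n m => by
      rw [map_zsmul, map_zsmul]; rfl

theorem coordAux_tmul (n : N) (m : M) (i : ι) :
    coordAux b N (n ⊗ₜ m) i = MulOpposite.op (b.repr m i) • n := rfl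

/-- The coordinates of an element of `N ⊗_R M` with respect to a basis of `M`. -/
noncomputable def coordBalanced : BalancedTensor R N M →+ (ι →₀ N) :=
  QuotientAddGroup.lift _ (coordAux b N) <| by
    refine (AddSubgroup.closure_le _).2 ?_
    rintro _ ⟨n, r, m, rfl⟩
    change coordAux b N _ = 0
    ext i
    simp [coordAux_tmul, smul_smul]

/-- The element of `N ⊗_R M` with given coordinates. -/
noncomputable def ofCoord : (ι →₀ N) →+ BalancedTensor R N M :=
  Finsupp.liftAddHom fun i => AddMonoidHom.mk' (fun n => QuotientAddGroup.mk (n ⊗ₜ[ℤ] b i))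
    fun n n' => by rw [add_tmul, QuotientAddGroup.mk_add]

theorem ofCoord_coordBalanced (t : BalancedTensor R N M) : ofCoord b N (coordBalanced b N t) = t := by
  obtain ⟨t, rfl⟩ := QuotientAddGroup.mk_surjective t
  change ofCoord b N (coordAux b N t) = _
  induction t with
  | zero => rw [map_zero, map_zero]; rfl
  | add t t' h h' => rw [map_add, map_add, h, h']; rfl
  | tmul n m =>
    obtain ⟨f, rfl⟩ := b.repr.symm.surjective m
    induction f using Finsupp.induction_linear with
    | zero => simp
    | add f g hf hg =>
      rw [map_add, tmul_add, map_add, map_add, hf, hg]; rfl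
    | single i r =>
      have : coordAux b N (n ⊗ₜ b.repr.symm (Finsupp.single i r)) =
          Finsupp.single i (MulOpposite.op r • n) := by
        ext j
        rw [coordAux_tmul, LinearEquiv.apply_symm_apply]
        by_cases h : i = j
        · subst h; simp
        · simp [Finsupp.single_eq_of_ne (Ne.symm h)]
      rw [this, ofCoord, Finsupp.liftAddHom_apply_single, Module.Basis.repr_symm_single]
      exact BalancedTensor.mk_smul n r (b i)

theorem coordBalanced_map {N N' : Type} [AddCommGroup N] [Module Rᵐᵒᵖ N] [AddCommGroup N']
    [Module Rᵐᵒᵖ N'] (f : N →ₗ[Rᵐᵒᵖ] N') (t : BalancedTensor R N M) (i : ι) :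
    coordBalanced b N' (BalancedTensor.map M f t) i = f (coordBalanced b N t i) := by
  obtain ⟨t, rfl⟩ := QuotientAddGroup.mk_surjective t
  change coordAux b N' (f.toAddMonoidHom.toIntLinearMap.rTensor M t) i = f (coordAux b N t i)
  induction t with
  | zero => simp
  | add t t' h h' => simp only [map_add, Finsupp.add_apply, h, h']
  | tmul n m =>
    rw [LinearMap.rTensor_tmul, coordAux_tmul, coordAux_tmul, map_smul]
    rfl

/-- A non-zero free module is faithfully flat. -/
theorem isFaithfullyFlat_of_basis (b : Module.Basis ι R M) [Nonempty ι] :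
    IsFaithfullyFlat R M where
  flat N N' _ _ _ _ f hf t t' h := by
    have h' : coordBalanced b N t = coordBalanced b N t' := by
      ext i
      refine hf ?_
      rw [← coordBalanced_map, h, coordBalanced_map]
    rw [← ofCoord_coordBalanced b N t, h', ofCoord_coordBalanced]
  faithful N _ _ hN := by
    obtain ⟨i⟩ := ‹Nonempty ι›
    refine ⟨fun n n' => ?_⟩
    have h := congrArg (coordBalanced b N)
      (Subsingleton.elim (QuotientAddGroup.mk (n ⊗ₜ[ℤ] b i) : BalancedTensor R N M)
        (QuotientAddGroup.mk (n' ⊗ₜ[ℤ] b i)))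
    have := DFunLike.congr_fun h i
    change coordAux b N (n ⊗ₜ[ℤ] b i) i = coordAux b N (n' ⊗ₜ[ℤ] b i) i at this
    simpa [coordAux_tmul] using this

end FaithfullyFlat

/-! ### Cleft extensions of a polynomial ring -/

section Galois
variable {H R : Type} [Ring H] [HopfAlgebra ℂ H] [Ring R] [Algebra ℂ R]

/-- The map `x ⊗ h ↦ x φ(h₍₁₎) ⊗ h₍₂₎`. -/
noncomputable def translation (φ : H →ₗ[ℂ] R) : R ⊗[ℂ] H →ₗ[ℂ] R ⊗[ℂ] H :=
  LinearMap.mul' ℂ (R ⊗[ℂ] H) ∘ₗ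
    TensorProduct.map (Algebra.TensorProduct.includeLeft : R →ₐ[ℂ] R ⊗[ℂ] H).toLinearMap
      (TensorProduct.map φ LinearMap.id ∘ₗ comul)

theorem translation_tmul (φ : H →ₗ[ℂ] R) (x : R) (h : H) :
    translation φ (x ⊗ₜ h) = x ⊗ₜ 1 * TensorProduct.map φ LinearMap.id (comul h) := rfl

theorem translation_translation (φ ψ : H →ₗ[ℂ] R) (t : R ⊗[ℂ] H) :
    translation ψ (translation φ t) =
      translation (WithConv.toConv φ * WithConv.toConv ψ).ofConv t := by
  have hl (x : R) (t : R ⊗[ℂ] H) : translation ψ (x ⊗ₜ 1 * t) = x ⊗ₜ 1 * translation ψ t := by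
    induction t with
    | zero => simp
    | add t t' h h' => simp only [mul_add, map_add, h, h']
    | tmul y h =>
      rw [Algebra.TensorProduct.tmul_mul_tmul, one_mul, translation_tmul, translation_tmul,
        ← mul_assoc, Algebra.TensorProduct.tmul_mul_tmul, one_mul]
  induction t with
  | zero => simp
  | add t t' h h' => simp only [map_add, h, h']
  | tmul x h =>
    rw [translation_tmul, hl, translation_tmul]
    congr 1
    let K : H ⊗[ℂ] (H ⊗[ℂ] H) →ₗ[ℂ] R ⊗[ℂ] H :=
      LinearMap.mul' ℂ (R ⊗[ℂ] H) ∘ₗ TensorProduct.map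
        ((Algebra.TensorProduct.includeLeft : R →ₐ[ℂ] R ⊗[ℂ] H).toLinearMap ∘ₗ φ)
        (TensorProduct.map ψ LinearMap.id)
    have hK (a b c : H) : K (a ⊗ₜ (b ⊗ₜ c)) = (φ a * ψ b) ⊗ₜ c := by
      simp [K]
    have h1 : translation ψ (TensorProduct.map φ LinearMap.id (comul h)) =
        K (comul.lTensor H (comul h)) := by
      induction comul (R := ℂ) h with
      | zero => simp
      | add t t' h h' => simp only [map_add, h, h']
      | tmul a b => simp [translation_tmul, K]
    have h2 : TensorProduct.map (WithConv.toConv φ * WithConv.toConv ψ).ofConv LinearMap.id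
        (comul h) = K (TensorProduct.assoc ℂ H H H (comul.rTensor H (comul h))) := by
      induction comul (R := ℂ) h with
      | zero => simp
      | add t t' h h' => simp only [map_add, h, h']
      | tmul a b =>
        rw [TensorProduct.map_tmul, LinearMap.rTensor_tmul]
        change (WithConv.toConv φ * WithConv.toConv ψ) a ⊗ₜ b = _
        rw [LinearMap.convMul_apply]
        induction comul (R := ℂ) a with
        | zero => simp
        | add t t' h h' => simp only [map_add, add_tmul, h, h']
        | tmul a a' => simp [hK]
    rw [h1, h2, Coalgebra.coassoc_apply]

theorem translation_one (t : R ⊗[ℂ] H) :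
    translation (1 : WithConv (H →ₗ[ℂ] R)).ofConv t = t := by
  induction t with
  | zero => simp
  | add t t' h h' => simp only [map_add, h, h']
  | tmul x h =>
    have key : TensorProduct.map (1 : WithConv (H →ₗ[ℂ] R)).ofConv LinearMap.id (comul h) =
        (1 : R) ⊗ₜ[ℂ] h := by
      have h1 (t : H ⊗[ℂ] H) : TensorProduct.map (1 : WithConv (H →ₗ[ℂ] R)).ofConv LinearMap.id t =
          TensorProduct.map (Algebra.linearMap ℂ R) LinearMap.id (counit.rTensor H t) := by
        induction t with
        | zero => simp
        | add t t' h h' => simp only [map_add, h, h']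
        | tmul a b => simp [LinearMap.convOne_def]
      rw [h1, Coalgebra.rTensor_counit_comul]
      simp
    rw [translation_tmul, key, Algebra.TensorProduct.tmul_mul_tmul, mul_one, one_mul]

theorem translation_bijective {φ : H →ₗ[ℂ] R} (h : IsUnit (WithConv.toConv φ)) :
    Function.Bijective (translation φ) := by
  obtain ⟨⟨u, v, huv, hvu⟩, rfl : u = _⟩ := h
  refine Function.bijective_iff_has_inverse.2 ⟨translation v.ofConv, fun t => ?_, fun t => ?_⟩
  · rw [translation_translation]
    exact (congrArg (fun w : WithConv (H →ₗ[ℂ] R) => translation w.ofConv t) huv).trans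
      (translation_one t)
  · rw [translation_translation]
    exact (congrArg (fun w : WithConv (H →ₗ[ℂ] R) => translation w.ofConv t) hvu).trans
      (translation_one t)

end Galois

open ComoduleAlgebra

/-- A cleaving map `γ` and a coinvariant `z` such that the elements `z ^ k γ(h i)` form a basis of
`R`, for a basis `h` of `H`, and `z` commutes with each `γ(h i)` up to a scalar. -/
structure IsPolynomialCleft {H R ι : Type} [Ring H] [HopfAlgebra ℂ H] [Ring R] [Algebra ℂ R]
    [ComoduleAlgebra H R] (h : Module.Basis ι ℂ H) (γ : H →ₗ[ℂ] R) (z : R) : Prop where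
  cleaving : IsCleavingMap γ
  map_one : γ 1 = 1
  coact_z : coact (H := H) z = z ⊗ₜ 1
  linearIndependent : LinearIndependent ℂ fun i : ι × ℕ => z ^ i.2 * γ (h i.1)
  span : Submodule.span ℂ (Set.range fun i : ι × ℕ => z ^ i.2 * γ (h i.1)) = ⊤
  qcomm (i : ι) : QComm (γ (h i)) z

namespace IsPolynomialCleft
variable {H R ι : Type} [Ring H] [HopfAlgebra ℂ H] [Ring R] [Algebra ℂ R]
    [ComoduleAlgebra H R] {h : Module.Basis ι ℂ H} {γ : H →ₗ[ℂ] R} {z : R}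

theorem aeval_mem (hc : IsPolynomialCleft h γ z) (p : Polynomial ℂ) :
    Polynomial.aeval z p ∈ coinvariants H R := by
  induction p using Polynomial.induction_on' with
  | add p q hp hq => rw [map_add]; exact add_mem hp hq
  | monomial n a =>
    rw [Polynomial.aeval_monomial]
    exact mul_mem (Subalgebra.algebraMap_mem _ _) (pow_mem (S := coinvariants H R) hc.coact_z n)

theorem nonempty (_hc : IsPolynomialCleft h γ z) : Nonempty ι := by
  have : Nontrivial H := ⟨0, 1, fun h01 => by simpa using congrArg (counit (R := ℂ)) h01⟩
  exact h.index_nonempty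

theorem coact_map (hc : IsPolynomialCleft h γ z) (x : H) :
    coact (H := H) (γ x) = TensorProduct.map γ LinearMap.id (comul (R := ℂ) x) :=
  LinearMap.congr_fun hc.cleaving.comodule x

theorem induction_on (hc : IsPolynomialCleft h γ z) {P : R → Prop} (x : R)
    (h0 : P 0) (hadd : ∀ x y, P x → P y → P (x + y)) (hsmul : ∀ (s : ℂ) x, P x → P (s • x))
    (hbasis : ∀ k i, P (z ^ k * γ (h i))) : P x := by
  have hx : x ∈ Submodule.span ℂ (Set.range fun i : ι × ℕ => z ^ i.2 * γ (h i.1)) :=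
    hc.span ▸ Submodule.mem_top
  induction hx using Submodule.span_induction with
  | mem x hx => obtain ⟨⟨i, k⟩, rfl⟩ := hx; exact hbasis k i
  | zero => exact h0
  | add x y _ _ hx hy => exact hadd x y hx hy
  | smul s x _ hx => exact hsmul s x hx

theorem mem_range_aeval (hc : IsPolynomialCleft h γ z) {x : R} (hx : x ∈ coinvariants H R) :
    ∃ p : Polynomial ℂ, Polynomial.aeval z p = x := by
  obtain ⟨⟨u, v, huv, hvu⟩, hu : u = _⟩ := hc.cleaving.invertible
  rw [hu] at huv
  let E : R →ₗ[ℂ] R := LinearMap.mul' ℂ R ∘ₗ TensorProduct.map LinearMap.id v.ofConv ∘ₗ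
    (coact : R →ₐ[ℂ] R ⊗[ℂ] H).toLinearMap
  have hE (k : ℕ) (y : H) : E (z ^ k * γ y) = counit (R := ℂ) y • z ^ k := by
    have h1 : coact (H := H) (z ^ k * γ y) =
        (z ^ k) ⊗ₜ 1 * TensorProduct.map γ LinearMap.id (comul (R := ℂ) y) := by
      rw [map_mul, map_pow, hc.coact_z, Algebra.TensorProduct.tmul_pow, one_pow, hc.coact_map]
    have h2 (t : H ⊗[ℂ] H) : LinearMap.mul' ℂ R (TensorProduct.map LinearMap.id v.ofConv
        ((z ^ k) ⊗ₜ 1 * TensorProduct.map γ LinearMap.id t)) =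
        z ^ k * LinearMap.mul' ℂ R (TensorProduct.map γ v.ofConv t) := by
      induction t with
      | zero => simp
      | add t t' h h' => simp only [map_add, mul_add, h, h']
      | tmul a b => simp [mul_assoc]
    have h3 := LinearMap.congr_fun (congrArg WithConv.ofConv huv) y
    change LinearMap.mul' ℂ R (TensorProduct.map γ v.ofConv (comul (R := ℂ) y)) =
      algebraMap ℂ R (counit (R := ℂ) y) at h3
    change LinearMap.mul' ℂ R (TensorProduct.map LinearMap.id v.ofConv (coact _)) = _
    rw [h1, h2, h3, ← Algebra.commutes, ← Algebra.smul_def]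
  have hv : v.ofConv 1 = 1 := by
    have h3 := LinearMap.congr_fun (congrArg WithConv.ofConv huv) 1
    change LinearMap.mul' ℂ R (TensorProduct.map γ v.ofConv (comul (R := ℂ) (1 : H))) =
      algebraMap ℂ R (counit (R := ℂ) (1 : H)) at h3
    simpa [Algebra.TensorProduct.one_def, hc.map_one] using h3
  have hEx : E x = x := by
    change LinearMap.mul' ℂ R (TensorProduct.map LinearMap.id v.ofConv (coact x)) = _
    have : coact (H := H) x = x ⊗ₜ 1 := hx
    rw [this]
    simp [hv]
  rw [← hEx]
  refine hc.induction_on (P := fun x => ∃ p : Polynomial ℂ, Polynomial.aeval z p = E x) x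
    ⟨0, by simp⟩ ?_ ?_ ?_
  · rintro x y ⟨p, hp⟩ ⟨p', hp'⟩
    exact ⟨p + p', by rw [map_add, map_add, hp, hp']⟩
  · rintro s x ⟨p, hp⟩
    exact ⟨s • p, by rw [map_smul, map_smul, hp]⟩
  · intro k i
    exact ⟨counit (R := ℂ) (h i) • Polynomial.X ^ k, by
      rw [hE, map_smul, map_pow, Polynomial.aeval_X]⟩

theorem eq_zero_of_sum_eq_zero (hc : IsPolynomialCleft h γ z) (s : Finset ι)
    (P : ι → Polynomial ℂ) (hP : ∑ i ∈ s, Polynomial.aeval z (P i) * γ (h i) = 0) :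
    ∀ i ∈ s, P i = 0 := by
  intro i hi
  set n := s.sup (fun i => (P i).natDegree) + 1 with hn
  have hdeg : ∀ i ∈ s, (P i).natDegree < n := fun i hi =>
    Nat.lt_succ_of_le (Finset.le_sup (f := fun i => (P i).natDegree) hi)
  have h0 : ∑ x ∈ s ×ˢ Finset.range n, (P x.1).coeff x.2 • (z ^ x.2 * γ (h x.1)) = 0 := by
    rw [Finset.sum_product, ← hP]
    refine Finset.sum_congr rfl fun i hi => ?_
    rw [Polynomial.aeval_eq_sum_range' (hdeg i hi), Finset.sum_mul]
    exact Finset.sum_congr rfl fun k _ => (smul_mul_assoc _ _ _).symm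
  ext k
  rw [Polynomial.coeff_zero]
  by_cases hk : k < n
  · exact linearIndependent_iff'.1 hc.linearIndependent _ (fun x => (P x.1).coeff x.2) h0 (i, k)
      (Finset.mk_mem_product hi (Finset.mem_range.2 hk))
  · exact Polynomial.coeff_eq_zero_of_natDegree_lt ((hdeg i hi).trans_le (not_lt.1 hk))

theorem aeval_injective (hc : IsPolynomialCleft h γ z) :
    Function.Injective (Polynomial.aeval (R := ℂ) z) := by
  refine (injective_iff_map_eq_zero _).2 fun p hp => ?_
  obtain ⟨i⟩ := hc.nonempty
  exact hc.eq_zero_of_sum_eq_zero {i} (fun _ => p) (by simp [hp]) i (Finset.mem_singleton_self i)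

theorem range_aeval (hc : IsPolynomialCleft h γ z) :
    (Polynomial.aeval (R := ℂ) z).range = coinvariants H R := by
  ext x
  exact ⟨fun ⟨p, hp⟩ => hp ▸ hc.aeval_mem p, fun hx => hc.mem_range_aeval hx⟩

theorem mul_aeval (hc : IsPolynomialCleft h γ z) (i : ι) :
    ∃ s : ℂ, s ≠ 0 ∧ ∀ p : Polynomial ℂ, γ (h i) * Polynomial.aeval z p =
      Polynomial.aeval z (p.comp (Polynomial.C s * Polynomial.X)) * γ (h i) := by
  obtain ⟨s, hs, h1⟩ := hc.qcomm i
  refine ⟨s, hs, fun p => ?_⟩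
  have hX : Polynomial.aeval z (Polynomial.C s * Polynomial.X) = s • z := by
    rw [map_mul, Polynomial.aeval_C, Polynomial.aeval_X, Algebra.smul_def]
  rw [Polynomial.aeval_comp, hX]
  induction p using Polynomial.induction_on' with
  | add p q hp hq => rw [map_add, map_add, mul_add, add_mul, hp, hq]
  | monomial n a =>
    have : SemiconjBy (γ (h i)) z (s • z) := by
      rw [SemiconjBy, h1, smul_mul_assoc]
    rw [Polynomial.aeval_monomial, Polynomial.aeval_monomial, ← mul_assoc, ← Algebra.commutes,
      mul_assoc, (this.pow_right n).eq, mul_assoc]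

/-- `R` is a free left module over its coinvariants. -/
noncomputable def basisLeft (hc : IsPolynomialCleft h γ z) :
    Module.Basis ι (coinvariants H R) R :=
  .mk (v := fun i => γ (h i)) (by
    rw [linearIndependent_iff']
    intro s g hg i hi
    choose P hP using fun i => hc.mem_range_aeval (g i).2
    refine Subtype.ext ?_
    rw [← hP, hc.eq_zero_of_sum_eq_zero s P ?_ i hi, map_zero]
    · rfl
    · rw [← hg]
      exact Finset.sum_congr rfl fun i _ => by rw [hP]; rfl)
    (fun x _ => by
      refine hc.induction_on x (Submodule.zero_mem _) (fun x y hx hy => Submodule.add_mem _ hx hy)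
        (fun s x hx => ?_) fun k i => ?_
      · rw [← algebraMap_smul (coinvariants H R)]
        exact Submodule.smul_mem _ _ hx
      · exact Submodule.smul_mem _ (⟨z ^ k, pow_mem hc.coact_z k⟩ : coinvariants H R)
          (Submodule.subset_span ⟨i, rfl⟩))

/-- `R` is a free right module over its coinvariants. -/
noncomputable def basisRight (hc : IsPolynomialCleft h γ z) :
    Module.Basis ι (coinvariants H R).op R :=
  .mk (v := fun i => γ (h i)) (by
    rw [linearIndependent_iff']
    intro s g hg i hi
    choose P hP using fun i => hc.mem_range_aeval (g i).2
    choose t ht0 ht using hc.mul_aeval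
    have h1 : P i = 0 := by
      have := hc.eq_zero_of_sum_eq_zero s
        (fun i => (P i).comp (Polynomial.C (t i) * Polynomial.X)) ?_ i hi
      · ext n
        have hn := congrArg (fun p => p.coeff n) this
        simp only [Polynomial.comp_C_mul_X_coeff, Polynomial.coeff_zero] at hn
        exact (mul_eq_zero.1 hn).resolve_right (pow_ne_zero _ (ht0 i))
      · rw [← hg]
        exact Finset.sum_congr rfl fun i _ => by rw [← ht, hP]; rfl
    refine Subtype.ext (MulOpposite.unop_injective ?_)
    rw [← hP, h1, map_zero]
    rfl)
    (fun x _ => by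
      refine hc.induction_on x (Submodule.zero_mem _) (fun x y hx hy => Submodule.add_mem _ hx hy)
        (fun s x hx => ?_) fun k i => ?_
      · rw [← algebraMap_smul (coinvariants H R).op]
        exact Submodule.smul_mem _ _ hx
      · obtain ⟨s, -, hs⟩ := ((hc.qcomm i).pow_right k).symm
        rw [hs, ← algebraMap_smul (coinvariants H R).op]
        exact Submodule.smul_mem _ _ (Submodule.smul_mem _
          (⟨MulOpposite.op (z ^ k), pow_mem (S := coinvariants H R) hc.coact_z k⟩ :
            (coinvariants H R).op) (Submodule.subset_span ⟨i, rfl⟩)))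

theorem isHopfGalois (hc : IsPolynomialCleft h γ z) : IsHopfGalois H R := by
  let p : R ⊗[ℂ] H →ₗ[ℂ] (R ⊗[ℂ] R) ⧸ balancedRelations R (coinvariants H R) :=
    Submodule.mkQ _ ∘ₗ TensorProduct.map LinearMap.id γ
  have hp (t : R ⊗[ℂ] H) : canonicalMap H R (p t) = translation γ t := by
    induction t with
    | zero => simp
    | add t t' h h' => simp only [map_add, h, h']
    | tmul x y =>
      change canonicalMapAux H R (x ⊗ₜ γ y) = x ⊗ₜ 1 * TensorProduct.map γ LinearMap.id (comul y)
      rw [← hc.coact_map]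
      rfl
  have hsurj : Function.Surjective p := by
    intro t
    obtain ⟨t, rfl⟩ := Submodule.mkQ_surjective _ t
    induction t with
    | zero => exact ⟨0, by simp⟩
    | add t t' h h' =>
      obtain ⟨u, hu⟩ := h
      obtain ⟨u', hu'⟩ := h'
      exact ⟨u + u', by rw [map_add, map_add, hu, hu']⟩
    | tmul x y =>
      refine hc.induction_on (P := fun y => ∃ u, p u = Submodule.mkQ _ (x ⊗ₜ y)) y ⟨0, by simp⟩
        ?_ ?_ fun k i => ⟨(x * z ^ k) ⊗ₜ h i, ?_⟩
      · rintro y y' ⟨u, hu⟩ ⟨u', hu'⟩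
        exact ⟨u + u', by rw [map_add, tmul_add, map_add, hu, hu']⟩
      · rintro s y ⟨u, hu⟩
        exact ⟨s • u, by rw [map_smul, tmul_smul, map_smul, hu]⟩
      · change Submodule.mkQ _ ((x * z ^ k) ⊗ₜ γ (h i)) = _
        rw [← sub_eq_zero, ← map_sub, Submodule.mkQ_apply, Submodule.Quotient.mk_eq_zero]
        exact Submodule.subset_span
          ⟨x, γ (h i), ⟨z ^ k, pow_mem (S := coinvariants H R) hc.coact_z k⟩, rfl⟩
  obtain ⟨hi, hs⟩ := translation_bijective hc.cleaving.invertible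
  refine ⟨fun t t' ht => ?_, fun t => ?_⟩
  · obtain ⟨u, rfl⟩ := hsurj t
    obtain ⟨u', rfl⟩ := hsurj t'
    rw [hp, hp] at ht
    rw [hi ht]
  · obtain ⟨u, rfl⟩ := hs t
    exact ⟨p u, hp u⟩

theorem isPrincipal (hc : IsPolynomialCleft h γ z) : IsPrincipal H R :=
  have := hc.nonempty
  ⟨hc.isHopfGalois, isFaithfullyFlat_of_basis hc.basisLeft, isFaithfullyFlat_of_basis hc.basisRight⟩

theorem isCleft (hc : IsPolynomialCleft h γ z) : IsCleft H R := ⟨γ, hc.cleaving⟩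

theorem map {R' : Type} [Ring R'] [Algebra ℂ R'] [ComoduleAlgebra H R']
    (hc : IsPolynomialCleft h γ z) (e : R ≃ₐ[ℂ] R') (he : IsComoduleAlgHom H e.toAlgHom) :
    IsPolynomialCleft h (e.toLinearMap ∘ₗ γ) (e z) := by
  have hmul (k : ℕ) (i : ι) :
      e z ^ k * (e.toLinearMap ∘ₗ γ) (h i) = e.toLinearMap (z ^ k * γ (h i)) := by
    simp
  have hco (x : R) : coact (H := H) (e x) =
      TensorProduct.map e.toLinearMap LinearMap.id (coact (H := H) x) := DFunLike.congr_fun he x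
  refine ⟨⟨?_, ?_⟩, by simp [hc.map_one], ?_, ?_, ?_, fun i => (hc.qcomm i).map e.toAlgHom⟩
  · ext x
    change coact (H := H) (e (γ x)) = _
    rw [hco, hc.coact_map, ← LinearMap.comp_apply, ← TensorProduct.map_comp, LinearMap.id_comp]
    rfl
  · obtain ⟨⟨u, v, huv, hvu⟩, rfl : u = _⟩ := hc.cleaving.invertible
    have hd (f g : WithConv (H →ₗ[ℂ] R)) :
        WithConv.toConv (e.toLinearMap ∘ₗ (f * g).ofConv) =
          WithConv.toConv (e.toLinearMap ∘ₗ f.ofConv) *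
            WithConv.toConv (e.toLinearMap ∘ₗ g.ofConv) :=
      congrArg WithConv.toConv (LinearMap.algHom_comp_convMul_distrib e.toAlgHom f g)
    have h1 : WithConv.toConv (e.toLinearMap ∘ₗ (1 : WithConv (H →ₗ[ℂ] R)).ofConv) = 1 := by
      ext x
      simp [LinearMap.convOne_def]
    exact ⟨⟨_, WithConv.toConv (e.toLinearMap ∘ₗ v.ofConv), by rw [← h1, ← huv, hd],
      by rw [← h1, ← hvu, hd]⟩, rfl⟩
  · rw [hco, hc.coact_z]
    simp
  · simp only [hmul]
    exact hc.linearIndependent.map' e.toLinearMap (LinearMap.ker_eq_bot.2 e.injective)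
  · simp only [hmul]
    have := congrArg (Submodule.map e.toLinearMap) hc.span
    rw [Submodule.map_span, ← Set.range_comp, Submodule.map_top, LinearMap.range_eq_top.2 e.surjective]
      at this
    exact this

end IsPolynomialCleft

/-! ### The Hopf algebra of the parabolic subgroup -/

section
variable {R H : Type*} [Ring R] [Algebra ℂ R] [Ring H] [Algebra ℂ H]

/-- The tensor product of two units. -/
noncomputable def unitTmul (u : Rˣ) (g : Hˣ) : (R ⊗[ℂ] H)ˣ where
  val := u ⊗ₜ g
  inv := (↑u⁻¹ : R) ⊗ₜ (↑g⁻¹ : H)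
  val_inv := by simp [Algebra.TensorProduct.one_def]
  inv_val := by simp [Algebra.TensorProduct.one_def]

theorem unitTmul_mul (u u' : Rˣ) (g g' : Hˣ) :
    unitTmul u g * unitTmul u' g' = unitTmul (u * u') (g * g') :=
  Units.ext (by simp [unitTmul])

/-- `unitTmul` as a homomorphism of groups. -/
noncomputable def unitTmulHom : Rˣ × Hˣ →* (R ⊗[ℂ] H)ˣ :=
  MonoidHom.mk' (fun x => unitTmul x.1 x.2) fun _ _ => (unitTmul_mul _ _ _ _).symm

theorem unitTmul_zpow (u : Rˣ) (g : Hˣ) (n : ℤ) :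
    unitTmul u g ^ n = unitTmul (u ^ n) (g ^ n) :=
  (map_zpow unitTmulHom (u, g) n).symm

theorem map_zpow_eq_tmul {S : Type*} [Semiring S] [Algebra ℂ S] (f : S →ₐ[ℂ] R ⊗[ℂ] H) {w : Sˣ}
    {u : Rˣ} {g : Hˣ} (h : f w = (u : R) ⊗ₜ (g : H)) (n : ℤ) :
    f ↑(w ^ n) = (↑(u ^ n) : R) ⊗ₜ (↑(g ^ n) : H) := by
  have := Torus.units_map_zpow f (v := unitTmul u g) h n
  rw [this, unitTmul_zpow]
  rfl

theorem map_inv_eq_tmul {S : Type*} [Semiring S] [Algebra ℂ S] (f : S →ₐ[ℂ] R ⊗[ℂ] H) {w : Sˣ}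
    {u : Rˣ} {g : Hˣ} (h : f w = (u : R) ⊗ₜ (g : H)) :
    f ↑w⁻¹ = (↑u⁻¹ : R) ⊗ₜ (↑g⁻¹ : H) := by
  simpa only [zpow_neg_one] using map_zpow_eq_tmul f h (-1)

theorem convMul_comp_antipode {A : Type*} [Ring A] [HopfAlgebra ℂ A] (f : A →ₐ[ℂ] R) :
    WithConv.toConv f.toLinearMap *
      WithConv.toConv (f.toLinearMap ∘ₗ HopfAlgebra.antipode ℂ) = 1 := by
  have h := LinearMap.algHom_comp_convMul_distrib f (WithConv.toConv LinearMap.id)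
    (WithConv.toConv (HopfAlgebra.antipode ℂ))
  rw [LinearMap.id_mul_antipode] at h
  refine (congrArg WithConv.toConv h).symm.trans ?_
  ext x
  simp [LinearMap.convOne_def]

theorem comp_antipode_convMul {A : Type*} [Ring A] [HopfAlgebra ℂ A] (f : A →ₐ[ℂ] R) :
    WithConv.toConv (f.toLinearMap ∘ₗ HopfAlgebra.antipode ℂ) *
      WithConv.toConv f.toLinearMap = 1 := by
  have h := LinearMap.algHom_comp_convMul_distrib f (WithConv.toConv (HopfAlgebra.antipode ℂ))
    (WithConv.toConv LinearMap.id)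
  rw [LinearMap.antipode_mul_id] at h
  refine (congrArg WithConv.toConv h).symm.trans ?_
  ext x
  simp [LinearMap.convOne_def]

theorem smul_pow_swap {x y : R} {s : ℂ} (h : x * y = s • (y * x)) (n : ℕ) :
    x ^ n * y = s ^ n • (y * x ^ n) := by
  induction n with
  | zero => simp
  | succ n ih =>
    rw [pow_succ, mul_assoc, h, mul_smul_comm, ← mul_assoc, ih, smul_mul_assoc, smul_smul,
      mul_assoc, pow_succ s, mul_comm s]

theorem smul_zpow_swap {x : R} {u : Rˣ} {s : ℂ} (hs : s ≠ 0) (h : x * u = s • (u * x)) (n : ℤ) :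
    x * ↑(u ^ n) = s ^ n • (↑(u ^ n) * x) := by
  have hinv : x * ↑u⁻¹ = s⁻¹ • (↑u⁻¹ * x) := by
    have : ↑u⁻¹ * x = s • (x * ↑u⁻¹) := OGL.swap_inv h u.mul_inv u.inv_mul
    rw [this, smul_smul, inv_mul_cancel₀ hs, one_smul]
  induction n using Int.induction_on with
  | zero => simp
  | succ n ih =>
    rw [zpow_add, zpow_one, Units.val_mul, ← mul_assoc, ih, smul_mul_assoc, mul_assoc, h,
      mul_smul_comm, smul_smul, mul_assoc, zpow_add₀ hs, zpow_one]
  | pred n ih =>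
    rw [zpow_sub, zpow_one, Units.val_mul, ← mul_assoc, ih, smul_mul_assoc, mul_assoc, hinv,
      mul_smul_comm, smul_smul, mul_assoc, zpow_sub_one₀ hs]

/-- `x ^ r u ^ n = s ^ (r n) u ^ n x ^ r` if `x u = s u x`. -/
theorem smul_pow_zpow_swap {x : R} {u : Rˣ} {s : ℂ} (hs : s ≠ 0) (h : x * u = s • (u * x))
    (r : ℕ) (n : ℤ) : x ^ r * ↑(u ^ n) = s ^ (r * n) • (↑(u ^ n) * x ^ r) := by
  have := smul_zpow_swap (pow_ne_zero r hs) (smul_pow_swap h r) n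
  rwa [← zpow_natCast, ← zpow_mul] at this
end

namespace OGL
variable {q : ℂ}

theorem mul_D_of {x : OGL q} {s : ℂ} (h : gen q .Dinv * x = s • (x * gen q .Dinv)) :
    x * D q = s • (↑(D q) * x) := by
  calc x * D q = D q * (gen q .Dinv * x) * D q := by
        change _ = det q * _ * det q
        rw [← mul_assoc, det_inv, one_mul]; rfl
    _ = s • (↑(D q) * x) := by
        change det q * _ * det q = _
        rw [h, mul_smul_comm, smul_mul_assoc, mul_assoc, mul_assoc, inv_det, mul_one]; rfl

theorem a_mul_D (hq : q ≠ 0) : gen q .a * D q = D q * gen q .a := by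
  rw [mul_D_of (s := 1) (by rw [one_smul, rDa hq]), one_smul]
theorem b_mul_D (hq : q ≠ 0) : gen q .b * D q = q ^ 2 • (D q * gen q .b) := mul_D_of (rDb hq)
theorem c_mul_D (hq : q ≠ 0) : gen q .c * D q = (q ^ 2)⁻¹ • (D q * gen q .c) := mul_D_of (rDc hq)
theorem d_mul_D (hq : q ≠ 0) : gen q .d * D q = D q * gen q .d := by
  rw [mul_D_of (s := 1) (by rw [one_smul, rDd hq]), one_smul]

theorem comul_D [NeZero q] : comul (R := ℂ) (D q : OGL q) = (D q : OGL q) ⊗ₜ (D q : OGL q) := by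
  have := comulFun_det (q := q) (NeZero.ne q)
  refine Eq.trans ?_ this
  change comulHom (NeZero.ne q) (det q) = _
  simp only [det, map_sub, map_smul, map_mul, comulHom_gen]

end OGL

namespace OP
variable (q : ℂ) [NeZero q]

/-- The projection `A → H` as an algebra map. -/
noncomputable abbrev mk : OGL q →ₐ[ℂ] OP q := Ideal.Quotient.mkₐ ℂ (OGL.borelIdeal q)

theorem hom_ext {B : Type*} [Ring B] [Algebra ℂ B] {f g : OP q →ₐ[ℂ] B}
    (h : ∀ x, f (mk q (OGL.gen q x)) = g (mk q (OGL.gen q x))) : f = g :=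
  Ideal.Quotient.algHom_ext ℂ (OGL.hom_ext h)

theorem n_mul_t : n q * t q = q • (t q * n q) := by
  have := congrArg (mk q) (OGL.rba (q := q) (NeZero.ne q))
  rwa [map_mul, map_smul, map_mul] at this
theorem t_mul_D : (t q : OP q) * D q = D q * t q := by
  have := congrArg (mk q) (OGL.a_mul_D (q := q) (NeZero.ne q))
  rwa [map_mul, map_mul] at this
theorem n_mul_D : n q * D q = q ^ 2 • (D q * n q) := by
  have := congrArg (mk q) (OGL.b_mul_D (q := q) (NeZero.ne q))
  rwa [map_mul, map_smul, map_mul] at this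
theorem mk_c : mk q (OGL.gen q .c) = 0 := OGL.mk_gen_c q
theorem s_eq : s q = ↑((t q)⁻¹ * D q) := by
  rw [Units.val_mul, Units.eq_inv_mul_iff_mul_eq]
  have := congrArg (mk q) (OGL.a_mul_d q)
  rwa [map_mul, map_add, map_smul, map_mul, mk_c, mul_zero, smul_zero, add_zero] at this

theorem commute_t_D : Commute (t q) (D q) := Units.ext (t_mul_D q)

theorem n_mul_s : n q * s q = q • (s q * n q) := by
  have h := smul_zpow_swap (NeZero.ne q) (n_mul_t q) (-1)
  rw [zpow_neg_one, zpow_neg_one] at h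
  rw [s_eq, Units.val_mul, ← mul_assoc, h, smul_mul_assoc, mul_assoc, n_mul_D, mul_smul_comm,
    smul_smul, mul_assoc]
  congr 1
  have := NeZero.ne q
  field_simp

theorem comul_mk (x : OGL q) : comul (R := ℂ) (mk q x) =
    Algebra.TensorProduct.map (mk q) (mk q) (comul (R := ℂ) x) :=
  (CoalgHomClass.map_comp_comul_apply (pr q) x).symm

theorem comul_t : comul (R := ℂ) (t q : OP q) = (t q : OP q) ⊗ₜ (t q : OP q) := by
  refine (comul_mk q (OGL.gen q .a)).trans ?_
  simp only [OGL.comul_gen, OGL.comulFun, map_add, Algebra.TensorProduct.map_tmul, mk_c, tmul_zero,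
    add_zero]
  rfl

theorem comul_n : comul (R := ℂ) (n q) = (t q : OP q) ⊗ₜ n q + n q ⊗ₜ s q := by
  refine (comul_mk q (OGL.gen q .b)).trans ?_
  simp only [OGL.comul_gen, OGL.comulFun, map_add, Algebra.TensorProduct.map_tmul]
  rfl

theorem comul_D : comul (R := ℂ) (D q : OP q) = (D q : OP q) ⊗ₜ (D q : OP q) := by
  refine (comul_mk q (OGL.D q)).trans ?_
  rw [OGL.comul_D]
  rfl

theorem comul_s : comul (R := ℂ) (s q) = s q ⊗ₜ s q := by
  refine (comul_mk q (OGL.gen q .d)).trans ?_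
  simp only [OGL.comul_gen, OGL.comulFun, map_add, Algebra.TensorProduct.map_tmul, mk_c, zero_tmul,
    zero_add]
  rfl

theorem counit_n : counit (R := ℂ) (n q) = 0 := OGL.counit_gen .b

theorem isGroupLike_t : IsGroupLikeElem ℂ (t q : OP q) := ⟨OGL.counit_gen .a, comul_t q⟩

theorem isGroupLike_D : IsGroupLikeElem ℂ (D q : OP q) := by
  refine ⟨?_, comul_D q⟩
  change OGL.counitHom q (OGL.det q) = 1
  simp [OGL.det, OGL.counitHom_gen, OGL.counitFun]

theorem isGroupLike_zpow {A : Type*} [Ring A] [Bialgebra ℂ A] {u : Aˣ}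
    (h : IsGroupLikeElem ℂ (u : A)) (m : ℤ) : IsGroupLikeElem ℂ (↑(u ^ m) : A) := by
  cases m with
  | ofNat m => simpa using h.pow
  | negSucc m =>
    rw [zpow_negSucc]
    exact isGroupLikeElem_unitsInv.2 (by simpa using h.pow)

theorem isGroupLike (p m : ℤ) : IsGroupLikeElem ℂ (↑(D q ^ p * t q ^ m) : OP q) :=
  (isGroupLike_zpow (isGroupLike_D q) p).mul (isGroupLike_zpow (isGroupLike_t q) m)

/-- The monomials `D ^ p t ^ m n ^ r`. -/
noncomputable def monomial (i : ℤ × ℤ × ℕ) : OP q := ↑(D q ^ i.1 * t q ^ i.2.1) * n q ^ i.2.2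

theorem adjoin_eq_top :
    Algebra.adjoin ℂ {1, n q, (D q : OP q), ↑(D q)⁻¹, (t q : OP q), ↑(t q)⁻¹} = ⊤ := by
  have hr : (mk q).range = ⊤ := AlgHom.range_eq_top _ |>.2 Ideal.Quotient.mk_surjective
  rw [eq_top_iff, ← hr, ← Algebra.map_top, ← OGL.adjoin_gen, AlgHom.map_adjoin, ← Set.range_comp]
  set S := Algebra.adjoin ℂ {1, n q, (D q : OP q), ↑(D q)⁻¹, (t q : OP q), ↑(t q)⁻¹} with hS
  refine Algebra.adjoin_le ?_
  rintro _ ⟨x, rfl⟩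
  have hD : ↑(D q) ∈ S := Algebra.subset_adjoin (by simp)
  have hD' : ↑(D q)⁻¹ ∈ S := Algebra.subset_adjoin (by simp)
  have ht : ↑(t q) ∈ S := Algebra.subset_adjoin (by simp)
  have ht' : ↑(t q)⁻¹ ∈ S := Algebra.subset_adjoin (by simp)
  have hn : n q ∈ S := Algebra.subset_adjoin (by simp)
  cases x
  · exact ht
  · exact hn
  · change mk q _ ∈ S
    rw [mk_c]
    exact S.zero_mem
  · change s q ∈ S
    rw [s_eq]
    exact S.mul_mem ht' hD
  · exact hD'

theorem qcomm_tD : QComm (t q : OP q) (D q) := .of_commute (t_mul_D q)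
theorem qcomm_nt : QComm (n q) (t q) := ⟨q, NeZero.ne q, n_mul_t q⟩
theorem qcomm_nD : QComm (n q) (D q) := ⟨_, pow_ne_zero 2 (NeZero.ne q), n_mul_D q⟩

theorem span_monomial : Submodule.span ℂ (Set.range (monomial q)) = ⊤ := by
  rw [eq_top_iff, ← span_monomials_eq_top (adjoin_eq_top q) (.one_right _) (.one_right _)
    (qcomm_tD q) (.one_right _) (qcomm_nD q) (qcomm_nt q)]
  refine Submodule.span_mono ?_
  rintro _ ⟨⟨i, k⟩, rfl⟩
  exact ⟨i, by simp [monomial]⟩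

end OP

/-! ### The first chart -/

namespace A1
variable (q : ℂ)

theorem b_mul_a [NeZero q] : b q * a q = q • (a q * b q) := by
  have := congrArg (Loc.incl (OGL.gen q .a)) (OGL.rba (q := q) (NeZero.ne q))
  rwa [map_mul, map_smul, map_mul] at this
theorem a_mul_D [NeZero q] : (a q : A1 q) * D q = D q * a q := by
  have := congrArg (Loc.incl (OGL.gen q .a)) (OGL.a_mul_D (q := q) (NeZero.ne q))
  rwa [map_mul, map_mul] at this
theorem b_mul_D [NeZero q] : b q * D q = q ^ 2 • (D q * b q) := by
  have := congrArg (Loc.incl (OGL.gen q .a)) (OGL.b_mul_D (q := q) (NeZero.ne q))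
  rwa [map_mul, map_smul, map_mul] at this

/-- The values of the cleaving map of the first chart on the generators. -/
noncomputable def cleavingFun : GLGen → A1 q
  | .a => a q
  | .b => b q
  | .c => 0
  | .d => ↑(a q)⁻¹ * D q
  | .Dinv => ↑(D q)⁻¹

variable [NeZero q]

theorem cleavingFun_rel {x y : FreeAlgebra ℂ GLGen} (h : GLRel q x y) :
    FreeAlgebra.lift ℂ (cleavingFun q) x = FreeAlgebra.lift ℂ (cleavingFun q) y := by
  have hq := NeZero.ne q
  cases h
  all_goals
    simp only [map_mul, map_smul, map_sub, map_one, FreeAlgebra.lift_ι_apply, cleavingFun, mul_zero,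
      zero_mul, smul_zero, sub_zero, Units.mul_inv_cancel_left, Units.mul_inv, Units.inv_mul]
  · rw [b_mul_a, smul_smul, inv_mul_cancel₀ hq, one_smul]
  · have h := smul_zpow_swap hq (b_mul_a q) (-1)
    rw [zpow_neg_one, zpow_neg_one] at h
    rw [← mul_assoc, h, smul_mul_assoc, mul_assoc, b_mul_D, mul_smul_comm, smul_smul, mul_assoc]
    congr 1
    field_simp
  · rw [mul_assoc, ← a_mul_D, Units.inv_mul_cancel_left]

/-- The algebra map `H → A[a⁻¹]` with `t ↦ a`, `n ↦ b`, `s ↦ a⁻¹ D`. -/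
noncomputable def cleaving : OP q →ₐ[ℂ] A1 q :=
  Ideal.Quotient.liftₐ _ (OGL.lift (cleavingFun q) fun _ _ h => cleavingFun_rel q h)
    fun _ hx => OGL.borelIdeal_induction _ (OGL.lift_gen _ _ .c) hx

theorem cleaving_mk (x : GLGen) : cleaving q (OP.mk q (OGL.gen q x)) = cleavingFun q x :=
  OGL.lift_gen (cleavingFun q) (fun _ _ h => cleavingFun_rel q h) x

theorem cleaving_t : cleaving q (OP.t q) = a q := cleaving_mk q .a
theorem cleaving_n : cleaving q (OP.n q) = b q := cleaving_mk q .b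
theorem cleaving_s : cleaving q (OP.s q) = ↑(a q)⁻¹ * D q := cleaving_mk q .d

theorem cleaving_inv {u : (OP q)ˣ} {v : (A1 q)ˣ} (h : cleaving q u = v) :
    cleaving q ↑u⁻¹ = ↑v⁻¹ := by
  simpa only [zpow_neg_one] using Torus.units_map_zpow (cleaving q) h (-1)

theorem cleaving_D_inv : cleaving q ↑(OP.D q)⁻¹ = ↑(D q)⁻¹ := cleaving_mk q .Dinv

theorem cleaving_D : cleaving q (OP.D q) = D q := by
  simpa only [inv_inv] using cleaving_inv q (cleaving_D_inv q)

theorem cleaving_monomial (i : ℤ × ℤ × ℕ) :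
    cleaving q (OP.monomial q i) = ↑(D q ^ i.1 * a q ^ i.2.1) * b q ^ i.2.2 := by
  simp only [OP.monomial, Units.val_mul, map_mul, map_pow, cleaving_n,
    Torus.units_map_zpow (cleaving q) (cleaving_D q),
    Torus.units_map_zpow (cleaving q) (cleaving_t q)]

end A1

namespace OP
variable (q : ℂ) [NeZero q]

theorem linearIndependent_monomial : LinearIndependent ℂ (monomial q) := by
  refine LinearIndependent.of_comp (A1.cleaving q).toLinearMap ?_
  convert (A1.linearIndependent_monomial q).comp (fun i => (i, 0)) fun i j h => (Prod.mk.inj h).1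
    using 1
  funext i
  simp [A1.cleaving_monomial, A1.monomial]

/-- The basis of `H` that consists of the monomials `D ^ p t ^ m n ^ r`. -/
noncomputable def basis : Module.Basis (ℤ × ℤ × ℕ) ℂ (OP q) :=
  .mk (linearIndependent_monomial q) (span_monomial q).ge

theorem basis_apply (i : ℤ × ℤ × ℕ) : basis q i = monomial q i :=
  Module.Basis.mk_apply _ _ i

theorem antipode_n : HopfAlgebra.antipode ℂ (n q) = -q • (n q * ↑(D q)⁻¹) := by
  have h : HopfAlgebra.antipode ℂ (OGL.gen q .b) = -q • (OGL.gen q .b * OGL.gen q .Dinv) :=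
    OGL.antiLin_gen .b
  have h' : mk q (-q • (OGL.gen q .b * OGL.gen q .Dinv)) = -q • (n q * ↑(D q)⁻¹) := by
    rw [map_smul, map_mul]
    rfl
  refine (HopfAlgebra.Quotient.antipode_mk (R := ℂ) (OGL.borelIdeal q) (OGL.gen q .b)).trans ?_
  rw [h]
  exact h'

theorem antipode_monomial (p m : ℤ) (r : ℕ) : ∃ c : ℂ, c ≠ 0 ∧
    HopfAlgebra.antipode ℂ (monomial q (p, m, r)) = c • monomial q (-p - r, -m, r) := by
  have hg : HopfAlgebra.antipode ℂ (↑(D q ^ p * t q ^ m) : OP q) = ↑(D q ^ (-p) * t q ^ (-m)) := by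
    have h := (isGroupLike q p m).antipode_mul_cancel
    rw [← Units.eq_mul_inv_iff_mul_eq, one_mul] at h
    rw [h, mul_inv_rev, zpow_neg, zpow_neg,
      (((commute_t_D q).zpow_left m).zpow_right p).inv_inv.eq]
  have hn : ∀ r : ℕ, ∃ c : ℂ, c ≠ 0 ∧ HopfAlgebra.antipode ℂ (n q ^ r) =
      c • (↑(D q ^ (-r : ℤ)) * n q ^ r) := by
    intro r
    induction r with
    | zero => exact ⟨1, one_ne_zero, by simp⟩
    | succ r ih =>
      obtain ⟨c, hc, h⟩ := ih
      obtain ⟨c', hc', h'⟩ := (qcomm_nD q).zpow_right (-(r + 1 : ℤ))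
      refine ⟨c * -q * c', mul_ne_zero (mul_ne_zero hc (neg_ne_zero.2 (NeZero.ne q))) hc', ?_⟩
      rw [pow_succ, HopfAlgebra.antipode_mul_antidistrib, h, antipode_n, smul_mul_smul_comm,
        mul_comm (-q) c, mul_smul, mul_smul, mul_assoc (n q), ← mul_assoc _ _ (n q ^ r),
        ← Units.val_mul, ← zpow_neg_one, ← zpow_add, ← mul_assoc,
        show (-1 + -r : ℤ) = -(r + 1) by ring, h', smul_mul_assoc, mul_assoc, ← pow_succ',
        ← pow_succ]
      push_cast
      rw [mul_smul]
  obtain ⟨c, hc, h⟩ := hn r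
  obtain ⟨c', hc', h'⟩ := (((qcomm_nD q).zpow_right (-p)).mul_right
    ((qcomm_nt q).zpow_right (-m))).symm.pow_right r |>.symm
  refine ⟨c * c', mul_ne_zero hc hc', ?_⟩
  rw [monomial, HopfAlgebra.antipode_mul_antidistrib, hg, h, smul_mul_assoc, mul_assoc,
    Units.val_mul, h', mul_smul_comm, smul_smul, ← Units.val_mul, ← mul_assoc, ← Units.val_mul,
    ← mul_assoc (D q ^ _), ← zpow_add, monomial,
    show (-r + -p : ℤ) = -p - r by ring]

theorem antipode_bijective : Function.Bijective (HopfAlgebra.antipode ℂ (A := OP q)) := by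
  have h : ∀ i : ℤ × ℤ × ℕ, ∃ c : ℂ, c ≠ 0 ∧
      HopfAlgebra.antipode ℂ (HopfAlgebra.antipode ℂ (basis q i)) = c • basis q i := by
    rintro ⟨p, m, r⟩
    obtain ⟨c, hc, h⟩ := antipode_monomial q p m r
    obtain ⟨c', hc', h'⟩ := antipode_monomial q (-p - r) (-m) r
    refine ⟨c * c', mul_ne_zero hc hc', ?_⟩
    rw [basis_apply, h, map_smul, h', smul_smul, neg_neg, show (-(-p - r) - r : ℤ) = p by ring]
  choose c hc h using h
  let b' := (basis q).isUnitSMul (w := c) fun i => (hc i).isUnit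
  have he : HopfAlgebra.antipode ℂ ∘ₗ HopfAlgebra.antipode ℂ =
      ((basis q).equiv b' (Equiv.refl _)).toLinearMap := by
    refine (basis q).ext fun i => ?_
    rw [LinearMap.comp_apply, h]
    simp [b', Module.Basis.isUnitSMul_apply]
  have hbij : Function.Bijective (HopfAlgebra.antipode ℂ ∘ HopfAlgebra.antipode ℂ (A := OP q)) := by
    have := ((basis q).equiv b' (Equiv.refl _)).bijective
    rw [← LinearEquiv.coe_toLinearMap, ← he] at this
    exact this
  exact ⟨hbij.1.of_comp, hbij.2.of_comp⟩

end OP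


theorem isComoduleMap_of_algHom {H R : Type} [Ring H] [HopfAlgebra ℂ H] [Ring R] [Algebra ℂ R]
    [ComoduleAlgebra H R] {f : H →ₐ[ℂ] R} (h : (coact (H := H)).comp f =
      (Algebra.TensorProduct.map f (AlgHom.id ℂ H)).comp (Bialgebra.comulAlgHom ℂ H)) :
    IsComoduleMap f.toLinearMap :=
  LinearMap.ext fun x => DFunLike.congr_fun h x

namespace A1
variable (q : ℂ) [NeZero q]

theorem coact_a : coact (H := OP q) (a q : A1 q) = (a q : A1 q) ⊗ₜ (OP.t q : OP q) := by
  refine (coact_incl_a q _).trans ?_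
  rw [_root_.coact_a]
  rfl

theorem coact_b : coact (H := OP q) (b q) = (a q : A1 q) ⊗ₜ OP.n q + b q ⊗ₜ OP.s q := by
  refine (coact_incl_a q _).trans ?_
  rw [coact_gen]
  simp only [OGL.comulFun, map_add, Algebra.TensorProduct.map_tmul]
  rfl

theorem coact_c : coact (H := OP q) (c q) = c q ⊗ₜ (OP.t q : OP q) := by
  refine (coact_incl_a q _).trans ?_
  rw [_root_.coact_c]
  rfl

theorem coact_D : coact (H := OP q) (D q : A1 q) = (D q : A1 q) ⊗ₜ (OP.D q : OP q) := by
  refine (coact_incl_a q _).trans ?_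
  change Algebra.TensorProduct.map _ _ (Algebra.TensorProduct.map _ _
    (comul (R := ℂ) (OGL.D q : OGL q))) = _
  rw [OGL.comul_D]
  rfl

theorem coact_z : coact (H := OP q) (z q) = z q ⊗ₜ 1 := by
  rw [z, map_mul, coact_c, map_inv_eq_tmul _ (coact_a q), Algebra.TensorProduct.tmul_mul_tmul,
    Units.mul_inv]

theorem isComoduleMap_cleaving : IsComoduleMap (cleaving q).toLinearMap := by
  have h : (coact (H := OP q)).comp (cleaving q) =
      (Algebra.TensorProduct.map (cleaving q) (AlgHom.id ℂ (OP q))).comp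
        (Bialgebra.comulAlgHom ℂ (OP q)) := by
    refine OP.hom_ext q fun x => ?_
    cases x
    · change coact (cleaving q (OP.t q)) = Algebra.TensorProduct.map _ _
        (comul (R := ℂ) (OP.t q : OP q))
      rw [cleaving_t, coact_a, OP.comul_t, Algebra.TensorProduct.map_tmul, cleaving_t]
      rfl
    · change coact (cleaving q (OP.n q)) = Algebra.TensorProduct.map _ _ (comul (R := ℂ) (OP.n q))
      rw [cleaving_n, coact_b, OP.comul_n, map_add, Algebra.TensorProduct.map_tmul,
        Algebra.TensorProduct.map_tmul, cleaving_t, cleaving_n]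
      rfl
    · rw [OP.mk_c, map_zero, map_zero]
    · change coact (cleaving q (OP.s q)) = Algebra.TensorProduct.map _ _ (comul (R := ℂ) (OP.s q))
      rw [cleaving_s, OP.comul_s, map_mul, coact_D, map_inv_eq_tmul _ (coact_a q),
        Algebra.TensorProduct.tmul_mul_tmul, Algebra.TensorProduct.map_tmul, cleaving_s, ← Units.val_mul (OP.t q)⁻¹,
        ← OP.s_eq]
      rfl
    · change coact (cleaving q ↑(OP.D q)⁻¹) =
        Algebra.TensorProduct.map _ _ (Bialgebra.comulAlgHom ℂ (OP q) ↑(OP.D q)⁻¹)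
      rw [cleaving_D_inv, map_inv_eq_tmul _ (coact_D q),
        map_inv_eq_tmul (Bialgebra.comulAlgHom ℂ (OP q)) (w := OP.D q) (u := OP.D q) (g := OP.D q)
          (OP.comul_D q),
        Algebra.TensorProduct.map_tmul, cleaving_D_inv]
      rfl
  exact isComoduleMap_of_algHom h

theorem cleaving_mul_antipode : WithConv.toConv (cleaving q).toLinearMap *
    WithConv.toConv ((cleaving q).toLinearMap ∘ₗ HopfAlgebra.antipode ℂ) = 1 :=
  convMul_comp_antipode (cleaving q)

theorem antipode_mul_cleaving :
    WithConv.toConv ((cleaving q).toLinearMap ∘ₗ HopfAlgebra.antipode ℂ) *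
      WithConv.toConv (cleaving q).toLinearMap = 1 :=
  comp_antipode_convMul (cleaving q)

theorem isCleavingMap : IsCleavingMap (cleaving q).toLinearMap :=
  ⟨isComoduleMap_cleaving q,
    ⟨⟨_, _, cleaving_mul_antipode q, antipode_mul_cleaving q⟩, rfl⟩⟩

theorem isPolynomialCleft : IsPolynomialCleft (OP.basis q) (cleaving q).toLinearMap (z q) := by
  have h (i : (ℤ × ℤ × ℕ) × ℕ) :
      z q ^ i.2 * (cleaving q).toLinearMap (OP.basis q i.1) = monomial q i := by
    rw [OP.basis_apply, AlgHom.toLinearMap_apply, cleaving_monomial, monomial]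
  refine ⟨isCleavingMap q, by simp, coact_z q, ?_, ?_, fun i => ?_⟩
  · simp only [h]
    exact linearIndependent_monomial q
  · simp only [h]
    exact span_monomial q
  · rw [OP.basis_apply, AlgHom.toLinearMap_apply, cleaving_monomial, Units.val_mul]
    exact (((qcomm_Dz q).symm.zpow_right _).symm.mul_left
      ((qcomm_az q).symm.zpow_right _).symm).mul_left ((qcomm_bz q).symm.pow_right _).symm

end A1

/-! ### The second chart -/

theorem convMul_eq_one_of_basis {H R ι : Type*} [Ring H] [HopfAlgebra ℂ H] [Ring R] [Algebra ℂ R]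
    (h : Module.Basis ι ℂ H) {f g : H →ₗ[ℂ] R}
    (hfg : ∀ i, LinearMap.mul' ℂ R (TensorProduct.map f g (comul (R := ℂ) (h i))) =
      algebraMap ℂ R (counit (R := ℂ) (h i))) :
    WithConv.toConv f * WithConv.toConv g = 1 :=
  congrArg WithConv.toConv (h.ext (f₂ := (1 : WithConv (H →ₗ[ℂ] R)).ofConv) hfg)

theorem isComoduleMap_of_basis {H R ι : Type} [Ring H] [HopfAlgebra ℂ H] [Ring R] [Algebra ℂ R]
    [ComoduleAlgebra H R] (h : Module.Basis ι ℂ H) {f : H →ₗ[ℂ] R}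
    (hf : ∀ i, coact (H := H) (f (h i)) =
      TensorProduct.map f LinearMap.id (comul (R := ℂ) (h i))) : IsComoduleMap f :=
  h.ext hf

theorem sum_antidiagonal_alternating (r : ℕ) :
    ∑ x ∈ Finset.HasAntidiagonal.antidiagonal r, (r.choose x.1 : ℂ) * (-1) ^ x.2 = 0 ^ r := by
  have := (Commute.all (1 : ℂ) (-1)).add_pow' r
  rw [add_neg_cancel] at this
  rw [this]
  exact Finset.sum_congr rfl fun x _ => by rw [one_pow, one_mul, nsmul_eq_mul]

namespace OP
variable {q : ℂ} [NeZero q]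

theorem n_pow_mul_s_pow (k j : ℕ) :
    n q ^ k * s q ^ j = q ^ (k * j) • (↑((t q)⁻¹ * D q) ^ j * n q ^ k) := by
  have h := smul_pow_zpow_swap (x := n q) (u := (t q)⁻¹ * D q) (NeZero.ne q)
    (by rw [← s_eq]; exact n_mul_s q) k j
  rw [zpow_natCast, Units.val_pow_eq_pow_val] at h
  rw [s_eq, h]
  congr 1

theorem monomial_mul_s_pow (p m : ℤ) (k j : ℕ) :
    ↑(D q ^ p * t q ^ m) * (n q ^ k * s q ^ j) = q ^ (k * j) • monomial q (p + j, m - j, k) := by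
  have h : D q ^ p * t q ^ m * ((t q)⁻¹ * D q) ^ j = D q ^ (p + j) * t q ^ (m - j) := by
    rw [((commute_t_D q).inv_left).mul_pow, inv_pow, mul_assoc, ← mul_assoc (t q ^ m),
      ← zpow_natCast, ← zpow_natCast, ← zpow_sub, (((commute_t_D q).zpow_left _).zpow_right _).eq,
      ← mul_assoc, ← zpow_add]
  rw [n_pow_mul_s_pow, mul_smul_comm, ← mul_assoc, ← Units.val_pow_eq_pow_val, ← Units.val_mul, h,
    monomial]

/-- The expansion of `(w ⊗ D) ^ p (u ⊗ t) ^ m (u ⊗ n + v ⊗ s) ^ r`. -/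
theorem tmul_mul_add_pow {R : Type*} [Ring R] [Algebra ℂ R] (w u : Rˣ) {v : R}
    (hv : v * u = q • (u * v)) (p m : ℤ) (r : ℕ) :
    ((↑(w ^ p * u ^ m) : R) ⊗ₜ[ℂ] (↑(D q ^ p * t q ^ m) : OP q)) *
        ((u : R) ⊗ₜ n q + v ⊗ₜ s q) ^ r =
      ∑ x ∈ Finset.HasAntidiagonal.antidiagonal r, ((r.choose x.1 : ℂ) * q ^ (x.1 * x.2)) •
        ((↑(w ^ p * u ^ (m + x.1)) * v ^ x.2) ⊗ₜ[ℂ] monomial q (p + x.2, m - x.2, x.1)) := by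
  have hcomm : Commute ((u : R) ⊗ₜ[ℂ] n q) (v ⊗ₜ s q) := by
    rw [Commute, SemiconjBy, Algebra.TensorProduct.tmul_mul_tmul,
      Algebra.TensorProduct.tmul_mul_tmul, hv, n_mul_s, tmul_smul, smul_tmul']
  rw [hcomm.add_pow', Finset.mul_sum]
  refine Finset.sum_congr rfl fun x _ => ?_
  rw [Algebra.TensorProduct.tmul_pow, Algebra.TensorProduct.tmul_pow,
    Algebra.TensorProduct.tmul_mul_tmul, mul_smul_comm, Algebra.TensorProduct.tmul_mul_tmul,
    monomial_mul_s_pow, tmul_smul, ← Nat.cast_smul_eq_nsmul ℂ, smul_smul, ← mul_assoc,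
    ← Units.val_pow_eq_pow_val, ← Units.val_mul, mul_assoc (w ^ p), ← zpow_natCast u, ← zpow_add]

theorem comul_monomial (p m : ℤ) (r : ℕ) : comul (R := ℂ) (monomial q (p, m, r)) =
    ∑ x ∈ Finset.HasAntidiagonal.antidiagonal r, ((r.choose x.1 : ℂ) * q ^ (x.1 * x.2)) •
      (monomial q (p, m + x.1, x.2) ⊗ₜ[ℂ] monomial q (p + x.2, m - x.2, x.1)) := by
  rw [monomial, Bialgebra.comul_mul, Bialgebra.comul_pow, comul_n,
    (isGroupLike q p m).comul_eq_tmul_self]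
  exact tmul_mul_add_pow (D q) (t q) (n_mul_t q) p m r

theorem counit_monomial (p m : ℤ) (r : ℕ) : counit (R := ℂ) (monomial q (p, m, r)) = 0 ^ r := by
  rw [monomial, Bialgebra.counit_mul, Bialgebra.counit_pow, counit_n,
    (isGroupLike q p m).counit_eq_one, one_mul]

end OP

namespace A2
variable (q : ℂ) [NeZero q]

theorem d_mul_c : d q * c q = q • (c q * d q) := by
  have := congrArg (Loc.incl (OGL.gen q .c)) (OGL.rdc (q := q) (NeZero.ne q))
  rwa [map_mul, map_smul, map_mul] at this
theorem c_mul_D : (c q : A2 q) * D q = (q ^ 2)⁻¹ • (D q * c q : A2 q) := by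
  have := congrArg (Loc.incl (OGL.gen q .c)) (OGL.c_mul_D (q := q) (NeZero.ne q))
  rwa [map_mul, map_smul, map_mul] at this
theorem d_mul_D : d q * D q = D q * d q := by
  have := congrArg (Loc.incl (OGL.gen q .c)) (OGL.d_mul_D (q := q) (NeZero.ne q))
  rwa [map_mul, map_mul] at this

theorem coact_a : coact (H := OP q) (a q : A2 q) = a q ⊗ₜ (OP.t q : OP q) := by
  refine (coact_incl_c q _).trans ?_
  rw [_root_.coact_a]
  rfl

theorem coact_d : coact (H := OP q) (d q) = (c q : A2 q) ⊗ₜ OP.n q + d q ⊗ₜ OP.s q := by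
  refine (coact_incl_c q _).trans ?_
  rw [coact_gen]
  simp only [OGL.comulFun, map_add, Algebra.TensorProduct.map_tmul]
  rfl

theorem coact_c : coact (H := OP q) (c q : A2 q) = (c q : A2 q) ⊗ₜ (OP.t q : OP q) := by
  refine (coact_incl_c q _).trans ?_
  rw [_root_.coact_c]
  rfl

theorem coact_D : coact (H := OP q) (D q : A2 q) = (D q : A2 q) ⊗ₜ (OP.D q : OP q) := by
  refine (coact_incl_c q _).trans ?_
  change Algebra.TensorProduct.map _ _ (Algebra.TensorProduct.map _ _
    (comul (R := ℂ) (OGL.D q : OGL q))) = _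
  rw [OGL.comul_D]
  rfl

theorem coact_z : coact (H := OP q) (z q) = z q ⊗ₜ 1 := by
  rw [z, map_mul, coact_a, map_inv_eq_tmul _ (coact_c q), Algebra.TensorProduct.tmul_mul_tmul,
    Units.mul_inv]

theorem coact_monomial (p m : ℤ) (r : ℕ) :
    coact (H := OP q) (↑(D q ^ p * c q ^ m) * d q ^ r : A2 q) =
      ∑ x ∈ Finset.HasAntidiagonal.antidiagonal r, ((r.choose x.1 : ℂ) * q ^ (x.1 * x.2)) •
        ((↑(D q ^ p * c q ^ (m + x.1)) * d q ^ x.2 : A2 q) ⊗ₜ[ℂ]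
          OP.monomial q (p + x.2, m - x.2, x.1)) := by
  rw [← OP.tmul_mul_add_pow (D q) (c q) (d_mul_c q), map_mul, map_pow, coact_d, Units.val_mul,
    map_mul, map_zpow_eq_tmul _ (coact_D q), map_zpow_eq_tmul _ (coact_c q),
    Algebra.TensorProduct.tmul_mul_tmul, ← Units.val_mul, ← Units.val_mul]

/-- The cleaving map of the second chart. -/
noncomputable def cleaving : OP q →ₗ[ℂ] A2 q :=
  (OP.basis q).constr ℂ fun i => ((-1) ^ i.1 * q ^ i.1) •
    (↑(D q ^ i.1 * c q ^ i.2.1) * d q ^ i.2.2)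

/-- The convolution inverse of the cleaving map of the second chart. -/
noncomputable def cleavingInv : OP q →ₗ[ℂ] A2 q :=
  (OP.basis q).constr ℂ fun i => ((-1) ^ i.1 * q ^ (-i.1 + (i.2.2 : ℤ) * ((i.2.2 : ℤ) - 1))) •
    (d q ^ i.2.2 * ↑(c q ^ (-i.2.1) * D q ^ (-(i.2.2 : ℤ) - i.1)))

theorem cleaving_monomial (p m : ℤ) (r : ℕ) : cleaving q (OP.monomial q (p, m, r)) =
    ((-1) ^ p * q ^ p) • (↑(D q ^ p * c q ^ m) * d q ^ r) := by
  rw [← OP.basis_apply, cleaving, Module.Basis.constr_basis]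

theorem cleavingInv_monomial (p m : ℤ) (r : ℕ) : cleavingInv q (OP.monomial q (p, m, r)) =
    ((-1) ^ p * q ^ (-p + (r : ℤ) * ((r : ℤ) - 1))) •
      (d q ^ r * ↑(c q ^ (-m) * D q ^ (-(r : ℤ) - p))) := by
  rw [← OP.basis_apply, cleavingInv, Module.Basis.constr_basis]

theorem isComoduleMap_cleaving : IsComoduleMap (cleaving q) := by
  refine isComoduleMap_of_basis (OP.basis q) ?_
  rintro ⟨p, m, r⟩
  rw [OP.basis_apply, cleaving_monomial, map_smul, coact_monomial, OP.comul_monomial, map_sum,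
    Finset.smul_sum]
  refine Finset.sum_congr rfl fun x _ => ?_
  rw [map_smul, TensorProduct.map_tmul, cleaving_monomial, ← smul_tmul', smul_comm]
  rfl

theorem cleaving_mul_cleavingInv (p m : ℤ) (j k : ℕ) :
    (q ^ (k * j)) • (cleaving q (OP.monomial q (p, m + k, j)) *
        cleavingInv q (OP.monomial q (p + j, m - j, k))) =
      (-1 : ℂ) ^ j • q ^ (((k + j : ℕ) : ℤ) * (((k + j : ℕ) : ℤ) - 1 - m)) •
        (↑(D q ^ p * c q ^ ((k + j : ℕ) : ℤ)) * d q ^ (k + j) *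
          ↑(D q ^ (-((k + j : ℕ) : ℤ) - p)) : A2 q) := by
  have hq := NeZero.ne q
  rw [cleaving_monomial, cleavingInv_monomial, smul_mul_smul_comm, mul_assoc _ (d q ^ j),
    ← mul_assoc (d q ^ j), ← pow_add, add_comm j, Units.val_mul (c q ^ _), ← mul_assoc (d q ^ _),
    smul_pow_zpow_swap hq (d_mul_c q), smul_mul_assoc, mul_smul_comm, smul_smul, smul_smul,
    smul_smul, mul_assoc (↑(c q ^ _) : A2 q), ← mul_assoc _ (↑(c q ^ _) : A2 q), ← Units.val_mul,
    mul_assoc (D q ^ p), ← zpow_add, mul_assoc _ (d q ^ _)]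
  have e1 : m + k + -(m - j) = ((k + j : ℕ) : ℤ) := by push_cast; ring
  have e2 : -(k : ℤ) - (p + j) = -((k + j : ℕ) : ℤ) - p := by push_cast; ring
  rw [e1, e2]
  congr 1
  have h1 : (-1 : ℂ) ^ p * (-1) ^ (p + j : ℤ) = (-1) ^ j := by
    rw [← zpow_add₀ (by norm_num), ← add_assoc, zpow_add₀ (by norm_num),
      Even.neg_one_zpow (Even.add_self p), one_mul, zpow_natCast]
  rw [← h1, ← zpow_natCast q (k * j)]
  have h2 : q ^ (((k + j : ℕ) : ℤ) * (((k + j : ℕ) : ℤ) - 1 - m)) =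
      q ^ ((k * j : ℕ) : ℤ) * (q ^ p * q ^ (-(p + j) + (k : ℤ) * ((k : ℤ) - 1))) *
        q ^ (((k + j : ℕ) : ℤ) * (-(m - j))) := by
    rw [← zpow_add₀ hq, ← zpow_add₀ hq, ← zpow_add₀ hq]
    congr 1
    push_cast
    ring
  rw [h2]
  ring

theorem cleavingInv_mul_cleaving (p m : ℤ) (j k : ℕ) :
    (q ^ (k * j)) • (cleavingInv q (OP.monomial q (p, m + k, j)) *
        cleaving q (OP.monomial q (p + j, m - j, k))) =
      (-1 : ℂ) ^ j • q ^ ((k + j) * (k + j)) •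
        (d q ^ (k + j) * ↑(c q ^ (-((k + j : ℕ) : ℤ))) : A2 q) := by
  have hq := NeZero.ne q
  rw [cleaving_monomial, cleavingInv_monomial, smul_mul_smul_comm]
  have e0 : c q ^ (-(m + k)) * D q ^ (-(j : ℤ) - p) * (D q ^ (p + j) * c q ^ (m - j)) =
      c q ^ (-((k + j : ℕ) : ℤ)) := by
    rw [mul_assoc, ← mul_assoc (D q ^ _), ← zpow_add, show -(j : ℤ) - p + (p + j) = 0 by ring,
      zpow_zero, one_mul, ← zpow_add]
    congr 1
    push_cast
    ring
  have e3 : (↑(c q ^ (-((k + j : ℕ) : ℤ))) : A2 q) * d q ^ k =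
      q ^ (k * (k + j)) • (d q ^ k * ↑(c q ^ (-((k + j : ℕ) : ℤ)))) := by
    rw [smul_pow_zpow_swap hq (d_mul_c q), smul_smul, ← zpow_natCast, ← zpow_add₀ hq]
    push_cast
    rw [show (k : ℤ) * (k + j) + k * -(k + j) = 0 by ring, zpow_zero, one_smul]
  rw [mul_assoc (d q ^ j), ← mul_assoc _ _ (d q ^ k), ← Units.val_mul, e0, e3, mul_smul_comm,
    ← mul_assoc (d q ^ j), ← pow_add, add_comm j, smul_smul, smul_smul, smul_smul]
  congr 1
  have h1 : (-1 : ℂ) ^ p * (-1) ^ (p + j : ℤ) = (-1) ^ j := by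
    rw [← zpow_add₀ (by norm_num), ← add_assoc, zpow_add₀ (by norm_num),
      Even.neg_one_zpow (Even.add_self p), one_mul, zpow_natCast]
  rw [← h1, ← zpow_natCast q (k * j), ← zpow_natCast q (k * (k + j)),
    ← zpow_natCast q ((k + j) * (k + j))]
  have h2 : q ^ (((k + j) * (k + j) : ℕ) : ℤ) =
      q ^ ((k * j : ℕ) : ℤ) * (q ^ (-p + (j : ℤ) * ((j : ℤ) - 1)) * q ^ (p + j)) *
        q ^ ((k * (k + j) : ℕ) : ℤ) := by
    rw [← zpow_add₀ hq, ← zpow_add₀ hq, ← zpow_add₀ hq]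
    congr 1
    push_cast
    ring
  rw [h2]
  ring

theorem cleaving_convMul : WithConv.toConv (cleaving q) * WithConv.toConv (cleavingInv q) = 1 := by
  refine convMul_eq_one_of_basis (OP.basis q) ?_
  rintro ⟨p, m, r⟩
  rw [OP.basis_apply, OP.comul_monomial, OP.counit_monomial, map_sum, map_sum]
  have h : ∀ x ∈ Finset.HasAntidiagonal.antidiagonal r, LinearMap.mul' ℂ (A2 q)
      (TensorProduct.map (cleaving q) (cleavingInv q) (((r.choose x.1 : ℂ) * q ^ (x.1 * x.2)) •
        (OP.monomial q (p, m + x.1, x.2) ⊗ₜ[ℂ] OP.monomial q (p + x.2, m - x.2, x.1)))) =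
      ((r.choose x.1 : ℂ) * (-1) ^ x.2) • q ^ ((r : ℤ) * ((r : ℤ) - 1 - m)) •
        (↑(D q ^ p * c q ^ (r : ℤ)) * d q ^ r * ↑(D q ^ (-(r : ℤ) - p)) : A2 q) := by
    rintro ⟨k, j⟩ hx
    obtain rfl : k + j = r := Finset.HasAntidiagonal.mem_antidiagonal.1 hx
    rw [map_smul, map_smul, TensorProduct.map_tmul, LinearMap.mul'_apply, mul_smul,
      cleaving_mul_cleavingInv, mul_smul]
  rw [Finset.sum_congr rfl h, ← Finset.sum_smul, sum_antidiagonal_alternating]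
  rcases Nat.eq_zero_or_pos r with rfl | hr
  · simp [← Units.val_mul]
  · rw [zero_pow hr.ne', zero_smul, map_zero]

theorem convMul_cleaving : WithConv.toConv (cleavingInv q) * WithConv.toConv (cleaving q) = 1 := by
  refine convMul_eq_one_of_basis (OP.basis q) ?_
  rintro ⟨p, m, r⟩
  rw [OP.basis_apply, OP.comul_monomial, OP.counit_monomial, map_sum, map_sum]
  have h : ∀ x ∈ Finset.HasAntidiagonal.antidiagonal r, LinearMap.mul' ℂ (A2 q)
      (TensorProduct.map (cleavingInv q) (cleaving q) (((r.choose x.1 : ℂ) * q ^ (x.1 * x.2)) •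
        (OP.monomial q (p, m + x.1, x.2) ⊗ₜ[ℂ] OP.monomial q (p + x.2, m - x.2, x.1)))) =
      ((r.choose x.1 : ℂ) * (-1) ^ x.2) • q ^ (r * r) •
        (d q ^ r * ↑(c q ^ (-(r : ℤ))) : A2 q) := by
    rintro ⟨k, j⟩ hx
    obtain rfl : k + j = r := Finset.HasAntidiagonal.mem_antidiagonal.1 hx
    rw [map_smul, map_smul, TensorProduct.map_tmul, LinearMap.mul'_apply, mul_smul,
      cleavingInv_mul_cleaving, mul_smul]
  rw [Finset.sum_congr rfl h, ← Finset.sum_smul, sum_antidiagonal_alternating]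
  rcases Nat.eq_zero_or_pos r with rfl | hr
  · simp
  · rw [zero_pow hr.ne', zero_smul, map_zero]

theorem isCleavingMap : IsCleavingMap (cleaving q) :=
  ⟨isComoduleMap_cleaving q, ⟨⟨_, _, cleaving_convMul q, convMul_cleaving q⟩, rfl⟩⟩

theorem cleaving_one : cleaving q 1 = 1 := by
  have := cleaving_monomial q 0 0 0
  simpa [OP.monomial] using this

theorem cleaving_s : cleaving q (OP.s q) = (-q⁻¹) • (↑(c q)⁻¹ * D q : A2 q) := by
  have hq := NeZero.ne q
  have hs : OP.s q = OP.monomial q (1, -1, 0) := by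
    rw [OP.s_eq, ((OP.commute_t_D q).inv_left).eq]
    simp [OP.monomial]
  have h : (↑(c q)⁻¹ * D q : A2 q) = q ^ 2 • (D q * ↑(c q)⁻¹ : A2 q) := by
    rw [Units.inv_mul_eq_iff_eq_mul, mul_smul_comm, ← mul_assoc, c_mul_D, smul_mul_assoc, smul_smul,
      mul_inv_cancel₀ (pow_ne_zero 2 hq), one_smul, Units.mul_inv_cancel_right]
  rw [hs, cleaving_monomial, h, smul_smul]
  simp only [zpow_one, zpow_neg_one, Units.val_mul, pow_zero, mul_one]
  congr 1
  field_simp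

theorem isPolynomialCleft : IsPolynomialCleft (OP.basis q) (cleaving q) (z q) := by
  set w : (ℤ × ℤ × ℕ) × ℕ → ℂˣ := fun i =>
    Units.mk0 ((-1) ^ i.1.1 * q ^ i.1.1)
      (mul_ne_zero (zpow_ne_zero _ (by norm_num)) (zpow_ne_zero _ (NeZero.ne q))) with hw
  have h : (fun i : (ℤ × ℤ × ℕ) × ℕ => z q ^ i.2 * cleaving q (OP.basis q i.1)) =
      w • monomial q := by
    funext ⟨⟨p, m, r⟩, k⟩
    rw [OP.basis_apply, cleaving_monomial, mul_smul_comm]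
    rfl
  refine ⟨isCleavingMap q, cleaving_one q, coact_z q, ?_, ?_, ?_⟩
  · rw [h]
    exact (linearIndependent_monomial q).units_smul w
  · rw [h, eq_top_iff, ← span_monomial q]
    refine Submodule.span_le.2 ?_
    rintro _ ⟨i, rfl⟩
    have : monomial q i = (w i)⁻¹ • (w • monomial q) i := by simp
    rw [this]
    exact Submodule.smul_mem _ ((w i)⁻¹ : ℂˣ).val (Submodule.subset_span ⟨i, rfl⟩)
  · rintro ⟨p, m, r⟩
    rw [OP.basis_apply, cleaving_monomial, Units.val_mul]
    obtain ⟨s, hs, hs'⟩ := (((qcomm_Dz q).symm.zpow_right p).symm.mul_left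
      ((qcomm_cz q).symm.zpow_right m).symm).mul_left ((qcomm_dz q).symm.pow_right r).symm
    exact ⟨s, hs, by rw [smul_mul_assoc, hs', mul_smul_comm, smul_comm]⟩

theorem not_map_mul (hq : q ^ 2 ≠ 1) :
    ¬ ∀ h k : OP q, cleaving q (h * k) = cleaving q h * cleaving q k := by
  intro hmul
  have h := hmul (OP.n q) (OP.D q)
  have e1 := cleaving_monomial q 0 0 1
  have e2 := cleaving_monomial q 1 0 0
  have e3 := cleaving_monomial q 1 0 1
  simp only [OP.monomial, zpow_zero, zpow_one, mul_one, one_mul, pow_zero, pow_one, one_smul,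
    Units.val_one] at e1 e2 e3
  rw [OP.n_mul_D, map_smul, e1, e2, e3, mul_smul_comm, d_mul_D, smul_smul, ← sub_eq_zero,
    ← sub_smul, smul_eq_zero] at h
  rcases h with h | h
  · have h0 : q * (q ^ 2 - 1) = 0 := by linear_combination -h
    rcases mul_eq_zero.1 h0 with h | h
    · exact NeZero.ne q h
    · exact hq (sub_eq_zero.1 h)
  · refine (linearIndependent_monomial q).ne_zero ((1, 0, 1), 0) ?_
    simpa [monomial] using h

end A2

/-! ### The open sets of the projective line -/

section Opens
open scoped LinearAlgebra.Projectivization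

theorem mem_chart_mk {v : Fin 2 → ℂ} (hv : v ≠ 0) (i : Fin 2) :
    (show P1 from Projectivization.mk ℂ v hv) ∈ chart i ↔ v i ≠ 0 := by
  obtain ⟨a, ha⟩ := Projectivization.exists_smul_eq_mk_rep ℂ v hv
  change (Projectivization.mk ℂ v hv).rep i ≠ 0 ↔ _
  rw [← ha, Pi.smul_apply, Units.smul_def, smul_eq_mul, mul_ne_zero_iff]
  exact and_iff_right a.ne_zero

theorem mem_chart_or (x : P1) : x ∈ chart 0 ∨ x ∈ chart 1 := by
  by_contra! h
  refine Projectivization.rep_nonzero (show ℙ ℂ (Fin 2 → ℂ) from x) (funext fun i => ?_)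
  fin_cases i
  · exact not_not.1 h.1
  · exact not_not.1 h.2

theorem chart_sup : chart 0 ⊔ chart 1 = ⊤ := top_unique fun x _ => mem_chart_or x

theorem not_chart_zero_le : ¬ chart 0 ≤ chart 1 := fun h => by
  have hv : (![1, 0] : Fin 2 → ℂ) ≠ 0 := fun h => one_ne_zero (congrFun h 0)
  have := h ((mem_chart_mk hv 0).2 (by simp))
  exact (mem_chart_mk hv 1).1 this (by simp)

theorem not_chart_one_le : ¬ chart 1 ≤ chart 0 := fun h => by
  have hv : (![0, 1] : Fin 2 → ℂ) ≠ 0 := fun h => one_ne_zero (congrFun h 1)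
  have := h ((mem_chart_mk hv 1).2 (by simp))
  exact (mem_chart_mk hv 0).1 this (by simp)

theorem not_chart_inf_le : ¬ chart 0 ⊓ chart 1 ≤ ⊥ := fun h => by
  have hv : (![1, 1] : Fin 2 → ℂ) ≠ 0 := fun h => one_ne_zero (congrFun h 1)
  exact h (show _ ∈ chart 0 ⊓ chart 1 from
    ⟨(mem_chart_mk hv 0).2 (by simp), (mem_chart_mk hv 1).2 (by simp)⟩)

/-- A point that lies in all charts that contain `x` lies in all open sets that contain `x`. -/
theorem mem_of_mem_chart {x y : P1} (h : ∀ i, x ∈ chart i → y ∈ chart i) {U : Opens P1}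
    (hx : x ∈ U) : y ∈ U := by
  obtain ⟨U, hU⟩ := U
  change x ∈ U at hx
  change y ∈ U
  change TopologicalSpace.GenerateOpen (Set.range chartSet) U at hU
  induction hU with
  | basic s hs => obtain ⟨i, rfl⟩ := hs; exact h i hx
  | univ => trivial
  | inter s t _ _ hs ht => exact ⟨hs hx.1, ht hx.2⟩
  | sUnion S _ ih => obtain ⟨s, hs, hxs⟩ := hx; exact ⟨s, hs, ih s hs hxs⟩

theorem le_one_or (U : Opens P1) : U ≤ chart 1 ∨ chart 0 ≤ U := by
  by_contra! h
  obtain ⟨x, hx, hx1⟩ := Set.not_subset.1 h.1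
  refine h.2 fun y hy => mem_of_mem_chart (fun i hi => ?_) hx
  fin_cases i
  · exact hy
  · exact absurd hi hx1

theorem le_zero_or (U : Opens P1) : U ≤ chart 0 ∨ chart 1 ≤ U := by
  by_contra! h
  obtain ⟨x, hx, hx1⟩ := Set.not_subset.1 h.1
  refine h.2 fun y hy => mem_of_mem_chart (fun i hi => ?_) hx
  fin_cases i
  · exact absurd hi hx1
  · exact hy

theorem le_bot_or (U : Opens P1) : U ≤ ⊥ ∨ chart 0 ⊓ chart 1 ≤ U := by
  by_contra! h
  obtain ⟨x, hx, -⟩ := Set.not_subset.1 h.1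
  refine h.2 fun y hy => mem_of_mem_chart (fun i _ => ?_) hx
  fin_cases i
  · exact hy.1
  · exact hy.2

namespace OpenKind

/-- The open set with a given label. -/
def upper : OpenKind → Opens P1
  | whole => ⊤
  | one => chart 0
  | two => chart 1
  | both => chart 0 ⊓ chart 1
  | empty => ⊥

theorem of_upper (k : OpenKind) : of k.upper = k := by
  cases k
  · simp [of, upper]
  · simp [of, upper, not_chart_one_le]
  · simp [of, upper, not_chart_zero_le]
  · simp [of, upper, not_chart_zero_le, not_chart_one_le]
  · have h := not_chart_inf_le
    have h0 : ¬ chart 0 ≤ ⊥ := fun h0 => h (inf_le_left.trans h0)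
    have h1 : ¬ chart 1 ≤ ⊥ := fun h1 => h (inf_le_right.trans h1)
    simp only [of, upper, sup_le_iff, h, h0, h1, and_self, if_false]

theorem le_upper (U : Opens P1) : U ≤ (of U).upper := by
  unfold of
  split_ifs with h h0 h1 h2
  · exact le_top
  · exact (le_zero_or U).resolve_right fun h1 => h (sup_le h0 h1)
  · exact (le_one_or U).resolve_right h0
  · exact le_inf ((le_zero_or U).resolve_right h1) ((le_one_or U).resolve_right h0)
  · exact (le_bot_or U).resolve_right h2

theorem upper_mono {k l : OpenKind} (h : l.le k) : l.upper ≤ k.upper := by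
  cases k <;> cases l <;> first | exact h.elim | simp [upper]

end OpenKind
end Opens

/-! ### Sheaves on the projective line -/

namespace AlgPresheaf
variable {X : TopCat.{0}} (F : TopCat.Presheaf (AlgCat.{0} ℂ) X)

/-- Restriction of sections in a presheaf of algebras. -/
def res {U V : Opens X} (h : U ≤ V) : F.obj (op V) →ₐ[ℂ] F.obj (op U) := (F.map (homOfLE h).op).hom

theorem res_res {U V W : Opens X} (h : U ≤ V) (h' : V ≤ W) (x : F.obj (op W)) :
    res F h (res F h' x) = res F (h.trans h') x := by
  have : (homOfLE h').op ≫ (homOfLE h).op = (homOfLE (h.trans h')).op := rfl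
  rw [res, res, res, ← this, F.map_comp]
  rfl

theorem res_self {U : Opens X} (h : U ≤ U) (x : F.obj (op U)) : res F h x = x := by
  have : (homOfLE h).op = 𝟙 (op U) := rfl
  rw [res, this, F.map_id]
  rfl

theorem subsingleton_bot {F : TopCat.Presheaf (AlgCat.{0} ℂ) X} (hF : F.IsSheaf) :
    Subsingleton (F.obj (op ⊥)) := by
  obtain ⟨s, -, hs⟩ := TopCat.Sheaf.existsUnique_gluing' (⟨F, hF⟩ : TopCat.Sheaf _ X)
    (ι := PEmpty.{1}) (fun i => i.elim) ⊥ (fun i => i.elim) bot_le (fun i => i.elim)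
    (fun i => i.elim)
  exact ⟨fun x y => (hs x fun i => i.elim).trans (hs y fun i => i.elim).symm⟩

/-- A presheaf of algebras on the projective line that is zero over the empty set and has unique
gluing for the covering by the two charts is a sheaf. -/
theorem isSheaf_of_charts (F : TopCat.Presheaf (AlgCat.{0} ℂ) P1)
    (h0 : Subsingleton (F.obj (op ⊥)))
    (hglue : ∀ (s : F.obj (op (chart 0))) (t : F.obj (op (chart 1))),
      res F inf_le_left s = res F inf_le_right t →
      ∃! w : F.obj (op ⊤), res F le_top w = s ∧ res F le_top w = t) : F.IsSheaf := by
  rw [TopCat.Presheaf.isSheaf_iff_isSheafUniqueGluing]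
  intro ι U sf hc
  have hc' : ∀ i j W (hi : W ≤ U i) (hj : W ≤ U j), res F hi (sf i) = res F hj (sf j) := by
    intro i j W hi hj
    have h : res F inf_le_left (sf i) = res F inf_le_right (sf j) := hc i j
    have := congrArg (res F (le_inf hi hj)) h
    rwa [res_res, res_res] at this
  change ∃! s : F.obj (op (iSup U)), ∀ i, res F (le_iSup U i) s = sf i
  have hA : ∀ i, iSup U ≤ U i → ∃! s : F.obj (op (iSup U)), ∀ i, res F (le_iSup U i) s = sf i := by
    intro i hi
    refine ⟨res F hi (sf i), fun j => ?_, fun s hs => ?_⟩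
    · rw [res_res, hc' i j _ _ le_rfl, res_self]
    · rw [← hs i, res_res, res_self]
  have hi0 (h : chart 0 ≤ iSup U) : ∃ i, chart 0 ≤ U i := by
    by_contra! hn
    exact not_chart_zero_le (h.trans (iSup_le fun i => (le_one_or (U i)).resolve_right (hn i)))
  have hi1 (h : chart 1 ≤ iSup U) : ∃ i, chart 1 ≤ U i := by
    by_contra! hn
    exact not_chart_one_le (h.trans (iSup_le fun i => (le_zero_or (U i)).resolve_right (hn i)))
  rcases le_one_or (iSup U) with ha | ha <;> rcases le_zero_or (iSup U) with hb | hb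
  · rcases le_bot_or (iSup U) with hbot | hinf
    · have hsub : ∀ V : Opens P1, V ≤ ⊥ → Subsingleton (F.obj (op V)) := by
        intro V hV
        rwa [le_bot_iff.1 hV]
      have := hsub _ hbot
      have h1 : ∀ i, Subsingleton (F.obj (op (U i))) := fun i => hsub _ ((le_iSup U i).trans hbot)
      exact ⟨0, fun i => Subsingleton.elim _ _, fun s _ => Subsingleton.elim _ _⟩
    · have : ∃ i, chart 0 ⊓ chart 1 ≤ U i := by
        by_contra! hn
        exact not_chart_inf_le
          (hinf.trans (iSup_le fun i => (le_bot_or (U i)).resolve_right (hn i)))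
      obtain ⟨i, hi⟩ := this
      exact hA i ((le_inf hb ha).trans hi)
  · obtain ⟨i, hi⟩ := hi1 hb
    exact hA i (ha.trans hi)
  · obtain ⟨i, hi⟩ := hi0 ha
    exact hA i (hb.trans hi)
  · by_cases hex : ∃ i, iSup U ≤ U i
    · obtain ⟨i, hi⟩ := hex
      exact hA i hi
    obtain ⟨i, hi⟩ := hi0 ha
    obtain ⟨j, hj⟩ := hi1 hb
    have htop : ⊤ ≤ iSup U := chart_sup ▸ sup_le ha hb
    obtain ⟨w, ⟨hw0, hw1⟩, huniq⟩ := hglue (res F hi (sf i)) (res F hj (sf j)) (by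
      rw [res_res, res_res]
      exact hc' i j _ _ _)
    refine ⟨res F le_top w, fun k => ?_, fun s hs => ?_⟩
    · rw [res_res]
      rcases le_one_or (U k) with hk | hk
      · rw [← res_res F hk le_top, hw1, res_res, hc' j k _ _ le_rfl, res_self]
      rcases le_zero_or (U k) with hk' | hk'
      · rw [← res_res F hk' le_top, hw0, res_res, hc' i k _ _ le_rfl, res_self]
      exact absurd ⟨k, le_top.trans (chart_sup ▸ sup_le hk hk')⟩ hex
    · rw [← huniq (res F htop s) ⟨?_, ?_⟩, res_res, res_self]
      · rw [← hs i, res_res, res_res]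
      · rw [← hs j, res_res, res_res]

end AlgPresheaf

namespace AlgSquare
variable (S : AlgSquare)

theorem existsUnique_glue
    (hS : ∀ (x : S.R₁) (y : S.R₂), S.r₁.hom x = S.r₂.hom y →
      ∃! w : S.G, S.g₁.hom w = x ∧ S.g₂.hom w = y)
    (k k₁ k₂ k₁₂ : OpenKind) (hk : k = .whole) (h₁ : k₁ = .one) (h₂ : k₂ = .two) (h₁₂ : k₁₂ = .both)
    (a₁ : k₁.le k) (a₂ : k₂.le k) (b₁ : k₁₂.le k₁) (b₂ : k₁₂.le k₂) (x : S.obj k₁) (y : S.obj k₂)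
    (hxy : (S.res k₁ k₁₂ b₁).hom x = (S.res k₂ k₁₂ b₂).hom y) :
    ∃! w : S.obj k, (S.res k k₁ a₁).hom w = x ∧ (S.res k k₂ a₂).hom w = y := by
  subst hk h₁ h₂ h₁₂
  exact hS x y hxy

theorem isSheaf_presheaf
    (hS : ∀ (x : S.R₁) (y : S.R₂), S.r₁.hom x = S.r₂.hom y →
      ∃! w : S.G, S.g₁.hom w = x ∧ S.g₂.hom w = y) : S.presheaf.IsSheaf := by
  refine AlgPresheaf.isSheaf_of_charts _ ?_ fun s t hst => ?_
  · have h : ∀ k : OpenKind, k = .empty → Subsingleton (S.obj k) := by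
      rintro k rfl
      exact inferInstanceAs (Subsingleton PUnit)
    exact h _ (OpenKind.of_upper .empty)
  · exact S.existsUnique_glue hS _ _ _ _ (OpenKind.of_upper .whole) (OpenKind.of_upper .one)
      (OpenKind.of_upper .two) (OpenKind.of_upper .both) _ _ _ _ s t hst

/-- A morphism of presheaves out of the presheaf of a square. -/
noncomputable def homOfKinds {S : AlgSquare} {G : TopCat.Presheaf (AlgCat.{0} ℂ) P1}
    (τ : ∀ k : OpenKind, S.obj k ⟶ G.obj (op k.upper))
    (hτ : ∀ (k l : OpenKind) (h : l.le k),
      τ k ≫ G.map (homOfLE (OpenKind.upper_mono h)).op = S.res k l h ≫ τ l) : S.presheaf ⟶ G where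
  app U := τ (OpenKind.of U.unop) ≫ G.map (homOfLE (OpenKind.le_upper U.unop)).op
  naturality U V f := by
    change S.res _ _ (OpenKind.of_mono f.unop.le) ≫ _ ≫ _ = _
    rw [← Category.assoc, ← hτ, Category.assoc]
    refine Eq.trans ?_ (Category.assoc (τ _) _ _).symm
    rw [← G.map_comp, ← G.map_comp]
    rfl

theorem homOfKinds_app {S : AlgSquare} {G : TopCat.Presheaf (AlgCat.{0} ℂ) P1}
    (τ : ∀ k : OpenKind, S.obj k ⟶ G.obj (op k.upper))
    (hτ : ∀ (k l : OpenKind) (h : l.le k),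
      τ k ≫ G.map (homOfLE (OpenKind.upper_mono h)).op = S.res k l h ≫ τ l)
    (k : OpenKind) (T : Subalgebra ℂ (G.obj (op k.upper)))
    (h : Function.Injective (τ k).hom ∧ (τ k).hom.range = T) :
    Function.Injective ((homOfKinds τ hτ).app (op k.upper)).hom ∧
      ((homOfKinds τ hτ).app (op k.upper)).hom.range = T := by
  have key : ∀ (k' : OpenKind) (_ : k' = k) (hle : k.upper ≤ k'.upper),
      Function.Injective (τ k' ≫ G.map (homOfLE hle).op).hom ∧
        (τ k' ≫ G.map (homOfLE hle).op).hom.range = T := by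
    rintro k' rfl hle
    have : (homOfLE hle).op = 𝟙 (op k'.upper) := rfl
    rw [this, G.map_id, Category.comp_id]
    exact h
  exact key _ (OpenKind.of_upper k) _

end AlgSquare

/-! ### The structure sheaf of the line -/

section Line
open Polynomial LaurentPolynomial

theorem aeval_T_one (p : ℂ[X]) : aeval (R := ℂ) (T 1 : ℂ[T;T⁻¹]) p = toLaurent p := by
  have : aeval (R := ℂ) (T 1 : ℂ[T;T⁻¹]) = toLaurentAlg := by
    refine algHom_ext ?_
    simp
  rw [this]
  rfl

theorem aeval_T_neg_one (p : ℂ[X]) :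
    aeval (R := ℂ) (T (-1) : ℂ[T;T⁻¹]) p = invert (toLaurent p) := by
  have : aeval (R := ℂ) (T (-1) : ℂ[T;T⁻¹]) =
      (invert : ℂ[T;T⁻¹] ≃ₐ[ℂ] ℂ[T;T⁻¹]).toAlgHom.comp toLaurentAlg := by
    refine algHom_ext ?_
    simp
  rw [this]
  rfl

theorem isSheaf_lineSquare : lineSquare.presheaf.IsSheaf := by
  refine AlgSquare.isSheaf_presheaf _ fun (x : ℂ[X]) (y : ℂ[X]) hxy => ?_
  have h : toLaurent x = invert (toLaurent y) := by
    rw [← aeval_T_one, ← aeval_T_neg_one]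
    exact hxy
  have h' (n : ℤ) : (toLaurent x).coeff n = (toLaurent y).coeff (-n) := by
    rw [h, invert_apply]
  have hn (p : ℂ[X]) (n : ℕ) : (toLaurent p).coeff (n : ℤ) = p.coeff n := by
    rw [coeff_toLaurent]
    exact Finsupp.mapDomain_apply Nat.cast_injective _ _
  have hneg (p : ℂ[X]) (n : ℕ) : (toLaurent p).coeff (-((n + 1 : ℕ) : ℤ)) = 0 := by
    rw [coeff_toLaurent]
    refine Finsupp.mapDomain_of_notMem_range _ _ ?_
    rintro ⟨m, hm⟩
    have : (m : ℤ) = -((n + 1 : ℕ) : ℤ) := hm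
    omega
  have hx (n : ℕ) : x.coeff (n + 1) = 0 := by rw [← hn, h', hneg]
  have hy (n : ℕ) : y.coeff (n + 1) = 0 := by
    rw [← hn, ← neg_neg ((n + 1 : ℕ) : ℤ), ← h', hneg]
  have h0 : x.coeff 0 = y.coeff 0 := by rw [← hn, h', ← hn]; rfl
  refine ⟨x.coeff 0, ⟨?_, ?_⟩, fun w hw => ?_⟩
  · change Polynomial.C (x.coeff 0) = x
    ext n
    cases n
    · simp
    · rw [hx, coeff_C_succ]
  · change Polynomial.C (x.coeff 0) = y
    ext n
    cases n
    · simp [h0]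
    · rw [hy, coeff_C_succ]
  · have hw1 : Polynomial.C (show ℂ from w) = x := hw.1
    rw [← hw1, coeff_C_zero]

end Line

section Coordinates
open Polynomial LaurentPolynomial
variable {R : Type} [Ring R] [Algebra ℂ R]

/-- The algebra map that sends the coordinate of the punctured line to a unit. -/
noncomputable def laurentLift (u : Rˣ) : ℂ[T;T⁻¹] →ₐ[ℂ] R :=
  AddMonoidAlgebra.lift ℂ R ℤ ((Units.coeHom R).comp (zpowersHom Rˣ u))

theorem laurentLift_T (u : Rˣ) (n : ℤ) : laurentLift u (T n) = ↑(u ^ n) := by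
  rw [laurentLift, T, AddMonoidAlgebra.lift_single, one_smul]
  rfl

variable {F : TopCat.Presheaf (AlgCat.{0} ℂ) P1}
  (z : F.obj (op (chart 0))) (w : F.obj (op (chart 1)))
  (u : (F.obj (op (chart 0 ⊓ chart 1)))ˣ)

/-- The maps from the structure sheaf of the line given by coordinates on the charts. -/
noncomputable def coordinateMap (h0 : Subsingleton (F.obj (op ⊥))) :
    ∀ k : OpenKind, lineSquare.obj k ⟶ F.obj (op k.upper)
  | .whole => AlgCat.ofHom (Algebra.ofId ℂ (F.obj (op ⊤)))
  | .one => AlgCat.ofHom (aeval z)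
  | .two => AlgCat.ofHom (aeval w)
  | .both => AlgCat.ofHom (laurentLift u)
  | .empty => AlgCat.ofHom
      (AlgHom.ofLinearMap (0 : PUnit →ₗ[ℂ] F.obj (op ⊥)) (h0.elim _ _) fun _ _ => h0.elim _ _)

theorem coordinateMap_naturality (h0 : Subsingleton (F.obj (op ⊥)))
    (hz : AlgPresheaf.res F (inf_le_left : chart 0 ⊓ chart 1 ≤ chart 0) z = u)
    (hw : AlgPresheaf.res F (inf_le_right : chart 0 ⊓ chart 1 ≤ chart 1) w = ↑u⁻¹)
    (k l : OpenKind) (h : l.le k) :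
    coordinateMap z w u h0 k ≫ F.map (homOfLE (OpenKind.upper_mono h)).op =
      lineSquare.res k l h ≫ coordinateMap z w u h0 l := by
  have hself : ∀ (k : OpenKind) (h : k.upper ≤ k.upper),
      coordinateMap z w u h0 k ≫ F.map (homOfLE h).op = 𝟙 _ ≫ coordinateMap z w u h0 k := by
    intro k h
    have : (homOfLE h).op = 𝟙 (op k.upper) := rfl
    rw [this, F.map_id, Category.comp_id, Category.id_comp]
  have hwhole : ∀ (R : AlgCat.{0} ℂ) (f g : AlgCat.of ℂ ℂ ⟶ R), f = g := fun R f g =>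
    AlgCat.hom_ext _ (Subsingleton.elim (α := ℂ →ₐ[ℂ] R) _ _)
  cases l
  case empty => exact AlgCat.hom_ext _ (AlgHom.ext fun _ => h0.elim _ _)
  all_goals cases k <;> first | exact h.elim | skip
  all_goals first | exact hself _ _ | exact hwhole _ _ _ | skip
  · refine AlgCat.hom_ext _ (Polynomial.algHom_ext ?_)
    have hX : laurentLift u (aeval (R := ℂ) (T 1 : ℂ[T;T⁻¹]) X) = _ := congrArg _ (aeval_X _)
    exact (congrArg (AlgPresheaf.res F inf_le_left) (aeval_X z)).trans
      (hz.trans ((hX.trans (laurentLift_T u _)).trans (by rw [zpow_one])).symm)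
  · refine AlgCat.hom_ext _ (Polynomial.algHom_ext ?_)
    have hX : laurentLift u (aeval (R := ℂ) (T (-1) : ℂ[T;T⁻¹]) X) = _ := congrArg _ (aeval_X _)
    exact (congrArg (AlgPresheaf.res F inf_le_right) (aeval_X w)).trans
      (hw.trans ((hX.trans (laurentLift_T u _)).trans (by rw [zpow_neg_one])).symm)

end Coordinates

section Bundle
variable (q : ℂ) [NeZero q]

theorem isLocallyCleftBundle_of_hasChartSections {F : ComoduleAlgPresheaf (OP q) P1}
    (hF : F.presheaf.IsSheaf) (h : HasChartSections q F) :
    IsLocallyCleftBundle lineSquare.presheaf F chart := by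
  obtain ⟨e₁, e₂, h₁, h₂, h₁₂, h₂₁⟩ := h
  have c₁ := (A1.isPolynomialCleft q).map e₁ h₁
  have c₂ := (A2.isPolynomialCleft q).map e₂ h₂
  let u : (F.presheaf.obj (op (chart 0 ⊓ chart 1)))ˣ := ⟨_, _, h₁₂, h₂₁⟩
  let ι := AlgSquare.homOfKinds _ (coordinateMap_naturality (e₁ (A1.z q)) (e₂ (A2.z q)) u
    (AlgPresheaf.subsingleton_bot hF) rfl rfl)
  exact {
    antipode_bijective := OP.antipode_bijective q
    isSheaf_base := isSheaf_lineSquare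
    isSheaf := hF
    cover := top_unique fun x _ => Opens.mem_iSup.2 <|
      (mem_chart_or x).elim (fun h => ⟨0, h⟩) fun h => ⟨1, h⟩
    coinv := by
      refine ⟨ι, fun i => ?_⟩
      fin_cases i
      · exact AlgSquare.homOfKinds_app _ _ .one _ ⟨c₁.aeval_injective, c₁.range_aeval⟩
      · exact AlgSquare.homOfKinds_app _ _ .two _ ⟨c₂.aeval_injective, c₂.range_aeval⟩
    principal := by
      intro i
      fin_cases i
      · exact c₁.isPrincipal
      · exact c₂.isPrincipal
    cleft := by
      intro i
      fin_cases i
      · exact c₁.isCleft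
      · exact c₂.isCleft }

theorem HasLocalizationSections.hasChartSections {F : ComoduleAlgPresheaf (OP q) P1}
    (h : HasLocalizationSections q F) : HasChartSections q F := by
  obtain ⟨-, e₁, e₂, e₁₂, -, h₁, h₂, -, -, -, r₁, r₂, -⟩ := h
  have hi (x : OGL q) : res2 q (Loc.incl _ x) = res1 q (Loc.incl _ x) :=
    DFunLike.congr_fun (res2_incl q) x
  have a1 : res1 q (A1.a q) * res1 q ↑(A1.a q)⁻¹ = 1 := by
    rw [← map_mul, Units.mul_inv, map_one]
  have a2 : res1 q ↑(A1.a q)⁻¹ * res1 q (A1.a q) = 1 := by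
    rw [← map_mul, Units.inv_mul, map_one]
  have c1 : res2 q (A2.c q) * res2 q ↑(A2.c q)⁻¹ = 1 := by
    rw [← map_mul, Units.mul_inv, map_one]
  have c2 : res2 q ↑(A2.c q)⁻¹ * res2 q (A2.c q) = 1 := by
    rw [← map_mul, Units.inv_mul, map_one]
  have ea : res2 q (A2.a q) = res1 q (A1.a q) := hi _
  have ec : res1 q (A1.c q) = res2 q (A2.c q) := (hi _).symm
  have zw : res1 q (A1.z q) * res2 q (A2.z q) = 1 := by
    rw [A1.z, A2.z, map_mul, map_mul, ea, ec, ← mul_assoc,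
      mul_assoc _ _ (res1 q (A1.a q)), a2, mul_one, c1]
  have wz : res2 q (A2.z q) * res1 q (A1.z q) = 1 := by
    rw [A1.z, A2.z, map_mul, map_mul, ea, ec, ← mul_assoc,
      mul_assoc _ _ (res2 q (A2.c q)), c2, mul_one, a1]
  refine ⟨e₁, e₂, h₁, h₂, ?_, ?_⟩
  · rw [r₁, r₂]
    exact (map_mul e₁₂ _ _).symm.trans ((congrArg e₁₂ zw).trans (map_one e₁₂))
  · rw [r₁, r₂]
    exact (map_mul e₁₂ _ _).symm.trans ((congrArg e₁₂ wz).trans (map_one e₁₂))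

theorem isSheaf_bundle : (bundle q).presheaf.IsSheaf :=
  AlgSquare.isSheaf_presheaf _ fun x y hxy => by
    obtain ⟨w, hw⟩ := exists_glue q hxy
    exact ⟨w, hw, fun w' hw' => incl1_injective q (hw'.1.trans hw.1.symm)⟩

theorem hasLocalizationSections_of_kinds (k k₁ k₂ k₁₂ k₀ : OpenKind) (hk : k = .whole)
    (h₁ : k₁ = .one) (h₂ : k₂ = .two) (h₁₂ : k₁₂ = .both) (h₀ : k₀ = .empty)
    (a₁ : k₁.le k) (a₂ : k₂.le k) (b₁ : k₁₂.le k₁) (b₂ : k₁₂.le k₂) :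
    ∃ (e : OGL q ≃ₐ[ℂ] (bundleSquare q).obj k) (e₁ : A1 q ≃ₐ[ℂ] (bundleSquare q).obj k₁)
      (e₂ : A2 q ≃ₐ[ℂ] (bundleSquare q).obj k₂) (e₁₂ : A12 q ≃ₐ[ℂ] (bundleSquare q).obj k₁₂),
      IsComoduleAlgHom (OP q) e.toAlgHom ∧ IsComoduleAlgHom (OP q) e₁.toAlgHom ∧
      IsComoduleAlgHom (OP q) e₂.toAlgHom ∧ IsComoduleAlgHom (OP q) e₁₂.toAlgHom ∧
      (∀ x, ((bundleSquare q).res k k₁ a₁).hom (e x) = e₁ (Loc.incl _ x)) ∧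
      (∀ x, ((bundleSquare q).res k k₂ a₂).hom (e x) = e₂ (Loc.incl _ x)) ∧
      (∀ x, ((bundleSquare q).res k₁ k₁₂ b₁).hom (e₁ x) = e₁₂ (res1 q x)) ∧
      (∀ x, ((bundleSquare q).res k₂ k₁₂ b₂).hom (e₂ x) = e₁₂ (res2 q x)) ∧
      Subsingleton ((bundleSquare q).obj k₀) := by
  subst hk h₁ h₂ h₁₂ h₀
  exact ⟨(AlgEquiv.refl : OGL q ≃ₐ[ℂ] OGL q), (AlgEquiv.refl : A1 q ≃ₐ[ℂ] A1 q),
    (AlgEquiv.refl : A2 q ≃ₐ[ℂ] A2 q), (AlgEquiv.refl : A12 q ≃ₐ[ℂ] A12 q),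
    ComoduleAlgSquare.isComoduleAlgHom_id (OGL q), ComoduleAlgSquare.isComoduleAlgHom_id (A1 q),
    ComoduleAlgSquare.isComoduleAlgHom_id (A2 q), ComoduleAlgSquare.isComoduleAlgHom_id (A12 q),
    fun _ => rfl, fun _ => rfl, fun _ => rfl, fun _ => rfl, inferInstanceAs (Subsingleton PUnit)⟩

theorem hasLocalizationSections_bundle : HasLocalizationSections q (bundle q) :=
  hasLocalizationSections_of_kinds q _ _ _ _ _ (OpenKind.of_upper .whole) (OpenKind.of_upper .one)
    (OpenKind.of_upper .two) (OpenKind.of_upper .both) (OpenKind.of_upper .empty)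
    (OpenKind.of_mono le_top) (OpenKind.of_mono le_top) (OpenKind.of_mono inf_le_left)
    (OpenKind.of_mono inf_le_right)

end Bundle

theorem mainTheorem7 (q : ℂ) [NeZero q] :
    -- the sheaf is a locally cleft quantum principal bundle with respect to the covering by the charts
    (HasLocalizationSections q (bundle q) ∧
      IsLocallyCleftBundle lineSquare.presheaf (bundle q) chart) ∧
    -- and so is every sheaf that is glued from the two charts over the coordinate change of the line
    (∀ F : ComoduleAlgPresheaf (OP q) P1, F.presheaf.IsSheaf → HasChartSections q F →
      IsLocallyCleftBundle lineSquare.presheaf F chart) ∧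
    -- the algebra-map cleaving map of the first chart
    (∃ γ₁ : OP q →ₐ[ℂ] A1 q, IsCleavingMap γ₁.toLinearMap ∧
      γ₁ (OP.D q) = A1.D q ∧ γ₁ ↑(OP.D q)⁻¹ = ↑(A1.D q)⁻¹ ∧
      γ₁ (OP.t q) = A1.a q ∧ γ₁ ↑(OP.t q)⁻¹ = ↑(A1.a q)⁻¹ ∧
      γ₁ (OP.n q) = A1.b q ∧ γ₁ (OP.s q) = ↑(A1.a q)⁻¹ * A1.D q ∧
      WithConv.toConv γ₁.toLinearMap *
        WithConv.toConv (γ₁.toLinearMap ∘ₗ HopfAlgebra.antipode ℂ) = 1 ∧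
      WithConv.toConv (γ₁.toLinearMap ∘ₗ HopfAlgebra.antipode ℂ) *
        WithConv.toConv γ₁.toLinearMap = 1) ∧
    -- the cleaving map of the second chart, with its convolution inverse
    (∃ B : Module.Basis (ℤ × ℤ × ℕ) ℂ (OP q),
      (∀ (p m : ℤ) (r : ℕ), B (p, m, r) = ↑(OP.D q ^ p * OP.t q ^ m) * OP.n q ^ r) ∧
      ∃ γ₂ γ₂' : OP q →ₗ[ℂ] A2 q,
        (∀ (p m : ℤ) (r : ℕ), γ₂ (↑(OP.D q ^ p * OP.t q ^ m) * OP.n q ^ r) =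
          ((-1) ^ p * q ^ p) • (↑(A2.D q ^ p * A2.c q ^ m) * A2.d q ^ r)) ∧
        (∀ (p m : ℤ) (r : ℕ), γ₂' (↑(OP.D q ^ p * OP.t q ^ m) * OP.n q ^ r) =
          ((-1) ^ p * q ^ (-p + (r : ℤ) * ((r : ℤ) - 1))) •
            (A2.d q ^ r * ↑(A2.c q ^ (-m) * A2.D q ^ (-(r : ℤ) - p)))) ∧
        γ₂ 1 = 1 ∧
        γ₂ (OP.s q) = (-q⁻¹) • (↑(A2.c q)⁻¹ * A2.D q : A2 q) ∧
        IsCleavingMap γ₂ ∧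
        WithConv.toConv γ₂ * WithConv.toConv γ₂' = 1 ∧
        WithConv.toConv γ₂' * WithConv.toConv γ₂ = 1 ∧
        (q ^ 2 ≠ 1 → ¬ ∀ h k : OP q, γ₂ (h * k) = γ₂ h * γ₂ k)) := by

  refine ⟨⟨hasLocalizationSections_bundle q, isLocallyCleftBundle_of_hasChartSections q
    (isSheaf_bundle q) (hasLocalizationSections_bundle q).hasChartSections⟩,
    fun F hF h => isLocallyCleftBundle_of_hasChartSections q hF h,
    ⟨A1.cleaving q, A1.isCleavingMap q, A1.cleaving_D q, A1.cleaving_D_inv q, A1.cleaving_t q,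
      A1.cleaving_inv q (A1.cleaving_t q), A1.cleaving_n q, A1.cleaving_s q,
      A1.cleaving_mul_antipode q, A1.antipode_mul_cleaving q⟩,
    ⟨OP.basis q, fun p m r => OP.basis_apply q _, A2.cleaving q, A2.cleavingInv q,
      fun p m r => A2.cleaving_monomial q p m r, fun p m r => A2.cleavingInv_monomial q p m r,
      A2.cleaving_one q, A2.cleaving_s q, A2.isCleavingMap q, A2.cleaving_convMul q,
      A2.convMul_cleaving q, A2.not_map_mul q⟩⟩
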